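/- Let $\mathcal G\rightrightarrows M$ be a Lie groupoid ($\mathcal G$ and $M$ finite-dimensional, Hausdorff, second countable smooth manifolds) and let $\mathcal V\rightrightarrows E$ be a VB-groupoid over $\mathcal G\rightrightarrows M$, i.e. $\mathcal V\to\mathcal G$ and $E\to M$ are vector bundles of finite rank whose total spaces form a Lie groupoid with source $\tilde s$, target $\tilde t$, and all structure maps vector bundle morphisms over those of $\mathcal G$. Let $C=\ker(\tilde s)|_M$ be the core, $\partial=\tilde t|_C:C\to E$ the core-anchor, and suppose that $\mathcal V$ is regular, i.e. $\partial$ has constant rank. Put $\mathfrak k=\ker\partial$ and $\mathfrak l=\operatorname{coker}\partial$, vector bundles over $M$ on which $\mathcal G$ acts by $g\cdot c=0_g\,c\,0_g^{-1}$ and $g\cdot[\tilde s(v)]=[\tilde t(v)]$ for $v\in\mathcal V_g$. Let $H^\bullet(\mathcal G,\mathfrak k)$ and $H^\bullet(\mathcal G,\mathfrak l)$ be the differentiable cohomologies with values in these representations. Let $H^\bullet_{VB}(\mathcal G,\mathcal V)$ be the cohomology of the complex with $C^0_{VB}(\mathcal G,\mathcal V)=\Gamma(C)$ and, for $k>0$,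 $C^k_{VB}(\mathcal G,\mathcal V)$ the space of smooth maps $c$ on $\mathcal G^{(k)}$ with $c(g_1,\dots,g_k)\in\mathcal V_{g_1}$ such that $\tilde s(c(g_1,\dots,g_k))$ does not depend on $g_1$; the differential is $$(\delta c)(g_1,\dots,g_{k+1})=-c(g_1g_2,g_3,\dots,g_{k+1})\cdot c(g_2,\dots,g_{k+1})^{-1}+\sum_{i=2}^{k}(-1)^i c(g_1,\dots,g_ig_{i+1},\dots,g_{k+1})+(-1)^{k+1}c(g_1,\dots,g_k)$$ for $k>0$, and $(\delta\alpha)(g)=\alpha_{t(g)}\cdot 0_g+0_g\cdot\alpha_{s(g)}^{-1}$ for $k=0$. Then the right multiplication by zero elements, $c\mapsto\big((g_1,\dots,g_k)\mapsto c(g_1,\dots,g_k)\cdot 0_{g_1}\big)$ (the inclusion $\Gamma(\mathfrak k)\subset\Gamma(C)$ for $k=0$), and the $\tilde s$-projection, $c\mapsto\big((g_2,\dots,g_k)\mapsto[\tilde s(c(g_1,\dots,g_k))]\big)$, induce linear maps $r:H^k(\mathcal G,\mathfrak k)\to H^k_{VB}(\mathcal G,\mathcal V)$ and $\pi:H^k_{VB}(\mathcal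 G,\mathcal V)\to H^{k-1}(\mathcal G,\mathfrak l)$, and there is a linear map $K:H^\bullet(\mathcal G,\mathfrak l)\to H^{\bullet+2}(\mathcal G,\mathfrak k)$ such that the sequence $$\cdots\longrightarrow H^{k}(\mathcal G,\mathfrak k)\stackrel{r}{\longrightarrow}H^{k}_{VB}(\mathcal G,\mathcal V)\stackrel{\pi}{\longrightarrow}H^{k-1}(\mathcal G,\mathfrak l)\stackrel{K}{\longrightarrow}H^{k+1}(\mathcal G,\mathfrak k)\longrightarrow\cdots$$ is exact, where all groups of negative degree are $0$. In particular $r$ is an isomorphism for $k=0$ and injective for $k=1$. -/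

import Mathlib

open Bundle Manifold ContDiff

noncomputable section

/-! ### Cohomology of a sequence of cochain spaces -/

section Cohomology

variable {A : ℕ → Type*} [∀ k, AddCommGroup (A k)] [∀ k, Module ℝ (A k)]

/-- Cocycles of degree `k`: the elements of the cochain space `C k ≤ A k` killed by `d k`. -/
def cocycles (C : ∀ k, Submodule ℝ (A k)) (d : ∀ k, A k →ₗ[ℝ] A (k + 1)) (k : ℕ) :
    Submodule ℝ (A k) :=
  C k ⊓ LinearMap.ker (d k)

/-- Coboundaries of degree `k`: the image of `C (k - 1)` under `d (k - 1)`, and `0` for `k = 0`. -/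
def coboundaries (C : ∀ k, Submodule ℝ (A k)) (d : ∀ k, A k →ₗ[ℝ] A (k + 1)) :
    ∀ k, Submodule ℝ (A k)
  | 0 => ⊥
  | k + 1 => (C k).map (d k)

/-- The cohomology space of degree `k`: cocycles modulo coboundaries. -/
abbrev Cohomology (C : ∀ k, Submodule ℝ (A k)) (d : ∀ k, A k →ₗ[ℝ] A (k + 1)) (k : ℕ) :=
  cocycles C d k ⧸ (coboundaries C d k).submoduleOf (cocycles C d k)

/-- The class of a cocycle. -/
abbrev cohomologyClass (C : ∀ k, Submodule ℝ (A k)) (d : ∀ k, A k →ₗ[ℝ] A (k + 1)) (k : ℕ) :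
    cocycles C d k →ₗ[ℝ] Cohomology C d k :=
  Submodule.mkQ _

end Cohomology

/-! ### Lie groupoids -/

/-- A Lie groupoid `G ⇉ M`. The multiplication is a total function for convenience; only its values
on composable pairs (`s g = t h`) are meaningful. -/
structure LieGroupoid {EM HM EG HG : Type*}
    [NormedAddCommGroup EM] [NormedSpace ℝ EM] [TopologicalSpace HM] (IM : ModelWithCorners ℝ EM HM)
    [NormedAddCommGroup EG] [NormedSpace ℝ EG] [TopologicalSpace HG] (IG : ModelWithCorners ℝ EG HG)
    (M G : Type*) [TopologicalSpace M] [ChartedSpace HM M]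
    [TopologicalSpace G] [ChartedSpace HG G] where
  /-- source -/
  s : G → M
  /-- target -/
  t : G → M
  /-- unit -/
  u : M → G
  /-- inversion -/
  inv : G → G
  /-- multiplication `(g, h) ↦ g h`, defined when `s g = t h` -/
  mul : G → G → G
  s_u : ∀ x, s (u x) = x
  t_u : ∀ x, t (u x) = x
  s_mul : ∀ g h, s g = t h → s (mul g h) = s h
  t_mul : ∀ g h, s g = t h → t (mul g h) = t g
  mul_assoc : ∀ g h k, s g = t h → s h = t k → mul (mul g h) k = mul g (mul h k)
  u_mul : ∀ g, mul (u (t g)) g = g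
  mul_u : ∀ g, mul g (u (s g)) = g
  s_inv : ∀ g, s (inv g) = t g
  t_inv : ∀ g, t (inv g) = s g
  mul_inv : ∀ g, mul g (inv g) = u (t g)
  inv_mul : ∀ g, mul (inv g) g = u (s g)
  submersion_s : IsSubmersion IG IM ∞ s
  smooth_t : ContMDiff IG IM ∞ t
  smooth_u : ContMDiff IM IG ∞ u
  smooth_inv : ContMDiff IG IG ∞ inv
  smooth_mul : ContMDiffOn (IG.prod IG) IG ∞ (fun p : G × G => mul p.1 p.2) {p | s p.1 = t p.2}

/-! ### The nerve of a Lie groupoid and smooth maps on it -/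

section Nerve

variable {EM EG : Type*} [NormedAddCommGroup EM] [NormedSpace ℝ EM]
  [NormedAddCommGroup EG] [NormedSpace ℝ EG]
  {M G : Type*} [TopologicalSpace M] [ChartedSpace EM M] [TopologicalSpace G] [ChartedSpace EG G]

/-- The space `G^(k)` of strings `x₀ ←g₁← x₁ ←g₂← ⋯ ←gₖ← xₖ` of `k` composable arrows:
`obj i = xᵢ` and `arr i = gᵢ₊₁`. For `k = 0` this is `M`, and for `k > 0` the objects are
determined by the arrows. -/
@[ext]
structure NerveStr (𝒢 : LieGroupoid 𝓘(ℝ, EM) 𝓘(ℝ, EG) M G) (k : ℕ) where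
  /-- the objects `x₀, …, xₖ` -/
  obj : Fin (k + 1) → M
  /-- the arrows `g₁, …, gₖ` -/
  arr : Fin k → G
  t_arr : ∀ i : Fin k, 𝒢.t (arr i) = obj i.castSucc
  s_arr : ∀ i : Fin k, 𝒢.s (arr i) = obj i.succ

namespace NerveStr

variable {𝒢 : LieGroupoid 𝓘(ℝ, EM) 𝓘(ℝ, EG) M G} {k : ℕ}

lemma s_eq_t (σ : NerveStr 𝒢 k) {i j : Fin k} (h : (i : ℕ) + 1 = j) :
    𝒢.s (σ.arr i) = 𝒢.t (σ.arr j) := by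
  rw [σ.s_arr, σ.t_arr]
  congr 1
  ext
  simpa using h

/-- The `i`-th face: the object `xᵢ` is dropped. So face `0` drops `g₁`, the last face drops the
last arrow, and the other faces replace `gᵢ, gᵢ₊₁` by the product `gᵢ gᵢ₊₁`. -/
def face (i : Fin (k + 2)) (σ : NerveStr 𝒢 (k + 1)) : NerveStr 𝒢 k where
  obj j := σ.obj (i.succAbove j)
  arr j :=
    if (j : ℕ) + 1 < i then σ.arr j.castSucc
    else if (j : ℕ) + 1 = i then 𝒢.mul (σ.arr j.castSucc) (σ.arr j.succ)
    else σ.arr j.succ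
  t_arr j := by
    split_ifs with h1 h2
    · rw [σ.t_arr, Fin.succAbove_of_castSucc_lt _ _ (by rw [Fin.lt_def]; simp; omega)]
    · rw [𝒢.t_mul _ _ (σ.s_eq_t (by simp)), σ.t_arr,
        Fin.succAbove_of_castSucc_lt _ _ (by rw [Fin.lt_def]; simp; omega)]
    · rw [σ.t_arr, Fin.succAbove_of_le_castSucc _ _ (by rw [Fin.le_def]; simp; omega)]
      congr 1
  s_arr j := by
    split_ifs with h1 h2
    · rw [σ.s_arr, Fin.succAbove_of_castSucc_lt _ _ (by rw [Fin.lt_def]; simp; omega)]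
      congr 1
    · rw [𝒢.s_mul _ _ (σ.s_eq_t (by simp)), σ.s_arr,
        Fin.succAbove_of_le_castSucc _ _ (by rw [Fin.le_def]; simp; omega)]
    · rw [σ.s_arr, Fin.succAbove_of_le_castSucc _ _ (by rw [Fin.le_def]; simp; omega)]

/-- The first arrow `g₁` of a string, and the unit at `x₀` for a string without arrows. -/
def first : ∀ {k : ℕ}, NerveStr 𝒢 k → G
  | 0, σ => 𝒢.u (σ.obj 0)
  | _ + 1, σ => σ.arr 0

/-- The string `(1, g₁, …, gₖ)`. -/
def consUnit (σ : NerveStr 𝒢 k) : NerveStr 𝒢 (k + 1) where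
  obj := Fin.cons (σ.obj 0) σ.obj
  arr := Fin.cons (𝒢.u (σ.obj 0)) σ.arr
  t_arr i := by
    induction i using Fin.cases with
    | zero => simp [𝒢.t_u]
    | succ i => rw [Fin.cons_succ, σ.t_arr, ← Fin.succ_castSucc, Fin.cons_succ]
  s_arr i := by
    induction i using Fin.cases with
    | zero => simp [𝒢.s_u]
    | succ i => simp [σ.s_arr]

lemma t_first (σ : NerveStr 𝒢 k) : 𝒢.t σ.first = σ.obj 0 := by
  cases k with
  | zero => exact 𝒢.t_u _
  | succ k => exact σ.t_arr 0

lemma s_arr_zero (σ : NerveStr 𝒢 (k + 1)) : 𝒢.s (σ.arr 0) = (face 0 σ).obj 0 := σ.s_arr 0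

lemma t_arr_zero (σ : NerveStr 𝒢 (k + 1)) : 𝒢.t (σ.arr 0) = σ.obj 0 := σ.t_arr 0

lemma face_succ_obj_zero (σ : NerveStr 𝒢 (k + 1)) (i : Fin (k + 1)) :
    (face i.succ σ).obj 0 = σ.obj 0 := by
  simp [face]

lemma first_face_zero (σ : NerveStr 𝒢 (k + 2)) : (face 0 σ).first = σ.arr 1 := by
  simp [face, first]

lemma first_face_one (σ : NerveStr 𝒢 (k + 2)) :
    (face 1 σ).first = 𝒢.mul (σ.arr 0) (σ.arr 1) := by
  simp [face, first]

lemma first_face_succ_succ (σ : NerveStr 𝒢 (k + 2)) (i : Fin (k + 1)) :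
    (face i.succ.succ σ).first = σ.first := by
  simp [face, first]

/-- A string as a point of the manifold `M^(k+1) × G^k`, of which the nerve is an embedded
submanifold. -/
def embed (σ : NerveStr 𝒢 k) : (Fin (k + 1) → M) × (Fin k → G) := (σ.obj, σ.arr)

lemma embed_injective : Function.Injective (embed (𝒢 := 𝒢) (k := k)) := by
  intro σ τ h
  exact NerveStr.ext (congrArg Prod.fst h) (congrArg Prod.snd h)

variable (EM EG M G) in
/-- The model of the manifold `M^(k+1) × G^k`. -/
abbrev model (k : ℕ) : ModelWithCorners ℝ ((Fin (k + 1) → EM) × (Fin k → EG))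
    (ModelProd (ModelPi fun _ : Fin (k + 1) => EM) (ModelPi fun _ : Fin k => EG)) :=
  (ModelWithCorners.pi fun _ => 𝓘(ℝ, EM)).prod (ModelWithCorners.pi fun _ => 𝓘(ℝ, EG))

/-- `f` is smooth on the part of `G^(k)` that lies in the set `U`. -/
def SmoothOn {E' H' N : Type*} [NormedAddCommGroup E'] [NormedSpace ℝ E'] [TopologicalSpace H']
    (J : ModelWithCorners ℝ E' H') [TopologicalSpace N] [ChartedSpace H' N]
    (f : NerveStr 𝒢 k → N) (U : Set ((Fin (k + 1) → M) × (Fin k → G))) : Prop :=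
  ∃ F : (Fin (k + 1) → M) × (Fin k → G) → N, (∀ σ : NerveStr 𝒢 k, F σ.embed = f σ) ∧
    ContMDiffOn (model EM EG k) J ∞ F (Set.range (embed (𝒢 := 𝒢)) ∩ U)

lemma contMDiff_pi_eval {ι E' N : Type*} [Fintype ι] [NormedAddCommGroup E'] [NormedSpace ℝ E']
    [TopologicalSpace N] [ChartedSpace E' N] (i : ι) :
    ContMDiff (ModelWithCorners.pi fun _ : ι => 𝓘(ℝ, E')) 𝓘(ℝ, E') ∞ (fun p : ι → N => p i) := by
  intro p
  rw [contMDiffAt_iff]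
  refine ⟨(continuous_apply i).continuousAt, ?_⟩
  have hev : ContDiffWithinAt ℝ ∞ (fun y : ι → E' => y i)
      (Set.range (ModelWithCorners.pi fun _ : ι => 𝓘(ℝ, E')))
      (extChartAt (ModelWithCorners.pi fun _ : ι => 𝓘(ℝ, E')) p p) :=
    (contDiff_apply ℝ E' i).contDiffWithinAt
  refine hev.congr_of_eventuallyEq_of_mem ?_ (Set.mem_range_self _)
  filter_upwards [extChartAt_target_mem_nhdsWithin p] with y hy
  have hy' : y i ∈ (extChartAt 𝓘(ℝ, E') (p i)).target := by
    simp only [extChartAt, mfld_simps] at hy ⊢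
    exact hy.2 i (Set.mem_univ i)
  exact (extChartAt 𝓘(ℝ, E') (p i)).right_inv hy'

lemma SmoothOn.comp {E₁ H₁ N₁ E₂ H₂ N₂ : Type*}
    [NormedAddCommGroup E₁] [NormedSpace ℝ E₁] [TopologicalSpace H₁]
    {J₁ : ModelWithCorners ℝ E₁ H₁} [TopologicalSpace N₁] [ChartedSpace H₁ N₁]
    [NormedAddCommGroup E₂] [NormedSpace ℝ E₂] [TopologicalSpace H₂]
    {J₂ : ModelWithCorners ℝ E₂ H₂} [TopologicalSpace N₂] [ChartedSpace H₂ N₂]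
    {φ : N₁ → N₂} (hφ : ContMDiff J₁ J₂ ∞ φ) {f : NerveStr 𝒢 k → N₁}
    {U : Set ((Fin (k + 1) → M) × (Fin k → G))} (hf : SmoothOn J₁ f U) :
    SmoothOn J₂ (fun σ => φ (f σ)) U := by
  obtain ⟨F, hF, hF'⟩ := hf
  exact ⟨fun p => φ (F p), fun σ => congrArg φ (hF σ), hφ.comp_contMDiffOn hF'⟩

lemma SmoothOn.mono {E₁ H₁ N₁ : Type*}
    [NormedAddCommGroup E₁] [NormedSpace ℝ E₁] [TopologicalSpace H₁]
    {J₁ : ModelWithCorners ℝ E₁ H₁} [TopologicalSpace N₁] [ChartedSpace H₁ N₁]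
    {f : NerveStr 𝒢 k → N₁} {U U' : Set ((Fin (k + 1) → M) × (Fin k → G))}
    (hf : SmoothOn J₁ f U) (h : U' ⊆ U) : SmoothOn J₁ f U' := by
  obtain ⟨F, hF, hF'⟩ := hf
  exact ⟨F, hF, hF'.mono (Set.inter_subset_inter_right _ h)⟩

lemma smoothOn_obj (i : Fin (k + 1)) (U) :
    SmoothOn 𝓘(ℝ, EM) (fun σ : NerveStr 𝒢 k => σ.obj i) U :=
  ⟨fun p => p.1 i, fun _ => rfl, ((contMDiff_pi_eval i).comp contMDiff_fst).contMDiffOn⟩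

lemma smoothOn_arr (i : Fin k) (U) :
    SmoothOn 𝓘(ℝ, EG) (fun σ : NerveStr 𝒢 k => σ.arr i) U :=
  ⟨fun p => p.2 i, fun _ => rfl, ((contMDiff_pi_eval i).comp contMDiff_snd).contMDiffOn⟩

lemma smoothOn_unit (U) :
    SmoothOn 𝓘(ℝ, EG) (fun σ : NerveStr 𝒢 k => 𝒢.u (σ.obj 0)) U :=
  (smoothOn_obj 0 U).comp 𝒢.smooth_u

lemma smoothOn_first (U) : SmoothOn 𝓘(ℝ, EG) (fun σ : NerveStr 𝒢 k => σ.first) U := by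
  cases k with
  | zero => exact smoothOn_unit U
  | succ k => exact smoothOn_arr 0 U

section Bundle

variable {EB : Type*} [NormedAddCommGroup EB] [NormedSpace ℝ EB] {B : Type*} [TopologicalSpace B]
  [ChartedSpace EB B] {F : Type*} [NormedAddCommGroup F] [NormedSpace ℝ F]
  {A : B → Type*} [∀ x, AddCommGroup (A x)] [∀ x, Module ℝ (A x)] [∀ x, TopologicalSpace (A x)]
  [TopologicalSpace (TotalSpace F A)] [FiberBundle F A] [VectorBundle ℝ F A]
  {b : NerveStr 𝒢 k → B} {U : Set ((Fin (k + 1) → M) × (Fin k → G))}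

variable (EB F) in
/-- A family `c σ ∈ A (b σ)`, `σ ∈ G^(k)`, of elements of a vector bundle is smooth on `U`. -/
def SmoothFamilyOn (c : ∀ σ : NerveStr 𝒢 k, A (b σ))
    (U : Set ((Fin (k + 1) → M) × (Fin k → G))) : Prop :=
  SmoothOn (𝓘(ℝ, EB).prod 𝓘(ℝ, F)) (fun σ => (⟨b σ, c σ⟩ : TotalSpace F A)) U

lemma SmoothFamilyOn.zero [ContMDiffVectorBundle ∞ F A 𝓘(ℝ, EB)] (hb : SmoothOn 𝓘(ℝ, EB) b U) :
    SmoothFamilyOn EB F (A := A) (b := b) 0 U :=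
  hb.comp (contMDiff_zeroSection ℝ A)

lemma SmoothFamilyOn.comb {c c' : ∀ σ : NerveStr 𝒢 k, A (b σ)} (r : ℝ)
    (h : SmoothFamilyOn EB F c U) (h' : SmoothFamilyOn EB F c' U) :
    SmoothFamilyOn EB F (c + r • c') U := by
  obtain ⟨f, hf, hfs⟩ := h
  obtain ⟨f', hf', hfs'⟩ := h'
  obtain ⟨f₃, key⟩ : ∃ f₃ : (Fin (k + 1) → M) × (Fin k → G) → TotalSpace F A,
      ∀ σ : NerveStr 𝒢 k, f₃ σ.embed = ⟨b σ, c σ + r • c' σ⟩ :=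
    ⟨Function.extend embed (fun σ => ⟨b σ, c σ + r • c' σ⟩) f, fun σ =>
      embed_injective.extend_apply _ _ σ⟩
  refine ⟨f₃, key, ?_⟩
  rintro _ ⟨⟨σ, rfl⟩, hU⟩
  have h1 := contMDiffWithinAt_totalSpace.1 (hfs σ.embed ⟨⟨σ, rfl⟩, hU⟩)
  have h2 := contMDiffWithinAt_totalSpace.1 (hfs' σ.embed ⟨⟨σ, rfl⟩, hU⟩)
  refine contMDiffWithinAt_totalSpace.2 ⟨?_, ?_⟩
  · refine h1.1.congr_of_mem ?_ ⟨⟨σ, rfl⟩, hU⟩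
    rintro _ ⟨⟨τ, rfl⟩, -⟩
    simp only [key, hf]
  · simp only [key, hf, hf'] at h1 h2 ⊢
    refine (h1.2.add ((contMDiffWithinAt_const (I' := 𝓘(ℝ, ℝ)) (c := r)).smul h2.2)).congr_of_eventuallyEq_of_mem ?_ ⟨⟨σ, rfl⟩, hU⟩
    have hb : ∀ᶠ p in nhdsWithin σ.embed (Set.range (embed (𝒢 := 𝒢)) ∩ U),
        (f p).proj ∈ (trivializationAt F A (b σ)).baseSet := by
      refine h1.1.continuousWithinAt.eventually
        ((trivializationAt F A (b σ)).open_baseSet.mem_nhds ?_)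
      simp only [hf]
      exact mem_baseSet_trivializationAt F A (b σ)
    filter_upwards [hb, self_mem_nhdsWithin] with p hp hpS
    obtain ⟨⟨τ, rfl⟩, -⟩ := hpS
    rw [hf] at hp
    simp only [key, hf, hf', Pi.add_apply, Pi.smul_apply']
    have hl := (trivializationAt F A (b σ)).linear ℝ hp
    rw [hl.map_add, hl.map_smul]

end Bundle

end NerveStr

end Nerve

/-! ### VB-groupoids -/

/-- The linear map between two fibres of a family of vector spaces over equal points. -/
def fibreCast {B : Type*} {A : B → Type*} [∀ x, AddCommGroup (A x)] [∀ x, Module ℝ (A x)]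
    {x y : B} (h : x = y) : A x →ₗ[ℝ] A y :=
  (LinearEquiv.cast (R := ℝ) (M := A) h).toLinearMap

lemma mk_fibreCast {B : Type*} (F : Type*) {A : B → Type*} [∀ x, AddCommGroup (A x)]
    [∀ x, Module ℝ (A x)] {x y : B} (h : x = y) (v : A x) :
    (⟨y, fibreCast h v⟩ : TotalSpace F A) = ⟨x, v⟩ := by
  subst h
  rfl

section VB

variable {EM EG : Type*} [NormedAddCommGroup EM] [NormedSpace ℝ EM]
  [NormedAddCommGroup EG] [NormedSpace ℝ EG]
  {M G : Type*} [TopologicalSpace M] [ChartedSpace EM M] [TopologicalSpace G] [ChartedSpace EG G]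

/-- A VB-groupoid over the Lie groupoid `𝒢 : G ⇉ M`, with side bundle `E → M` and total bundle
`V → G`: a Lie groupoid structure on the total spaces of `V` and `E` whose structure maps are
vector bundle morphisms over the structure maps of `𝒢`, given fibrewise by the linear maps
`src, trg, unit, inv, mul`. The multiplication is linear on the space of composable pairs in
`V g × V h`; `mul g h` is a linear extension of it to `V g × V h`, and only its values on
composable pairs are meaningful. -/
structure VBGroupoid (𝒢 : LieGroupoid 𝓘(ℝ, EM) 𝓘(ℝ, EG) M G)
    (FE : Type*) [NormedAddCommGroup FE] [NormedSpace ℝ FE]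
    (E : M → Type*) [∀ x, AddCommGroup (E x)] [∀ x, Module ℝ (E x)] [∀ x, TopologicalSpace (E x)]
    [TopologicalSpace (TotalSpace FE E)] [FiberBundle FE E] [VectorBundle ℝ FE E]
    (FV : Type*) [NormedAddCommGroup FV] [NormedSpace ℝ FV]
    (V : G → Type*) [∀ g, AddCommGroup (V g)] [∀ g, Module ℝ (V g)] [∀ g, TopologicalSpace (V g)]
    [TopologicalSpace (TotalSpace FV V)] [FiberBundle FV V] [VectorBundle ℝ FV V] where
  /-- the Lie groupoid structure on the total spaces -/
  tot : LieGroupoid (𝓘(ℝ, EM).prod 𝓘(ℝ, FE)) (𝓘(ℝ, EG).prod 𝓘(ℝ, FV))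
    (TotalSpace FE E) (TotalSpace FV V)
  /-- the source map on fibres -/
  src : ∀ g, V g →ₗ[ℝ] E (𝒢.s g)
  /-- the target map on fibres -/
  trg : ∀ g, V g →ₗ[ℝ] E (𝒢.t g)
  /-- the unit map on fibres -/
  unit : ∀ x, E x →ₗ[ℝ] V (𝒢.u x)
  /-- the inversion on fibres -/
  inv : ∀ g, V g →ₗ[ℝ] V (𝒢.inv g)
  /-- the multiplication on fibres -/
  mul : ∀ g h, V g × V h →ₗ[ℝ] V (𝒢.mul g h)
  tot_s : ∀ g (v : V g), tot.s ⟨g, v⟩ = ⟨𝒢.s g, src g v⟩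
  tot_t : ∀ g (v : V g), tot.t ⟨g, v⟩ = ⟨𝒢.t g, trg g v⟩
  tot_u : ∀ x (e : E x), tot.u ⟨x, e⟩ = ⟨𝒢.u x, unit x e⟩
  tot_inv : ∀ g (v : V g), tot.inv ⟨g, v⟩ = ⟨𝒢.inv g, inv g v⟩
  tot_mul : ∀ g h (v : V g) (w : V h), tot.s ⟨g, v⟩ = tot.t ⟨h, w⟩ →
    tot.mul ⟨g, v⟩ ⟨h, w⟩ = ⟨𝒢.mul g h, mul g h (v, w)⟩

namespace VBGroupoid

variable {𝒢 : LieGroupoid 𝓘(ℝ, EM) 𝓘(ℝ, EG) M G}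
  {FE : Type*} [NormedAddCommGroup FE] [NormedSpace ℝ FE]
  {E : M → Type*} [∀ x, AddCommGroup (E x)] [∀ x, Module ℝ (E x)] [∀ x, TopologicalSpace (E x)]
  [TopologicalSpace (TotalSpace FE E)] [FiberBundle FE E] [VectorBundle ℝ FE E]
  {FV : Type*} [NormedAddCommGroup FV] [NormedSpace ℝ FV]
  {V : G → Type*} [∀ g, AddCommGroup (V g)] [∀ g, Module ℝ (V g)] [∀ g, TopologicalSpace (V g)]
  [TopologicalSpace (TotalSpace FV V)] [FiberBundle FV V] [VectorBundle ℝ FV V]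
  (𝒱 : VBGroupoid 𝒢 FE E FV V)

/-- The fibre `C_x` of the core: the kernel of the source map on the fibre of `V` at the unit. -/
def core (x : M) : Submodule ℝ (V (𝒢.u x)) := LinearMap.ker (𝒱.src (𝒢.u x))

/-- The core-anchor `∂ : C_x → E_x`, the restriction of the target map. -/
def coreAnchor (x : M) : 𝒱.core x →ₗ[ℝ] E x :=
  fibreCast (𝒢.t_u x) ∘ₗ 𝒱.trg (𝒢.u x) ∘ₗ (𝒱.core x).subtype

/-- A VB-groupoid is regular if its core-anchor has constant rank. -/
def IsRegular : Prop :=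
  ∃ r : ℕ, ∀ x, Module.finrank ℝ (LinearMap.range (𝒱.coreAnchor x)) = r

/-- The fibre `𝔨_x` of the kernel of the core-anchor, as a subspace of `V (u x)`. -/
def kerAnchor (x : M) : Submodule ℝ (V (𝒢.u x)) :=
  (LinearMap.ker (𝒱.coreAnchor x)).map (𝒱.core x).subtype

/-- The fibre `𝔩_x` of the cokernel of the core-anchor. -/
abbrev Coker (x : M) := E x ⧸ LinearMap.range (𝒱.coreAnchor x)

lemma trg_mem_range {g : G} {v : V g}
    (hv : 𝒱.src g v ∈ LinearMap.range (𝒱.coreAnchor (𝒢.s g))) :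
    𝒱.trg g v ∈ LinearMap.range (𝒱.coreAnchor (𝒢.t g)) := by
  obtain ⟨⟨c, hc⟩, hcv⟩ := hv
  have hc0 : 𝒱.src _ c = 0 := hc
  have h1 : 𝒱.tot.s ⟨g, v⟩ = 𝒱.tot.t ⟨𝒢.u (𝒢.s g), c⟩ := by
    rw [𝒱.tot_s, 𝒱.tot_t, ← hcv, ← mk_fibreCast FE (𝒢.t_u (𝒢.s g))]
    rfl
  have h1s := 𝒱.tot.s_mul _ _ h1
  have h1t := 𝒱.tot.t_mul _ _ h1
  rw [𝒱.tot_mul _ _ _ _ h1] at h1s h1t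
  have h2 : 𝒱.tot.s ⟨_, 𝒱.mul g (𝒢.u (𝒢.s g)) (v, c)⟩ = 𝒱.tot.t ⟨𝒢.inv g, 0⟩ := by
    rw [h1s, 𝒱.tot_s, 𝒱.tot_t, hc0, map_zero]
    have : 𝒢.s (𝒢.u (𝒢.s g)) = 𝒢.t (𝒢.inv g) := by rw [𝒢.s_u, 𝒢.t_inv]
    rw [← mk_fibreCast FE this, map_zero]
  have h2s := 𝒱.tot.s_mul _ _ h2
  have h2t := 𝒱.tot.t_mul _ _ h2
  rw [𝒱.tot_mul _ _ _ _ h2] at h2s h2t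
  have hu : 𝒢.mul (𝒢.mul g (𝒢.u (𝒢.s g))) (𝒢.inv g) = 𝒢.u (𝒢.t g) := by
    rw [𝒢.mul_u, 𝒢.mul_inv]
  rw [← mk_fibreCast FV hu] at h2s h2t
  generalize fibreCast (A := V) hu _ = d at h2s h2t
  rw [h1t, 𝒱.tot_t, 𝒱.tot_t] at h2t
  rw [𝒱.tot_s, 𝒱.tot_s, map_zero] at h2s
  have key : ∀ {x y : M} (h : x = y) (a : E x) (b : E y),
      (⟨x, a⟩ : TotalSpace FE E) = ⟨y, b⟩ → fibreCast h a = b := by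
    rintro x _ rfl a b hab
    exact (TotalSpace.mk_inj.1 hab : a = b)
  refine ⟨⟨d, ?_⟩, key (𝒢.t_u (𝒢.t g)) _ _ h2t⟩
  have h0 : 𝒢.s (𝒢.u (𝒢.t g)) = 𝒢.s (𝒢.inv g) := by rw [𝒢.s_u, 𝒢.s_inv]
  have h3 := key h0 _ _ h2s
  have h4 : Function.Injective (fibreCast (A := E) h0) := (LinearEquiv.cast (R := ℝ) h0).injective
  exact h4 (by rw [h3, map_zero])

lemma exists_cokerAction (g : G) : ∃ a : 𝒱.Coker (𝒢.s g) →ₗ[ℝ] 𝒱.Coker (𝒢.t g),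
    a ∘ₗ Submodule.mkQ _ ∘ₗ 𝒱.src g = Submodule.mkQ _ ∘ₗ 𝒱.trg g := by
  set p : V g →ₗ[ℝ] 𝒱.Coker (𝒢.s g) := Submodule.mkQ _ ∘ₗ 𝒱.src g with hp
  set q : V g →ₗ[ℝ] 𝒱.Coker (𝒢.t g) := Submodule.mkQ _ ∘ₗ 𝒱.trg g with hq
  have hpq : LinearMap.ker p ≤ LinearMap.ker q := by
    intro v hv
    simp only [hp, hq, LinearMap.mem_ker, LinearMap.comp_apply, Submodule.mkQ_apply,
      Submodule.Quotient.mk_eq_zero] at hv ⊢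
    exact 𝒱.trg_mem_range hv
  obtain ⟨a, ha⟩ := LinearMap.exists_extend
    ((LinearMap.ker p).liftQ q hpq ∘ₗ p.quotKerEquivRange.symm.toLinearMap)
  refine ⟨a, LinearMap.ext fun v => ?_⟩
  have := LinearMap.congr_fun ha ⟨p v, LinearMap.mem_range_self p v⟩
  simpa [LinearMap.quotKerEquivRange_symm_apply_image p v] using this

/-- The action of an arrow `g` on the cokernel: the linear map `𝔩_{s g} → 𝔩_{t g}` that maps the
class of `src g v` to the class of `trg g v`, for all `v` in `V g`. (Every element of `E (s g)` is
`src g v` for some `v`, since the source map of the total groupoid is a submersion.) -/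
def cokerAction (g : G) : 𝒱.Coker (𝒢.s g) →ₗ[ℝ] 𝒱.Coker (𝒢.t g) :=
  (𝒱.exists_cokerAction g).choose

lemma cokerAction_mk (g : G) (v : V g) :
    𝒱.cokerAction g (Submodule.Quotient.mk (𝒱.src g v)) = Submodule.Quotient.mk (𝒱.trg g v) :=
  LinearMap.congr_fun (𝒱.exists_cokerAction g).choose_spec v

open NerveStr

/-! #### Differentials -/

/-- The VB-differential, on all families `c σ ∈ V g₁` (`c x ∈ V (u x)` in degree `0`). In degree `0`
it is `(δ c)(g) = c (t g) · 0_g + 0_g · (c (s g))⁻¹`, and in degree `n > 0`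
`(δ c)(g₁, …, gₙ₊₁) = - c (g₁ g₂, g₃, …, gₙ₊₁) · (c (g₂, …, gₙ₊₁))⁻¹
  + ∑_{i=2}^{n} (-1)^i c (g₁, …, gᵢ gᵢ₊₁, …, gₙ₊₁) + (-1)^(n+1) c (g₁, …, gₙ)`. -/
def dVB : ∀ k, (∀ σ : NerveStr 𝒢 k, V σ.first) →ₗ[ℝ] (∀ σ : NerveStr 𝒢 (k + 1), V σ.first)
  | 0 => LinearMap.pi fun σ =>
      fibreCast (y := σ.first) (by
        have h : (face 1 σ).obj 0 = 𝒢.t (σ.arr 0) := by rw [σ.t_arr_zero]; rfl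
        exact (congrArg (fun x => 𝒢.mul (𝒢.u x) (σ.arr 0)) h).trans (𝒢.u_mul _)) ∘ₗ
          𝒱.mul (face 1 σ).first (σ.arr 0) ∘ₗ LinearMap.inl ℝ _ _ ∘ₗ LinearMap.proj (face 1 σ)
      + fibreCast (y := σ.first) (by
        have h : 𝒢.inv (𝒢.u (𝒢.s (σ.arr 0))) = 𝒢.u (𝒢.s (σ.arr 0)) := by
          rw [← 𝒢.mul_u (𝒢.inv _), 𝒢.s_inv, 𝒢.t_u]
          have := 𝒢.inv_mul (𝒢.u (𝒢.s (σ.arr 0)))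
          rwa [𝒢.s_u] at this
        have h' := 𝒢.mul_u (σ.arr 0)
        rw [← h, σ.s_arr_zero] at h'
        exact h') ∘ₗ
          𝒱.mul (σ.arr 0) (𝒢.inv (face 0 σ).first) ∘ₗ LinearMap.inr ℝ _ _ ∘ₗ
            𝒱.inv (face 0 σ).first ∘ₗ LinearMap.proj (face 0 σ)
  | k + 1 => LinearMap.pi fun σ =>
      - fibreCast (y := σ.first) (by
        rw [first_face_one, first_face_zero, 𝒢.mul_assoc _ _ _ (σ.s_eq_t rfl) (𝒢.t_inv _).symm,
          𝒢.mul_inv, ← σ.s_eq_t (i := 0) rfl, 𝒢.mul_u]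
        rfl) ∘ₗ
          𝒱.mul (face 1 σ).first (𝒢.inv (face 0 σ).first) ∘ₗ
            LinearMap.prod (LinearMap.proj (face 1 σ))
              (𝒱.inv (face 0 σ).first ∘ₗ LinearMap.proj (face 0 σ))
      + ∑ i : Fin (k + 1), (-1 : ℝ) ^ ((i : ℕ) + 2) •
          (fibreCast (first_face_succ_succ σ i) ∘ₗ LinearMap.proj (face i.succ.succ σ))

/-- The differential with values in `𝔨`, on all families `c σ ∈ V (u x₀)`:
`(δ c)(g₁, …, gₙ₊₁) = 0_{g₁} · c (g₂, …, gₙ₊₁) · 0_{g₁}⁻¹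
  + ∑_{i=1}^{n} (-1)^i c (g₁, …, gᵢ gᵢ₊₁, …, gₙ₊₁) + (-1)^(n+1) c (g₁, …, gₙ)`. -/
def dKer (k : ℕ) : (∀ σ : NerveStr 𝒢 k, V (𝒢.u (σ.obj 0))) →ₗ[ℝ]
    (∀ σ : NerveStr 𝒢 (k + 1), V (𝒢.u (σ.obj 0))) :=
  LinearMap.pi fun σ =>
    fibreCast (y := 𝒢.u (σ.obj 0)) (by
      rw [← s_arr_zero, 𝒢.mul_u, 𝒢.mul_inv, t_arr_zero]) ∘ₗ
        𝒱.mul (𝒢.mul (σ.arr 0) (𝒢.u ((face 0 σ).obj 0))) (𝒢.inv (σ.arr 0)) ∘ₗ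
          LinearMap.inl ℝ _ _ ∘ₗ 𝒱.mul (σ.arr 0) (𝒢.u ((face 0 σ).obj 0)) ∘ₗ
            LinearMap.inr ℝ _ _ ∘ₗ LinearMap.proj (face 0 σ)
    + ∑ i : Fin (k + 1), (-1 : ℝ) ^ ((i : ℕ) + 1) •
        (fibreCast (congrArg 𝒢.u (face_succ_obj_zero σ i)) ∘ₗ LinearMap.proj (face i.succ σ))

/-- The differential with values in `𝔩`:
`(δ ξ)(g₁, …, gₙ₊₁) = g₁ · ξ (g₂, …, gₙ₊₁)
  + ∑_{i=1}^{n} (-1)^i ξ (g₁, …, gᵢ gᵢ₊₁, …, gₙ₊₁) + (-1)^(n+1) ξ (g₁, …, gₙ)`. -/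
def dCoker (k : ℕ) : (∀ σ : NerveStr 𝒢 k, 𝒱.Coker (σ.obj 0)) →ₗ[ℝ]
    (∀ σ : NerveStr 𝒢 (k + 1), 𝒱.Coker (σ.obj 0)) :=
  LinearMap.pi fun σ =>
    fibreCast (A := 𝒱.Coker) (t_arr_zero σ) ∘ₗ 𝒱.cokerAction (σ.arr 0) ∘ₗ
      fibreCast (A := 𝒱.Coker) (s_arr_zero σ).symm ∘ₗ LinearMap.proj (face 0 σ)
    + ∑ i : Fin (k + 1), (-1 : ℝ) ^ ((i : ℕ) + 1) •
        (fibreCast (A := 𝒱.Coker) (face_succ_obj_zero σ i) ∘ₗ LinearMap.proj (face i.succ σ))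

/-! #### Smooth cochains -/

/-- The cochains `C^k_VB(G, V)`. For `k = 0` these are the smooth sections of the core; for `k > 0`
these are the smooth families `c (g₁, …, gₖ) ∈ V g₁` that are source-projectable: the source of
`c (g₁, …, gₖ)` does not depend on `g₁`. -/
def CVB [ContMDiffVectorBundle ∞ FV V 𝓘(ℝ, EG)] :
    ∀ k, Submodule ℝ (∀ σ : NerveStr 𝒢 k, V σ.first)
  | 0 =>
    { carrier := {c | SmoothFamilyOn EG FV c Set.univ ∧ ∀ σ, c σ ∈ 𝒱.core (σ.obj 0)}
      zero_mem' := ⟨SmoothFamilyOn.zero (smoothOn_first _), fun _ => Submodule.zero_mem _⟩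
      add_mem' := fun {c c'} h h' =>
        ⟨by simpa using SmoothFamilyOn.comb 1 h.1 h'.1,
          fun σ => Submodule.add_mem _ (h.2 σ) (h'.2 σ)⟩
      smul_mem' := fun r c h =>
        ⟨by simpa using SmoothFamilyOn.comb r (SmoothFamilyOn.zero (smoothOn_first _)) h.1,
          fun σ => Submodule.smul_mem _ r (h.2 σ)⟩ }
  | k + 1 =>
    { carrier := {c | SmoothFamilyOn EG FV c Set.univ ∧ ∀ σ τ : NerveStr 𝒢 (k + 1),
        face 0 σ = face 0 τ → 𝒱.tot.s ⟨σ.first, c σ⟩ = 𝒱.tot.s ⟨τ.first, c τ⟩}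
      zero_mem' := by
        refine ⟨SmoothFamilyOn.zero (smoothOn_first _), fun σ τ h => ?_⟩
        have hs : 𝒢.s σ.first = 𝒢.s τ.first :=
          (σ.s_arr_zero.trans (congrArg (fun ρ => ρ.obj 0) h)).trans τ.s_arr_zero.symm
        rw [𝒱.tot_s, 𝒱.tot_s, ← mk_fibreCast FE hs]
        simp
      add_mem' := by
        intro c c' h h'
        refine ⟨by simpa using SmoothFamilyOn.comb 1 h.1 h'.1, fun σ τ hστ => ?_⟩
        have h1 := h.2 σ τ hστ
        have h2 := h'.2 σ τ hστ
        rw [𝒱.tot_s, 𝒱.tot_s] at h1 h2 ⊢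
        have hs : 𝒢.s σ.first = 𝒢.s τ.first := congrArg TotalSpace.proj h1
        rw [← mk_fibreCast FE hs, TotalSpace.mk_inj] at h1 h2 ⊢
        simp only [Pi.add_apply, map_add, h1, h2]
      smul_mem' := by
        intro r c h
        refine ⟨by simpa using SmoothFamilyOn.comb r (SmoothFamilyOn.zero (smoothOn_first _)) h.1,
          fun σ τ hστ => ?_⟩
        have h1 := h.2 σ τ hστ
        rw [𝒱.tot_s, 𝒱.tot_s] at h1 ⊢
        have hs : 𝒢.s σ.first = 𝒢.s τ.first := congrArg TotalSpace.proj h1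
        rw [← mk_fibreCast FE hs, TotalSpace.mk_inj] at h1 ⊢
        simp only [Pi.smul_apply, map_smul, h1] }

/-- The cochains `C^k(G, 𝔨)`: smooth families `c (g₁, …, gₖ) ∈ 𝔨_{t g₁}`. -/
def CKer [ContMDiffVectorBundle ∞ FV V 𝓘(ℝ, EG)] (k : ℕ) :
    Submodule ℝ (∀ σ : NerveStr 𝒢 k, V (𝒢.u (σ.obj 0))) where
  carrier := {c | SmoothFamilyOn EG FV (b := fun σ : NerveStr 𝒢 k => 𝒢.u (σ.obj 0)) c Set.univ ∧
    ∀ σ, c σ ∈ 𝒱.kerAnchor (σ.obj 0)}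
  zero_mem' := ⟨SmoothFamilyOn.zero (smoothOn_unit _), fun _ => Submodule.zero_mem _⟩
  add_mem' := fun {c c'} h h' =>
    ⟨by simpa using SmoothFamilyOn.comb 1 h.1 h'.1,
      fun σ => Submodule.add_mem _ (h.2 σ) (h'.2 σ)⟩
  smul_mem' := fun r c h =>
    ⟨by simpa using SmoothFamilyOn.comb r (SmoothFamilyOn.zero (smoothOn_unit _)) h.1,
      fun σ => Submodule.smul_mem _ r (h.2 σ)⟩

/-- The cochains `C^k(G, 𝔩)`: smooth families `ξ (g₁, …, gₖ) ∈ 𝔩_{t g₁}`, where a family of elements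
of the quotients `𝔩_x` of the fibres `E_x` is smooth if it locally lifts to a smooth family of
elements of `E`. -/
def CCoker [ContMDiffVectorBundle ∞ FE E 𝓘(ℝ, EM)] (k : ℕ) :
    Submodule ℝ (∀ σ : NerveStr 𝒢 k, 𝒱.Coker (σ.obj 0)) where
  carrier := {ξ | ∀ σ₀ : NerveStr 𝒢 k, ∃ U, IsOpen U ∧ σ₀.embed ∈ U ∧
    ∃ e : ∀ σ : NerveStr 𝒢 k, E (σ.obj 0), SmoothFamilyOn EM FE e U ∧
      ∀ σ, σ.embed ∈ U → ξ σ = Submodule.Quotient.mk (e σ)}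
  zero_mem' := fun σ₀ => ⟨Set.univ, isOpen_univ, trivial, 0, SmoothFamilyOn.zero (smoothOn_obj 0 _),
    fun _ _ => rfl⟩
  add_mem' := by
    intro ξ ξ' h h' σ₀
    obtain ⟨U, hU, hσ, e, he, hξ⟩ := h σ₀
    obtain ⟨U', hU', hσ', e', he', hξ'⟩ := h' σ₀
    refine ⟨U ∩ U', hU.inter hU', ⟨hσ, hσ'⟩, e + e', ?_, fun σ h => ?_⟩
    · simpa using SmoothFamilyOn.comb 1 (SmoothOn.mono he Set.inter_subset_left)
        (SmoothOn.mono he' Set.inter_subset_right)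
    · simp [hξ σ h.1, hξ' σ h.2]
  smul_mem' := by
    intro r ξ h σ₀
    obtain ⟨U, hU, hσ, e, he, hξ⟩ := h σ₀
    refine ⟨U, hU, hσ, r • e, ?_, fun σ h => ?_⟩
    · simpa using SmoothFamilyOn.comb r (SmoothFamilyOn.zero (smoothOn_obj 0 _)) he
    · simp [hξ σ h]

/-! #### Cohomologies -/

section
variable [ContMDiffVectorBundle ∞ FV V 𝓘(ℝ, EG)]

/-- The VB-cohomology `H^k_VB(G, V)`. -/
abbrev HVB (k : ℕ) := Cohomology 𝒱.CVB 𝒱.dVB k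

/-- The cohomology `H^k(G, 𝔨)`. -/
abbrev HKer (k : ℕ) := Cohomology 𝒱.CKer 𝒱.dKer k

end

/-- The cohomology `H^k(G, 𝔩)`. -/
abbrev HCoker [ContMDiffVectorBundle ∞ FE E 𝓘(ℝ, EM)] (k : ℕ) := Cohomology 𝒱.CCoker 𝒱.dCoker k

/-! #### Right multiplication by zero elements and the source projection -/

/-- Right multiplication by zero elements, `(r c)(g₁, …, gₖ) = c (g₁, …, gₖ) · 0_{g₁}`.
In degree `0` this is `c x · 0_{u x} = c x`. -/
def rightMulZero (k : ℕ) : (∀ σ : NerveStr 𝒢 k, V (𝒢.u (σ.obj 0))) →ₗ[ℝ]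
    (∀ σ : NerveStr 𝒢 k, V σ.first) :=
  LinearMap.pi fun σ =>
    fibreCast (y := σ.first) (by rw [← σ.t_first, 𝒢.u_mul]) ∘ₗ
      𝒱.mul (𝒢.u (σ.obj 0)) σ.first ∘ₗ LinearMap.inl ℝ _ _ ∘ₗ LinearMap.proj σ

/-- The source projection followed by the quotient map `E → 𝔩`: the class of the source of
`c (g₁, g₂, …, gₖ₊₁)` as a function of `(g₂, …, gₖ₊₁)`. As the source does not depend on `g₁` for
a projectable `c`, it is evaluated for a unit `g₁`. -/
def srcProj (k : ℕ) : (∀ σ : NerveStr 𝒢 (k + 1), V σ.first) →ₗ[ℝ]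
    (∀ σ : NerveStr 𝒢 k, 𝒱.Coker (σ.obj 0)) :=
  LinearMap.pi fun σ =>
    Submodule.mkQ _ ∘ₗ fibreCast (A := E) (𝒢.s_u (σ.obj 0)) ∘ₗ
      𝒱.src (𝒢.u (σ.obj 0)) ∘ₗ LinearMap.proj σ.consUnit

end VBGroupoid

end VB

/-!
The sequence is the long exact cohomology sequence of a sequence of cochain spaces that is short
exact up to coboundaries.

**Right multiplication and source projection.** A VB-cochain has a source section `srcSec`, and
the source projection is its class modulo the image of the core-anchor `∂`. In positive degrees
the VB-differential is an alternating sum of coface maps (`dVB_succ_eq_coface`), which gives `δ δ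
= 0` (`dVB_dVB`) and a formula for the source section of `δ c` (`srcSec_dVB_succ`), in which the
target of `c` occurs because the source of `c (g₁ g₂, …) · c (g₂, …)⁻¹` is the target of `c (g₂,
…)`. So the source projection anticommutes with the differentials (`srcProj_dVB_succ`). Right
multiplication by zero elements commutes with them in positive degrees and anticommutes in degree
zero (`dVB_rightMulZero`). It identifies the `𝔨`-valued cochains with the VB-cochains `c` such
that both `c` and `δ c` have vanishing source (`exists_rightMulZero_eq`), since for a cochain `c`
of vanishing source the source section of `δ c` is the target of `c` up to sign.

**Exactness.** The kernel of the source projection is larger than the image of right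
multiplication, but only by coboundaries: if the source of `c` takes values in the image of `∂`, a
smooth splitting `θ` of `∂` over its image gives a cochain `θ (srcSec c)`, and subtracting the
differential of its right multiple by zero elements, with the appropriate sign, makes the source
of `c` vanish (`exists_srcSec_sub_dVB_eq_zero`). The source projection is surjective on cochains
(`exists_srcProj_eq`): `1 - ∂ θ` lifts families in `𝔩` to families in `E`, and a smooth splitting
of the source map lifts those to `V`. The diagram chase that yields the connecting map and the
long exact sequence from these facts is `IsShiftedExact.exists_longExact`.

**Splittings.** Both splittings come from one fact: a smooth family of linear maps of constant
rank between fibres of vector bundles has a smooth generalized inverse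
(`exists_smooth_generalizedInverse`). A generalized inverse of one member of the family yields, by
a Neumann-type formula, generalized inverses of nearby members, and a partition of unity glues
these. For the source map the rank is constant because it is surjective on fibres
(`src_surjective`), which follows from the source map of the total groupoid being a submersion.
For `∂`, whose domain is a family of subspaces and not given as a bundle, the fact is applied to
the difference of the target and source maps over units, which has the same image
(`range_unitAnchor`).
-/

/-! ### Smooth maps on the nerve -/

section NerveSmooth

variable {EM EG : Type*} [NormedAddCommGroup EM] [NormedSpace ℝ EM]
  [NormedAddCommGroup EG] [NormedSpace ℝ EG]
  {M G : Type*} [TopologicalSpace M] [ChartedSpace EM M] [TopologicalSpace G] [ChartedSpace EG G]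

namespace NerveStr

variable {𝒢 : LieGroupoid 𝓘(ℝ, EM) 𝓘(ℝ, EG) M G} {k l : ℕ}

lemma contMDiffWithinAt_pi_of_eval {ι E' N X EX HX : Type*} [Fintype ι] [NormedAddCommGroup E']
    [NormedSpace ℝ E'] [TopologicalSpace N] [ChartedSpace E' N]
    [NormedAddCommGroup EX] [NormedSpace ℝ EX] [TopologicalSpace HX] {I : ModelWithCorners ℝ EX HX}
    [TopologicalSpace X] [ChartedSpace HX X] {f : X → ι → N} {s : Set X} {x : X}
    (h : ∀ i, ContMDiffWithinAt I 𝓘(ℝ, E') ∞ (fun p => f p i) s x) :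
    ContMDiffWithinAt I (ModelWithCorners.pi fun _ : ι => 𝓘(ℝ, E')) ∞ f s x := by
  rw [contMDiffWithinAt_iff]
  refine ⟨continuousWithinAt_pi.2 fun i => (h i).continuousWithinAt, ?_⟩
  exact contDiffWithinAt_pi.2 fun i => (contMDiffWithinAt_iff.1 (h i)).2

section SmoothOn

variable {E₁ H₁ N₁ E₂ H₂ N₂ : Type*}
    [NormedAddCommGroup E₁] [NormedSpace ℝ E₁] [TopologicalSpace H₁]
    {J₁ : ModelWithCorners ℝ E₁ H₁} [TopologicalSpace N₁] [ChartedSpace H₁ N₁]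
    [NormedAddCommGroup E₂] [NormedSpace ℝ E₂] [TopologicalSpace H₂]
    {J₂ : ModelWithCorners ℝ E₂ H₂} [TopologicalSpace N₂] [ChartedSpace H₂ N₂]
    {U : Set ((Fin (k + 1) → M) × (Fin k → G))}

lemma SmoothOn.prodMk {f : NerveStr 𝒢 k → N₁} {g : NerveStr 𝒢 k → N₂}
    (hf : SmoothOn J₁ f U) (hg : SmoothOn J₂ g U) :
    SmoothOn (J₁.prod J₂) (fun σ => (f σ, g σ)) U := by
  obtain ⟨F, hF, hF'⟩ := hf
  obtain ⟨F₂, hF₂, hF₂'⟩ := hg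
  exact ⟨fun p => (F p, F₂ p), fun σ => Prod.ext (hF σ) (hF₂ σ), hF'.prodMk hF₂'⟩

lemma SmoothOn.comp_of_mem {φ : N₁ → N₂} {S : Set N₁} (hφ : ContMDiffOn J₁ J₂ ∞ φ S)
    {f : NerveStr 𝒢 k → N₁} (hf : SmoothOn J₁ f U) (hS : ∀ σ, f σ ∈ S) :
    SmoothOn J₂ (fun σ => φ (f σ)) U := by
  obtain ⟨F, hF, hF'⟩ := hf
  refine ⟨fun p => φ (F p), fun σ => congrArg φ (hF σ), hφ.comp hF' ?_⟩
  rintro _ ⟨⟨σ, rfl⟩, -⟩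
  change F σ.embed ∈ S
  rw [hF]
  exact hS σ

/-- Smooth maps on the nerve can be composed with maps of strings whose objects and arrows depend
smoothly on the given string. -/
lemma SmoothOn.comp_nerve {Φ : NerveStr 𝒢 k → NerveStr 𝒢 l}
    (ho : ∀ i, SmoothOn 𝓘(ℝ, EM) (fun σ => (Φ σ).obj i) Set.univ)
    (ha : ∀ i, SmoothOn 𝓘(ℝ, EG) (fun σ => (Φ σ).arr i) Set.univ)
    {f : NerveStr 𝒢 l → N₁} (hf : SmoothOn J₁ f Set.univ) :
    SmoothOn J₁ (fun σ => f (Φ σ)) Set.univ := by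
  obtain ⟨F, hF, hF'⟩ := hf
  choose Fo hFo hFo' using ho
  choose Fa hFa hFa' using ha
  have key : ∀ σ : NerveStr 𝒢 k,
      ((fun i => Fo i σ.embed, fun i => Fa i σ.embed) : (Fin (l + 1) → M) × (Fin l → G)) =
        (Φ σ).embed := by
    intro σ
    exact Prod.ext (funext fun i => hFo i σ) (funext fun i => hFa i σ)
  refine ⟨fun p => F (fun i => Fo i p, fun i => Fa i p), fun σ => ?_, ?_⟩
  · exact (congrArg F (key σ)).trans (hF _)
  · refine hF'.comp (t := Set.range embed ∩ Set.univ)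
      (f := fun p => ((fun i => Fo i p, fun i => Fa i p) : (Fin (l + 1) → M) × (Fin l → G))) ?_ ?_
    · intro p hp
      exact (contMDiffWithinAt_pi_of_eval fun i => hFo' i p hp).prodMk
        (contMDiffWithinAt_pi_of_eval fun i => hFa' i p hp)
    · rintro _ ⟨⟨σ, rfl⟩, -⟩
      exact ⟨⟨Φ σ, (key σ).symm⟩, trivial⟩

lemma smoothOn_face_arr (i : Fin (k + 2)) (j : Fin k) :
    SmoothOn 𝓘(ℝ, EG) (fun σ : NerveStr 𝒢 (k + 1) => (face i σ).arr j) Set.univ := by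
  simp only [face]
  split_ifs with h1 h2
  · exact smoothOn_arr _ _
  · exact ((smoothOn_arr _ _).prodMk (smoothOn_arr _ _)).comp_of_mem 𝒢.smooth_mul
      fun σ => σ.s_eq_t (by simp)
  · exact smoothOn_arr _ _

lemma SmoothOn.comp_face (i : Fin (k + 2)) {f : NerveStr 𝒢 k → N₁}
    (hf : SmoothOn J₁ f Set.univ) : SmoothOn J₁ (fun σ => f (face i σ)) Set.univ :=
  SmoothOn.comp_nerve (Φ := face i) (fun _ => smoothOn_obj _ _) (smoothOn_face_arr i) hf

lemma SmoothOn.comp_consUnit {f : NerveStr 𝒢 (k + 1) → N₁}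
    (hf : SmoothOn J₁ f Set.univ) : SmoothOn J₁ (fun σ => f (consUnit σ)) Set.univ := by
  refine SmoothOn.comp_nerve (fun i => ?_) (fun i => ?_) hf
  · induction i using Fin.cases with
    | zero => exact smoothOn_obj _ _
    | succ i => simpa [consUnit] using smoothOn_obj _ _
  · induction i using Fin.cases with
    | zero => exact smoothOn_unit _
    | succ i => simpa [consUnit] using smoothOn_arr _ _

/-- Smoothness on the nerve is a local property. -/
lemma SmoothOn.of_locally {f : NerveStr 𝒢 k → N₁}
    (hf : ∀ σ : NerveStr 𝒢 k, ∃ U, IsOpen U ∧ σ.embed ∈ U ∧ SmoothOn J₁ f U) :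
    SmoothOn J₁ f Set.univ := by
  rcases isEmpty_or_nonempty (NerveStr 𝒢 k) with hE | ⟨⟨σ₀⟩⟩
  · -- without strings there are no points: a point `x` gives the string of units at `x`
    have : IsEmpty M := ⟨fun x => hE.false
      ⟨fun _ => x, fun _ => 𝒢.u x, fun _ => 𝒢.t_u x, fun _ => 𝒢.s_u x⟩⟩
    exact ⟨fun p => isEmptyElim (p.1 0), fun σ => isEmptyElim σ, fun p => isEmptyElim (p.1 0)⟩
  · obtain ⟨F, hF⟩ : ∃ F : (Fin (k + 1) → M) × (Fin k → G) → N₁, ∀ σ : NerveStr 𝒢 k,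
        F σ.embed = f σ :=
      ⟨Function.extend embed f fun _ => f σ₀, fun σ => embed_injective.extend_apply _ _ σ⟩
    refine ⟨F, hF, ?_⟩
    rintro _ ⟨⟨σ, rfl⟩, -⟩
    obtain ⟨U, hU, hσ, F', hF', hs⟩ := hf σ
    rw [Set.inter_univ, ← contMDiffWithinAt_inter (hU.mem_nhds hσ)]
    refine (hs σ.embed ⟨⟨σ, rfl⟩, hσ⟩).congr_of_mem ?_ ⟨⟨σ, rfl⟩, hσ⟩
    rintro _ ⟨⟨τ, rfl⟩, -⟩
    rw [hF, hF']

end SmoothOn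

/-! ### Simplicial identities -/

@[simp] lemma face_zero_consUnit (σ : NerveStr 𝒢 k) : face 0 (consUnit σ) = σ := by
  ext i
  · simp [face, consUnit]
  · simp [face, consUnit]

lemma face_face (i j : Fin (k + 2)) (h : i ≤ j) (σ : NerveStr 𝒢 (k + 2)) :
    face i (face j.succ σ) = face j (face i.castSucc σ) := by
  ext m
  · simp only [face]
    congr 1
    ext
    simp only [Fin.succAbove, Fin.lt_def, Fin.val_castSucc, Fin.val_succ]
    rw [Fin.le_def] at h
    split_ifs <;> simp only [Fin.val_castSucc, Fin.val_succ] at * <;> omega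
  · have hij : (i : ℕ) ≤ j := h
    simp only [face, Fin.val_castSucc, Fin.val_succ, ← Fin.succ_castSucc]
    have hm := σ.s_eq_t (i := m.castSucc.castSucc) (j := m.succ.castSucc) (by simp)
    have hm' := σ.s_eq_t (i := m.succ.castSucc) (j := m.succ.succ) (by simp)
    have hass := 𝒢.mul_assoc _ _ _ hm hm'
    split_ifs <;> first | rfl | omega | exact hass | exact hass.symm

end NerveStr

end NerveSmooth

/-! ### Calculus in a groupoid -/

namespace LieGroupoid

variable {EM HM EG HG : Type*}
    [NormedAddCommGroup EM] [NormedSpace ℝ EM] [TopologicalSpace HM] {IM : ModelWithCorners ℝ EM HM}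
    [NormedAddCommGroup EG] [NormedSpace ℝ EG] [TopologicalSpace HG] {IG : ModelWithCorners ℝ EG HG}
    {M G : Type*} [TopologicalSpace M] [ChartedSpace HM M]
    [TopologicalSpace G] [ChartedSpace HG G] (𝒢 : LieGroupoid IM IG M G)

lemma inv_mul_cancel_left {g h : G} (e : 𝒢.s g = 𝒢.t h) :
    𝒢.mul (𝒢.inv g) (𝒢.mul g h) = h := by
  rw [← 𝒢.mul_assoc _ _ _ (𝒢.s_inv g) e, 𝒢.inv_mul, e, 𝒢.u_mul]

lemma mul_inv_cancel_right {g h : G} (e : 𝒢.s g = 𝒢.t h) :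
    𝒢.mul (𝒢.mul g h) (𝒢.inv h) = g := by
  rw [𝒢.mul_assoc _ _ _ e (𝒢.t_inv h).symm, 𝒢.mul_inv, ← e, 𝒢.mul_u]

lemma inv_mul_cancel_right {g h : G} (e : 𝒢.s g = 𝒢.s h) :
    𝒢.mul (𝒢.mul g (𝒢.inv h)) h = g := by
  rw [𝒢.mul_assoc _ _ _ (e.trans (𝒢.t_inv h).symm) (𝒢.s_inv h), 𝒢.inv_mul, ← e, 𝒢.mul_u]

lemma inv_eq_of_mul_eq {g h : G} (e : 𝒢.s g = 𝒢.t h) (e' : 𝒢.mul g h = 𝒢.u (𝒢.t g)) :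
    𝒢.inv g = h := by
  have := 𝒢.inv_mul_cancel_left e
  rwa [e', ← 𝒢.s_inv, 𝒢.mul_u] at this

lemma inv_u (x : M) : 𝒢.inv (𝒢.u x) = 𝒢.u x := by
  refine 𝒢.inv_eq_of_mul_eq (by rw [𝒢.s_u, 𝒢.t_u]) ?_
  have := 𝒢.u_mul (𝒢.u x)
  rwa [𝒢.t_u] at this ⊢

lemma inv_inv (g : G) : 𝒢.inv (𝒢.inv g) = g :=
  𝒢.inv_eq_of_mul_eq (𝒢.s_inv g) (by rw [𝒢.inv_mul, 𝒢.t_inv])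

lemma inv_mul_rev {g h : G} (e : 𝒢.s g = 𝒢.t h) :
    𝒢.inv (𝒢.mul g h) = 𝒢.mul (𝒢.inv h) (𝒢.inv g) := by
  have e1 : 𝒢.s h = 𝒢.t (𝒢.inv h) := (𝒢.t_inv h).symm
  have e2 : 𝒢.s (𝒢.inv h) = 𝒢.t (𝒢.inv g) := by rw [𝒢.s_inv, 𝒢.t_inv, e]
  refine 𝒢.inv_eq_of_mul_eq (by rw [𝒢.s_mul _ _ e, 𝒢.t_mul _ _ e2, e1]) ?_
  rw [← 𝒢.mul_assoc _ _ _ ((𝒢.s_mul _ _ e).trans e1) e2, 𝒢.mul_inv_cancel_right e, 𝒢.mul_inv,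
    𝒢.t_mul _ _ e]

lemma mul_inv_mul_mul_inv_inv {p q r : G} (e : 𝒢.s p = 𝒢.s q) (e' : 𝒢.s r = 𝒢.s q) :
    𝒢.mul (𝒢.mul p (𝒢.inv q)) (𝒢.inv (𝒢.mul r (𝒢.inv q))) = 𝒢.mul p (𝒢.inv r) := by
  have h1 : 𝒢.s r = 𝒢.t (𝒢.inv q) := by rw [𝒢.t_inv, e']
  rw [𝒢.inv_mul_rev h1, 𝒢.inv_inv, ← 𝒢.mul_assoc, 𝒢.inv_mul_cancel_right e]
  · rw [𝒢.s_mul _ _ (e.trans (𝒢.t_inv q).symm), 𝒢.s_inv]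
  · rw [𝒢.t_inv, e']

lemma mul_mul_inv_mul {a p b q : G} (ha : 𝒢.s a = 𝒢.t p) (hb : 𝒢.s b = 𝒢.t q)
    (e : 𝒢.s p = 𝒢.s q) :
    𝒢.mul (𝒢.mul a p) (𝒢.inv (𝒢.mul b q)) = 𝒢.mul (𝒢.mul a (𝒢.mul p (𝒢.inv q))) (𝒢.inv b) := by
  have h1 : 𝒢.s p = 𝒢.t (𝒢.inv q) := by rw [𝒢.t_inv, e]
  have h2 : 𝒢.s (𝒢.inv q) = 𝒢.t (𝒢.inv b) := by rw [𝒢.s_inv, 𝒢.t_inv, hb]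
  have h3 : 𝒢.s (𝒢.mul a p) = 𝒢.t (𝒢.inv q) := by rw [𝒢.s_mul _ _ ha, h1]
  rw [𝒢.inv_mul_rev hb, ← 𝒢.mul_assoc _ _ _ h3 h2, 𝒢.mul_assoc _ _ _ ha h1]

end LieGroupoid

/-! ### Sums of elements of a vector bundle -/

section IsSum

lemma eq_of_mk_eq {B F : Type*} {A : B → Type*} {x : B} {v w : A x}
    (h : (⟨x, v⟩ : TotalSpace F A) = ⟨x, w⟩) : v = w :=
  TotalSpace.mk_inj.1 h

variable {B F : Type*} {A : B → Type*} [∀ x, AddCommGroup (A x)]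

/-- `r = p + q` for points `p, q, r` of the total space of a vector bundle. The points are required
to lie in one fibre, and no base point has to be named, which spares the transport between fibres
over equal base points. -/
def IsSum (p q r : TotalSpace F A) : Prop :=
  ∃ (x : B) (v w : A x), p = ⟨x, v⟩ ∧ q = ⟨x, w⟩ ∧ r = ⟨x, v + w⟩

lemma isSum_mk {x : B} {v w z : A x} :
    IsSum (⟨x, v⟩ : TotalSpace F A) ⟨x, w⟩ ⟨x, z⟩ ↔ v + w = z := by
  constructor
  · rintro ⟨y, v', w', h1, h2, h3⟩
    obtain rfl : x = y := congrArg TotalSpace.proj h1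
    rw [TotalSpace.mk_inj] at h1 h2 h3
    rw [h1, h2, h3]
  · rintro rfl
    exact ⟨x, v, w, rfl, rfl, rfl⟩

lemma IsSum.eq_mk {x : B} {v w : A x} {r : TotalSpace F A}
    (h : IsSum (⟨x, v⟩ : TotalSpace F A) ⟨x, w⟩ r) : r = ⟨x, v + w⟩ := by
  obtain ⟨y, v', w', h1, h2, rfl⟩ := h
  obtain rfl : x = y := congrArg TotalSpace.proj h1
  rw [TotalSpace.mk_inj] at h1 h2
  rw [h1, h2]

lemma isSum_zero_right (p : TotalSpace F A) : IsSum p (zeroSection F A p.proj) p :=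
  isSum_mk.2 (add_zero _)

lemma isSum_zero_left (p : TotalSpace F A) : IsSum (zeroSection F A p.proj) p p :=
  isSum_mk.2 (zero_add _)

lemma mk_eq_iff_fibreCast [∀ x, Module ℝ (A x)] {x y : B} (h : x = y) {v : A x} {w : A y} :
    (⟨x, v⟩ : TotalSpace F A) = ⟨y, w⟩ ↔ fibreCast h v = w := by
  rw [← mk_fibreCast F h, TotalSpace.mk_inj]

lemma fibreCast_eq_zero_iff [∀ x, Module ℝ (A x)] {x y : B} (h : x = y) {v : A x} :
    fibreCast h v = 0 ↔ v = 0 :=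
  (LinearEquiv.cast (R := ℝ) h).map_eq_zero_iff

lemma mk_zero_eq {x y : B} (h : x = y) : (⟨x, 0⟩ : TotalSpace F A) = ⟨y, 0⟩ := by rw [h]

end IsSum

section VB

variable {EM EG : Type*} [NormedAddCommGroup EM] [NormedSpace ℝ EM]
  [NormedAddCommGroup EG] [NormedSpace ℝ EG]
  {M G : Type*} [TopologicalSpace M] [ChartedSpace EM M] [TopologicalSpace G] [ChartedSpace EG G]

namespace VBGroupoid

variable {𝒢 : LieGroupoid 𝓘(ℝ, EM) 𝓘(ℝ, EG) M G}
  {FE : Type*} [NormedAddCommGroup FE] [NormedSpace ℝ FE]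
  {E : M → Type*} [∀ x, AddCommGroup (E x)] [∀ x, Module ℝ (E x)] [∀ x, TopologicalSpace (E x)]
  [TopologicalSpace (TotalSpace FE E)] [FiberBundle FE E] [VectorBundle ℝ FE E]
  {FV : Type*} [NormedAddCommGroup FV] [NormedSpace ℝ FV]
  {V : G → Type*} [∀ g, AddCommGroup (V g)] [∀ g, Module ℝ (V g)] [∀ g, TopologicalSpace (V g)]
  [TopologicalSpace (TotalSpace FV V)] [FiberBundle FV V] [VectorBundle ℝ FV V]
  (𝒱 : VBGroupoid 𝒢 FE E FV V)

/-! ### Zero elements and sums in the total groupoid -/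

lemma tot_s_proj (p : TotalSpace FV V) : (𝒱.tot.s p).proj = 𝒢.s p.proj := by
  rw [show p = ⟨p.proj, p.2⟩ from rfl, 𝒱.tot_s]

lemma tot_t_proj (p : TotalSpace FV V) : (𝒱.tot.t p).proj = 𝒢.t p.proj := by
  rw [show p = ⟨p.proj, p.2⟩ from rfl, 𝒱.tot_t]

lemma tot_inv_proj (p : TotalSpace FV V) : (𝒱.tot.inv p).proj = 𝒢.inv p.proj := by
  rw [show p = ⟨p.proj, p.2⟩ from rfl, 𝒱.tot_inv]

lemma tot_mul_proj {p q : TotalSpace FV V} (e : 𝒱.tot.s p = 𝒱.tot.t q) :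
    (𝒱.tot.mul p q).proj = 𝒢.mul p.proj q.proj := by
  rw [show p = ⟨p.proj, p.2⟩ from rfl, show q = ⟨q.proj, q.2⟩ from rfl, 𝒱.tot_mul _ _ _ _ e]

lemma tot_s_zero (g : G) : 𝒱.tot.s (zeroSection FV V g) = zeroSection FE E (𝒢.s g) := by
  simp [zeroSection, 𝒱.tot_s]

lemma tot_t_zero (g : G) : 𝒱.tot.t (zeroSection FV V g) = zeroSection FE E (𝒢.t g) := by
  simp [zeroSection, 𝒱.tot_t]

lemma tot_u_zero (x : M) : 𝒱.tot.u (zeroSection FE E x) = zeroSection FV V (𝒢.u x) := by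
  simp [zeroSection, 𝒱.tot_u]

lemma tot_inv_zero (g : G) : 𝒱.tot.inv (zeroSection FV V g) = zeroSection FV V (𝒢.inv g) := by
  simp [zeroSection, 𝒱.tot_inv]

lemma tot_mul_zero {g h : G} (e : 𝒢.s g = 𝒢.t h) :
    𝒱.tot.mul (zeroSection FV V g) (zeroSection FV V h) = zeroSection FV V (𝒢.mul g h) := by
  rw [zeroSection, zeroSection, 𝒱.tot_mul]
  · rw [← Prod.zero_eq_mk, map_zero, zeroSection]
  · exact (𝒱.tot_s_zero g).trans ((congrArg _ e).trans (𝒱.tot_t_zero h).symm)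

lemma tot_s_eq_zero_iff {g : G} {v : V g} {x : M} (hx : 𝒢.s g = x) :
    𝒱.tot.s ⟨g, v⟩ = zeroSection FE E x ↔ 𝒱.src g v = 0 := by
  subst hx
  rw [𝒱.tot_s, zeroSection, TotalSpace.mk_inj]

lemma tot_t_eq_zero_iff {g : G} {v : V g} {x : M} (hx : 𝒢.t g = x) :
    𝒱.tot.t ⟨g, v⟩ = zeroSection FE E x ↔ 𝒱.trg g v = 0 := by
  subst hx
  rw [𝒱.tot_t, zeroSection, TotalSpace.mk_inj]

/-- The interchange law: the multiplication is additive on composable pairs. -/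
lemma isSum_mul {p q r p' q' r' : TotalSpace FV V} (h : IsSum p q r) (h' : IsSum p' q' r')
    (hp : 𝒱.tot.s p = 𝒱.tot.t p') (hq : 𝒱.tot.s q = 𝒱.tot.t q') :
    𝒱.tot.s r = 𝒱.tot.t r' ∧
      IsSum (𝒱.tot.mul p p') (𝒱.tot.mul q q') (𝒱.tot.mul r r') := by
  obtain ⟨g, v, w, rfl, rfl, rfl⟩ := h
  obtain ⟨g', v', w', rfl, rfl, rfl⟩ := h'
  have e : 𝒢.s g = 𝒢.t g' := by
    rw [𝒱.tot_s, 𝒱.tot_t] at hp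
    exact congrArg TotalSpace.proj hp
  have hr : 𝒱.tot.s ⟨g, v + w⟩ = 𝒱.tot.t ⟨g', v' + w'⟩ := by
    rw [𝒱.tot_s, 𝒱.tot_t, mk_eq_iff_fibreCast e] at hp hq ⊢
    rw [map_add, map_add, map_add, hp, hq]
  refine ⟨hr, ?_⟩
  rw [𝒱.tot_mul _ _ _ _ hp, 𝒱.tot_mul _ _ _ _ hq, 𝒱.tot_mul _ _ _ _ hr, isSum_mk, ← map_add]
  rfl

/-- `p 0_h + 0_g q = p q` if `p` over `g` has source zero and `q` over `h` has target zero. -/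
lemma isSum_mul_zero_zero_mul {p q : TotalSpace FV V} {x : M}
    (hp : 𝒱.tot.s p = zeroSection FE E x) (hq : 𝒱.tot.t q = zeroSection FE E x) :
    IsSum (𝒱.tot.mul p (zeroSection FV V q.proj)) (𝒱.tot.mul (zeroSection FV V p.proj) q)
      (𝒱.tot.mul p q) := by
  have h1 : 𝒢.s p.proj = x := by
    rw [← 𝒱.tot_s_proj, hp, zeroSection_proj]
  have h2 : 𝒢.t q.proj = x := by
    rw [← 𝒱.tot_t_proj, hq, zeroSection_proj]
  refine (𝒱.isSum_mul (isSum_zero_right p) (isSum_zero_left q) ?_ ?_).2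
  · rw [hp, 𝒱.tot_t_zero, h2]
  · rw [hq, 𝒱.tot_s_zero, h1]

lemma mul_zero_unit {p : TotalSpace FV V} {x : M} (hp : 𝒱.tot.s p = zeroSection FE E x) :
    𝒱.tot.mul p (zeroSection FV V (𝒢.u x)) = p := by
  have := 𝒱.tot.mul_u p
  rwa [hp, 𝒱.tot_u_zero] at this

lemma zero_unit_mul {p : TotalSpace FV V} {x : M} (hp : 𝒱.tot.t p = zeroSection FE E x) :
    𝒱.tot.mul (zeroSection FV V (𝒢.u x)) p = p := by
  have := 𝒱.tot.u_mul p
  rwa [hp, 𝒱.tot_u_zero] at this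

/-- Over a unit, the inverse of an element with vanishing source and target is its negative. -/
lemma isSum_inv_self {p : TotalSpace FV V} {x : M} (hx : p.proj = 𝒢.u x)
    (hs : 𝒱.tot.s p = zeroSection FE E x) (ht : 𝒱.tot.t p = zeroSection FE E x) :
    IsSum (𝒱.tot.inv p) p (zeroSection FV V (𝒢.u x)) := by
  have hp' : (𝒱.tot.inv p).proj = 𝒢.u x := by
    rw [𝒱.tot_inv_proj, hx, 𝒢.inv_u]
  have hs' : 𝒱.tot.s (𝒱.tot.inv p) = zeroSection FE E x := by rw [𝒱.tot.s_inv, ht]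
  have := 𝒱.isSum_mul_zero_zero_mul hs' ht
  rwa [hx, hp', 𝒱.mul_zero_unit hs', 𝒱.zero_unit_mul ht, 𝒱.tot.inv_mul, hs, 𝒱.tot_u_zero] at this

/-- `a 0_g b⁻¹ + 0_g b = a 0_g` for `a` in the core and `b` in the kernel of the core-anchor. -/
lemma isSum_mul_zero_mul_inv {a b : TotalSpace FV V} {g : G}
    (ha' : a.proj = 𝒢.u (𝒢.t g)) (ha : 𝒱.tot.s a = zeroSection FE E (𝒢.t g))
    (hb : b.proj = 𝒢.u (𝒢.s g))
    (hs : 𝒱.tot.s b = zeroSection FE E (𝒢.s g)) (ht : 𝒱.tot.t b = zeroSection FE E (𝒢.s g)) :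
    IsSum (𝒱.tot.mul (𝒱.tot.mul a (zeroSection FV V g)) (𝒱.tot.inv b))
      (𝒱.tot.mul (zeroSection FV V g) b) (𝒱.tot.mul a (zeroSection FV V g)) := by
  have e : 𝒱.tot.s a = 𝒱.tot.t (zeroSection FV V g) := by rw [ha, 𝒱.tot_t_zero]
  have hag : 𝒱.tot.s (𝒱.tot.mul a (zeroSection FV V g)) = zeroSection FE E (𝒢.s g) := by
    rw [𝒱.tot.s_mul _ _ e, 𝒱.tot_s_zero]
  have hpr : (𝒱.tot.mul a (zeroSection FV V g)).proj = g := by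
    rw [𝒱.tot_mul_proj e, ha', zeroSection_proj, 𝒢.u_mul]
  have := (𝒱.isSum_mul (isSum_zero_right (𝒱.tot.mul a (zeroSection FV V g)))
    (𝒱.isSum_inv_self hb hs ht) (by rw [hag, 𝒱.tot.t_inv, hs])
    (by rw [hpr, 𝒱.tot_s_zero, ht])).2
  rwa [hpr, 𝒱.mul_zero_unit hag] at this

end VBGroupoid
end VB

/-! ### Alternating sums -/

/-- The composite of two alternating sums vanishes on an element on which the cosimplicial
identities hold. -/
lemma alternating_sum_alternating_sum_eq_zero {A B C : Type*} [AddCommGroup A] [Module ℝ A]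
    [AddCommGroup B] [Module ℝ B] [AddCommGroup C] [Module ℝ C] {n : ℕ}
    (d : Fin (n + 1) → A →ₗ[ℝ] B) (d' : Fin (n + 2) → B →ₗ[ℝ] C) (c : A)
    (h : ∀ i j : Fin (n + 1), i ≤ j → d' j.succ (d i c) = d' i.castSucc (d j c)) :
    ∑ j : Fin (n + 2), (-1 : ℝ) ^ (j : ℕ) •
      d' j (∑ i : Fin (n + 1), (-1 : ℝ) ^ (i : ℕ) • d i c) = 0 := by
  set f : Fin (n + 2) → Fin (n + 1) → C :=
    fun j i => (-1 : ℝ) ^ (j : ℕ) • (-1 : ℝ) ^ (i : ℕ) • d' j (d i c) with hf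
  have hsum : ∀ i, ∑ j, f j i =
      ∑ j : Fin (n + 1), ((if j ≤ i then f j.castSucc i else 0) +
        if i ≤ j then f j.succ i else 0) := by
    intro i
    have hs : ∀ j, f j i = (if j ≤ i.castSucc then f j i else 0) +
        if i.castSucc < j then f j i else 0 := by
      intro j
      rcases le_or_gt j i.castSucc with hj | hj
      · simp [hj, hj.not_gt]
      · simp [hj, hj.not_ge]
    rw [Finset.sum_congr rfl fun j _ => hs j, Finset.sum_add_distrib, Fin.sum_univ_castSucc,
      Fin.sum_univ_succ (fun j => if i.castSucc < j then f j i else 0), Finset.sum_add_distrib]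
    simp [Fin.castSucc_lt_succ_iff, (Fin.castSucc_lt_last i).not_ge]
  have hzero : ∑ i, ∑ j, f j i = 0 := by
    rw [Finset.sum_congr rfl fun i _ => hsum i]
    simp only [Finset.sum_add_distrib]
    rw [Finset.sum_comm (f := fun i j => if j ≤ i then f j.castSucc i else 0),
      ← Finset.sum_add_distrib]
    refine Finset.sum_eq_zero fun i _ => ?_
    rw [← Finset.sum_add_distrib]
    refine Finset.sum_eq_zero fun j _ => ?_
    split_ifs with hij
    · simp only [hf, h i j hij, Fin.val_castSucc, Fin.val_succ, pow_succ]
      rw [smul_smul, smul_smul, ← add_smul, mul_comm ((-1 : ℝ) ^ (i : ℕ))]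
      simp
    · simp
  rw [Finset.sum_comm] at hzero
  rw [← hzero]
  refine Finset.sum_congr rfl fun j _ => ?_
  simp only [hf, map_sum, map_smul, Finset.smul_sum]

lemma NerveStr.s_first {EM EG : Type*} [NormedAddCommGroup EM] [NormedSpace ℝ EM]
    [NormedAddCommGroup EG] [NormedSpace ℝ EG] {M G : Type*} [TopologicalSpace M]
    [ChartedSpace EM M] [TopologicalSpace G] [ChartedSpace EG G]
    {𝒢 : LieGroupoid 𝓘(ℝ, EM) 𝓘(ℝ, EG) M G} {k : ℕ} (σ : NerveStr 𝒢 (k + 1)) :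
    𝒢.s σ.first = (face 0 σ).obj 0 := σ.s_arr_zero

section VB

variable {EM EG : Type*} [NormedAddCommGroup EM] [NormedSpace ℝ EM]
  [NormedAddCommGroup EG] [NormedSpace ℝ EG]
  {M G : Type*} [TopologicalSpace M] [ChartedSpace EM M] [TopologicalSpace G] [ChartedSpace EG G]

namespace VBGroupoid

open NerveStr

variable {𝒢 : LieGroupoid 𝓘(ℝ, EM) 𝓘(ℝ, EG) M G}
  {FE : Type*} [NormedAddCommGroup FE] [NormedSpace ℝ FE]
  {E : M → Type*} [∀ x, AddCommGroup (E x)] [∀ x, Module ℝ (E x)] [∀ x, TopologicalSpace (E x)]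
  [TopologicalSpace (TotalSpace FE E)] [FiberBundle FE E] [VectorBundle ℝ FE E]
  {FV : Type*} [NormedAddCommGroup FV] [NormedSpace ℝ FV]
  {V : G → Type*} [∀ g, AddCommGroup (V g)] [∀ g, Module ℝ (V g)] [∀ g, TopologicalSpace (V g)]
  [TopologicalSpace (TotalSpace FV V)] [FiberBundle FV V] [VectorBundle ℝ FV V]
  (𝒱 : VBGroupoid 𝒢 FE E FV V) {k : ℕ}

/-! ### Sources and targets of cochains -/

/-- The target of a family `c (g₁, …, gₖ) ∈ V g₁`, a family of elements of `E` at `t g₁`. -/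
def trgSec (k : ℕ) : (∀ σ : NerveStr 𝒢 k, V σ.first) →ₗ[ℝ] (∀ σ : NerveStr 𝒢 k, E (σ.obj 0)) :=
  LinearMap.pi fun σ => fibreCast (A := E) σ.t_first ∘ₗ 𝒱.trg σ.first ∘ₗ LinearMap.proj σ

/-- The source of a family `c (g₁, …, gₖ₊₁) ∈ V g₁`, evaluated for a unit `g₁`, as a family of
elements of `E` on the strings `(g₂, …, gₖ₊₁)`. -/
def srcSec (k : ℕ) : (∀ σ : NerveStr 𝒢 (k + 1), V σ.first) →ₗ[ℝ]
    (∀ σ : NerveStr 𝒢 k, E (σ.obj 0)) :=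
  LinearMap.pi fun σ =>
    fibreCast (A := E) (𝒢.s_u (σ.obj 0)) ∘ₗ 𝒱.src (𝒢.u (σ.obj 0)) ∘ₗ LinearMap.proj σ.consUnit

lemma srcProj_apply (c : ∀ σ : NerveStr 𝒢 (k + 1), V σ.first) (σ : NerveStr 𝒢 k) :
    𝒱.srcProj k c σ = Submodule.Quotient.mk (𝒱.srcSec k c σ) := rfl

lemma mk_trgSec (c : ∀ σ : NerveStr 𝒢 k, V σ.first) (σ : NerveStr 𝒢 k) :
    (⟨σ.obj 0, 𝒱.trgSec k c σ⟩ : TotalSpace FE E) = 𝒱.tot.t ⟨σ.first, c σ⟩ := by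
  rw [𝒱.tot_t]
  exact mk_fibreCast FE σ.t_first _

lemma mk_srcSec (c : ∀ σ : NerveStr 𝒢 (k + 1), V σ.first) (σ : NerveStr 𝒢 k) :
    (⟨σ.obj 0, 𝒱.srcSec k c σ⟩ : TotalSpace FE E) =
      𝒱.tot.s ⟨σ.consUnit.first, c σ.consUnit⟩ := by
  rw [𝒱.tot_s]
  exact mk_fibreCast FE (𝒢.s_u (σ.obj 0)) _

/-- The source-projectable families: the source of `c (g₁, …, gₖ₊₁)` does not depend on `g₁`, and
so agrees with the source for a unit `g₁`. -/
def projectable (k : ℕ) : Submodule ℝ (∀ σ : NerveStr 𝒢 (k + 1), V σ.first) :=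
  LinearMap.eqLocus
    (LinearMap.pi fun σ =>
      fibreCast (A := E) σ.s_first ∘ₗ 𝒱.src σ.first ∘ₗ LinearMap.proj σ)
    (LinearMap.pi fun σ => LinearMap.proj (face 0 σ) ∘ₗ 𝒱.srcSec k)

variable {𝒱}

lemma mem_projectable_iff {c : ∀ σ : NerveStr 𝒢 (k + 1), V σ.first} :
    c ∈ 𝒱.projectable k ↔ ∀ σ : NerveStr 𝒢 (k + 1),
      𝒱.tot.s ⟨σ.first, c σ⟩ = ⟨(face 0 σ).obj 0, 𝒱.srcSec k c (face 0 σ)⟩ := by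
  rw [projectable, LinearMap.mem_eqLocus, funext_iff]
  refine forall_congr' fun σ => ?_
  rw [𝒱.tot_s, mk_eq_iff_fibreCast σ.s_first]
  rfl

lemma mem_projectable_iff_forall_face_eq {c : ∀ σ : NerveStr 𝒢 (k + 1), V σ.first} :
    c ∈ 𝒱.projectable k ↔ ∀ σ τ : NerveStr 𝒢 (k + 1),
      face 0 σ = face 0 τ → 𝒱.tot.s ⟨σ.first, c σ⟩ = 𝒱.tot.s ⟨τ.first, c τ⟩ := by
  rw [mem_projectable_iff]
  refine ⟨fun h σ τ e => by rw [h, h, e], fun h σ => ?_⟩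
  rw [mk_srcSec]
  exact h _ _ (by simp)

lemma src_eq_zero_iff_tot_s {c : ∀ σ : NerveStr 𝒢 k, V σ.first} {σ : NerveStr 𝒢 k} :
    𝒱.src _ (c σ) = 0 ↔
      𝒱.tot.s ⟨σ.first, c σ⟩ = zeroSection FE E (𝒢.s σ.first) :=
  (𝒱.tot_s_eq_zero_iff rfl).symm

/-- A projectable family with vanishing source section takes values in the kernel of the source. -/
lemma src_eq_zero_of_srcSec {c : ∀ σ : NerveStr 𝒢 (k + 1), V σ.first} (hc : c ∈ 𝒱.projectable k)
    (h : 𝒱.srcSec k c = 0) (σ : NerveStr 𝒢 (k + 1)) : 𝒱.src _ (c σ) = 0 := by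
  have := mem_projectable_iff.1 hc σ
  rw [h] at this
  exact (𝒱.tot_s_eq_zero_iff σ.s_first).1 this

lemma mem_projectable_of_src_eq_zero {c : ∀ σ : NerveStr 𝒢 (k + 1), V σ.first}
    (hc : ∀ σ, 𝒱.src _ (c σ) = 0) : c ∈ 𝒱.projectable k ∧ 𝒱.srcSec k c = 0 := by
  refine ⟨mem_projectable_iff_forall_face_eq.2 fun σ τ e => ?_, funext fun σ => ?_⟩
  · rw [𝒱.tot_s, 𝒱.tot_s, hc, hc]
    exact mk_zero_eq ((σ.s_first.trans (congrArg (fun ρ => ρ.obj 0) e)).trans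
      τ.s_first.symm)
  · exact (congrArg (fibreCast (𝒢.s_u _)) (hc σ.consUnit)).trans (map_zero _)

variable (𝒱)

/-! ### The differential as an alternating sum of coface maps -/

lemma mul_first_inv_first (σ : NerveStr 𝒢 (k + 1 + 1)) :
    𝒢.mul (face 1 σ).first (𝒢.inv (face 0 σ).first) = σ.first := by
  rw [first_face_one, first_face_zero]
  exact 𝒢.mul_inv_cancel_right (σ.s_eq_t rfl)

/-- The family `c (g₁ g₂, g₃, …, gₖ₊₂) · c (g₂, …, gₖ₊₂)⁻¹`. -/
def divFace (k : ℕ) : (∀ σ : NerveStr 𝒢 (k + 1), V σ.first) →ₗ[ℝ]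
    (∀ σ : NerveStr 𝒢 (k + 1 + 1), V σ.first) :=
  LinearMap.pi fun σ =>
    fibreCast (mul_first_inv_first σ) ∘ₗ
        𝒱.mul (face 1 σ).first (𝒢.inv (face 0 σ).first) ∘ₗ
          LinearMap.prod (LinearMap.proj (face 1 σ))
            (𝒱.inv (face 0 σ).first ∘ₗ LinearMap.proj (face 0 σ))

variable (𝒢 V) in
/-- The family `c (g₁, …, gᵢ₊₂ gᵢ₊₃, …, gₖ₊₂)`. -/
def pullFace (k : ℕ) (i : Fin (k + 1)) : (∀ σ : NerveStr 𝒢 (k + 1), V σ.first) →ₗ[ℝ]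
    (∀ σ : NerveStr 𝒢 (k + 1 + 1), V σ.first) :=
  LinearMap.pi fun σ =>
    fibreCast (first_face_succ_succ σ i) ∘ₗ LinearMap.proj (face i.succ.succ σ)

/-- The coface maps of the cosimplicial vector space whose alternating sum is the VB-differential
in positive degrees. -/
def coface (k : ℕ) : Fin (k + 2) → (∀ σ : NerveStr 𝒢 (k + 1), V σ.first) →ₗ[ℝ]
    (∀ σ : NerveStr 𝒢 (k + 1 + 1), V σ.first) :=
  Fin.cons (𝒱.divFace k) (pullFace 𝒢 V k)

@[simp] lemma coface_zero : 𝒱.coface k 0 = 𝒱.divFace k := rfl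

@[simp] lemma coface_succ (i : Fin (k + 1)) : 𝒱.coface k i.succ = pullFace 𝒢 V k i := rfl

lemma dVB_succ (c : ∀ σ : NerveStr 𝒢 (k + 1), V σ.first) :
    𝒱.dVB (k + 1) c = -𝒱.divFace k c + ∑ i : Fin (k + 1), (-1 : ℝ) ^ ((i : ℕ) + 2) •
      pullFace 𝒢 V k i c := by
  funext σ
  simp only [dVB, divFace, pullFace, LinearMap.pi_apply, LinearMap.add_apply,
    LinearMap.neg_apply, LinearMap.sum_apply, LinearMap.smul_apply, Pi.add_apply, Pi.neg_apply,
    Finset.sum_apply, Pi.smul_apply]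

lemma dVB_succ_eq_coface (c : ∀ σ : NerveStr 𝒢 (k + 1), V σ.first) :
    𝒱.dVB (k + 1) c = -∑ i : Fin (k + 2), (-1 : ℝ) ^ (i : ℕ) • 𝒱.coface k i c := by
  rw [dVB_succ, Fin.sum_univ_succ (fun i => (-1 : ℝ) ^ (i : ℕ) • 𝒱.coface k i c), neg_add,
    ← Finset.sum_neg_distrib]
  simp only [Fin.val_zero, pow_zero, one_smul, coface_zero, coface_succ, Fin.val_succ, pow_succ]
  simp

variable {𝒱}

lemma mk_pullFace (c : ∀ σ : NerveStr 𝒢 (k + 1), V σ.first) (i : Fin (k + 1))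
    (σ : NerveStr 𝒢 (k + 1 + 1)) :
    (⟨σ.first, pullFace 𝒢 V k i c σ⟩ : TotalSpace FV V) =
      ⟨(face i.succ.succ σ).first, c (face i.succ.succ σ)⟩ :=
  mk_fibreCast FV (first_face_succ_succ σ i) _

lemma face_zero_face_one (σ : NerveStr 𝒢 (k + 1 + 1)) :
    face 0 (face 1 σ) = face 0 (face 0 σ) := face_face 0 0 le_rfl σ

lemma face_one_face_succ_succ (i : Fin (k + 1)) (σ : NerveStr 𝒢 (k + 1 + 1)) :
    face 1 (face i.succ.succ σ) = face i.succ (face 1 σ) :=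
  face_face 1 i.succ (by simp [Fin.le_def]) σ

lemma face_zero_face_succ (i : Fin (k + 2)) (σ : NerveStr 𝒢 (k + 1 + 1)) :
    face 0 (face i.succ σ) = face i (face 0 σ) :=
  face_face 0 i (Fin.zero_le _) σ

lemma tot_s_eq_of_mem_projectable {c : ∀ σ : NerveStr 𝒢 (k + 1), V σ.first}
    (hc : c ∈ 𝒱.projectable k) {σ τ : NerveStr 𝒢 (k + 1)} (h : face 0 σ = face 0 τ) :
    𝒱.tot.s ⟨σ.first, c σ⟩ = 𝒱.tot.s ⟨τ.first, c τ⟩ :=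
  mem_projectable_iff_forall_face_eq.1 hc σ τ h

lemma mk_divFace {c : ∀ σ : NerveStr 𝒢 (k + 1), V σ.first} (hc : c ∈ 𝒱.projectable k)
    (σ : NerveStr 𝒢 (k + 1 + 1)) :
    (⟨σ.first, 𝒱.divFace k c σ⟩ : TotalSpace FV V) =
      𝒱.tot.mul ⟨_, c (face 1 σ)⟩ (𝒱.tot.inv ⟨_, c (face 0 σ)⟩) := by
  have h : 𝒱.tot.s ⟨_, c (face 1 σ)⟩ = 𝒱.tot.t (𝒱.tot.inv ⟨_, c (face 0 σ)⟩) := by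
    rw [𝒱.tot.t_inv]
    exact tot_s_eq_of_mem_projectable hc (face_zero_face_one σ)
  rw [𝒱.tot_inv] at h ⊢
  rw [𝒱.tot_mul _ _ _ _ h]
  exact mk_fibreCast FV (mul_first_inv_first σ) _

lemma tot_s_divFace {c : ∀ σ : NerveStr 𝒢 (k + 1), V σ.first} (hc : c ∈ 𝒱.projectable k)
    (σ : NerveStr 𝒢 (k + 1 + 1)) :
    𝒱.tot.s ⟨σ.first, 𝒱.divFace k c σ⟩ =
      ⟨(face 0 σ).obj 0, 𝒱.trgSec (k + 1) c (face 0 σ)⟩ := by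
  rw [mk_divFace hc, mk_trgSec, 𝒱.tot.s_mul, 𝒱.tot.s_inv]
  rw [𝒱.tot.t_inv]
  exact tot_s_eq_of_mem_projectable hc (face_zero_face_one σ)

lemma divFace_mem_projectable {c : ∀ σ : NerveStr 𝒢 (k + 1), V σ.first}
    (hc : c ∈ 𝒱.projectable k) : 𝒱.divFace k c ∈ 𝒱.projectable (k + 1) :=
  mem_projectable_iff_forall_face_eq.2 fun σ τ h => by
    rw [tot_s_divFace hc, tot_s_divFace hc, h]

lemma srcSec_divFace {c : ∀ σ : NerveStr 𝒢 (k + 1), V σ.first} (hc : c ∈ 𝒱.projectable k) :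
    𝒱.srcSec (k + 1) (𝒱.divFace k c) = 𝒱.trgSec (k + 1) c := by
  funext σ
  have := (𝒱.mk_srcSec (𝒱.divFace k c) σ).trans (tot_s_divFace hc _)
  rwa [face_zero_consUnit, TotalSpace.mk_inj] at this

lemma pullFace_mem_projectable {c : ∀ σ : NerveStr 𝒢 (k + 1), V σ.first}
    (hc : c ∈ 𝒱.projectable k) (i : Fin (k + 1)) :
    pullFace 𝒢 V k i c ∈ 𝒱.projectable (k + 1) :=
  mem_projectable_iff_forall_face_eq.2 fun σ τ h => by
    rw [mk_pullFace, mk_pullFace]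
    exact tot_s_eq_of_mem_projectable hc (by rw [face_zero_face_succ, face_zero_face_succ, h])

lemma srcSec_pullFace {c : ∀ σ : NerveStr 𝒢 (k + 1), V σ.first} (hc : c ∈ 𝒱.projectable k)
    (i : Fin (k + 1)) (σ : NerveStr 𝒢 (k + 1)) :
    𝒱.srcSec (k + 1) (pullFace 𝒢 V k i c) σ =
      fibreCast (A := E) (face_succ_obj_zero σ i) (𝒱.srcSec k c (face i.succ σ)) := by
  have h1 := 𝒱.mk_srcSec (pullFace 𝒢 V k i c) σ
  have h2 := 𝒱.mk_srcSec c (face i.succ σ)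
  rw [mk_pullFace, tot_s_eq_of_mem_projectable hc (τ := (face i.succ σ).consUnit), ← h2] at h1
  · exact ((mk_eq_iff_fibreCast (face_succ_obj_zero σ i)).1 h1.symm).symm
  · rw [face_zero_face_succ, face_zero_consUnit, face_zero_consUnit]

lemma coface_mem_projectable {c : ∀ σ : NerveStr 𝒢 (k + 1), V σ.first}
    (hc : c ∈ 𝒱.projectable k) (i : Fin (k + 2)) :
    𝒱.coface k i c ∈ 𝒱.projectable (k + 1) := by
  induction i using Fin.cases with
  | zero => exact divFace_mem_projectable hc
  | succ i => exact pullFace_mem_projectable hc i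

lemma dVB_succ_mem_projectable {c : ∀ σ : NerveStr 𝒢 (k + 1), V σ.first}
    (hc : c ∈ 𝒱.projectable k) : 𝒱.dVB (k + 1) c ∈ 𝒱.projectable (k + 1) := by
  rw [dVB_succ_eq_coface]
  exact neg_mem (sum_mem fun i _ => Submodule.smul_mem _ _ (coface_mem_projectable hc i))

/-- The cosimplicial identities. -/
lemma coface_coface {c : ∀ σ : NerveStr 𝒢 (k + 1), V σ.first} (hc : c ∈ 𝒱.projectable k)
    (i j : Fin (k + 2)) (h : i ≤ j) :
    𝒱.coface (k + 1) j.succ (𝒱.coface k i c) = 𝒱.coface (k + 1) i.castSucc (𝒱.coface k j c) := by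
  funext σ
  rw [← TotalSpace.mk_inj (F := FV), coface_succ]
  refine (mk_pullFace (𝒱.coface k i c) j σ).trans ?_
  induction i using Fin.cases with
  | zero =>
    rw [coface_zero, Fin.castSucc_zero, coface_zero, mk_divFace hc]
    refine Eq.trans ?_ (mk_divFace (coface_mem_projectable hc j) σ).symm
    rw [face_one_face_succ_succ, face_zero_face_succ]
    induction j using Fin.cases with
    | zero =>
      rw [coface_zero, mk_divFace hc, mk_divFace hc, face_zero_face_one,
        𝒱.tot.mul_inv_mul_mul_inv_inv]
      · rfl
      · exact tot_s_eq_of_mem_projectable hc (by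
          rw [face_zero_face_one, face_zero_face_one])
      · exact tot_s_eq_of_mem_projectable hc (by rw [face_zero_face_one])
    | succ j =>
      rw [coface_succ, mk_pullFace, mk_pullFace]
  | succ i =>
    induction j using Fin.cases with
    | zero => simp at h
    | succ j =>
      rw [coface_succ, ← Fin.succ_castSucc, coface_succ, mk_pullFace]
      refine Eq.trans ?_ (mk_pullFace (𝒱.coface k j.succ c) i.castSucc σ).symm
      rw [coface_succ, mk_pullFace, face_face _ _ (by simpa using h)]
      rfl

lemma dVB_dVB_succ {c : ∀ σ : NerveStr 𝒢 (k + 1), V σ.first} (hc : c ∈ 𝒱.projectable k) :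
    𝒱.dVB (k + 2) (𝒱.dVB (k + 1) c) = 0 := by
  rw [dVB_succ_eq_coface, dVB_succ_eq_coface]
  simp only [map_neg, smul_neg, Finset.sum_neg_distrib, neg_neg]
  exact alternating_sum_alternating_sum_eq_zero _ _ c (coface_coface hc)

lemma srcSec_dVB_succ {c : ∀ σ : NerveStr 𝒢 (k + 1), V σ.first} (hc : c ∈ 𝒱.projectable k)
    (σ : NerveStr 𝒢 (k + 1)) :
    𝒱.srcSec (k + 1) (𝒱.dVB (k + 1) c) σ = -𝒱.trgSec (k + 1) c σ +
      ∑ i : Fin (k + 1), (-1 : ℝ) ^ ((i : ℕ) + 2) •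
        fibreCast (A := E) (face_succ_obj_zero σ i) (𝒱.srcSec k c (face i.succ σ)) := by
  rw [dVB_succ, map_add, map_neg, map_sum, srcSec_divFace hc]
  simp only [map_smul, Pi.add_apply, Pi.neg_apply, Finset.sum_apply, Pi.smul_apply,
    srcSec_pullFace hc]

end VBGroupoid
end VB

section VB

variable {EM EG : Type*} [NormedAddCommGroup EM] [NormedSpace ℝ EM]
  [NormedAddCommGroup EG] [NormedSpace ℝ EG]
  {M G : Type*} [TopologicalSpace M] [ChartedSpace EM M] [TopologicalSpace G] [ChartedSpace EG G]

namespace VBGroupoid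

open NerveStr

variable {𝒢 : LieGroupoid 𝓘(ℝ, EM) 𝓘(ℝ, EG) M G}
  {FE : Type*} [NormedAddCommGroup FE] [NormedSpace ℝ FE]
  {E : M → Type*} [∀ x, AddCommGroup (E x)] [∀ x, Module ℝ (E x)] [∀ x, TopologicalSpace (E x)]
  [TopologicalSpace (TotalSpace FE E)] [FiberBundle FE E] [VectorBundle ℝ FE E]
  {FV : Type*} [NormedAddCommGroup FV] [NormedSpace ℝ FV]
  {V : G → Type*} [∀ g, AddCommGroup (V g)] [∀ g, Module ℝ (V g)] [∀ g, TopologicalSpace (V g)]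
  [TopologicalSpace (TotalSpace FV V)] [FiberBundle FV V] [VectorBundle ℝ FV V]
  (𝒱 : VBGroupoid 𝒢 FE E FV V) {k : ℕ}

/-! ### Right multiplication by zero elements -/

variable {𝒱}

lemma mem_kerAnchor_iff {x : M} {v : V (𝒢.u x)} :
    v ∈ 𝒱.kerAnchor x ↔ 𝒱.src _ v = 0 ∧ 𝒱.trg _ v = 0 := by
  have hinj : Function.Injective (fibreCast (A := E) (𝒢.t_u x)) :=
    (LinearEquiv.cast (R := ℝ) (𝒢.t_u x)).injective
  constructor
  · rintro ⟨⟨w, hw⟩, hw', rfl⟩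
    refine ⟨hw, hinj ?_⟩
    rw [map_zero]
    exact hw'
  · rintro ⟨hs, ht⟩
    refine ⟨⟨v, hs⟩, ?_, rfl⟩
    change fibreCast (𝒢.t_u x) (𝒱.trg _ v) = 0
    rw [ht, map_zero]

lemma tot_s_of_src_eq_zero {x : M} {v : V (𝒢.u x)} (h : 𝒱.src _ v = 0) :
    𝒱.tot.s ⟨_, v⟩ = zeroSection FE E x := (𝒱.tot_s_eq_zero_iff (𝒢.s_u x)).2 h

lemma tot_t_of_trg_eq_zero {x : M} {v : V (𝒢.u x)} (h : 𝒱.trg _ v = 0) :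
    𝒱.tot.t ⟨_, v⟩ = zeroSection FE E x := (𝒱.tot_t_eq_zero_iff (𝒢.t_u x)).2 h

lemma mul_unit_first (σ : NerveStr 𝒢 k) : 𝒢.mul (𝒢.u (σ.obj 0)) σ.first = σ.first := by
  rw [← σ.t_first, 𝒢.u_mul]

lemma tot_t_zero_first (σ : NerveStr 𝒢 k) :
    𝒱.tot.t (zeroSection FV V σ.first) = zeroSection FE E (σ.obj 0) := by
  rw [𝒱.tot_t_zero, σ.t_first]

lemma mk_rightMulZero {κ : ∀ σ : NerveStr 𝒢 k, V (𝒢.u (σ.obj 0))} {σ : NerveStr 𝒢 k}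
    (hκ : 𝒱.src _ (κ σ) = 0) :
    (⟨σ.first, 𝒱.rightMulZero k κ σ⟩ : TotalSpace FV V) =
      𝒱.tot.mul ⟨_, κ σ⟩ (zeroSection FV V σ.first) := by
  rw [zeroSection, 𝒱.tot_mul]
  · exact mk_fibreCast FV (mul_unit_first σ) _
  · exact (tot_s_of_src_eq_zero hκ).trans (tot_t_zero_first σ).symm

lemma src_rightMulZero {κ : ∀ σ : NerveStr 𝒢 k, V (𝒢.u (σ.obj 0))} {σ : NerveStr 𝒢 k}
    (hκ : 𝒱.src _ (κ σ) = 0) : 𝒱.src _ (𝒱.rightMulZero k κ σ) = 0 := by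
  rw [src_eq_zero_iff_tot_s, mk_rightMulZero hκ, 𝒱.tot.s_mul, 𝒱.tot_s_zero]
  rw [tot_t_zero_first, tot_s_of_src_eq_zero hκ]

lemma mk_trgSec_rightMulZero {κ : ∀ σ : NerveStr 𝒢 k, V (𝒢.u (σ.obj 0))} {σ : NerveStr 𝒢 k}
    (hκ : 𝒱.src _ (κ σ) = 0) :
    (⟨σ.obj 0, 𝒱.trgSec k (𝒱.rightMulZero k κ) σ⟩ : TotalSpace FE E) =
      𝒱.tot.t ⟨_, κ σ⟩ := by
  rw [mk_trgSec, mk_rightMulZero hκ, 𝒱.tot.t_mul]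
  rw [tot_t_zero_first, tot_s_of_src_eq_zero hκ]

lemma rightMulZero_injOn {κ κ' : ∀ σ : NerveStr 𝒢 k, V (𝒢.u (σ.obj 0))}
    (hκ : ∀ σ, 𝒱.src _ (κ σ) = 0) (hκ' : ∀ σ, 𝒱.src _ (κ' σ) = 0)
    (h : 𝒱.rightMulZero k κ = 𝒱.rightMulZero k κ') : κ = κ' := by
  funext σ
  have e : ∀ {κ : ∀ σ : NerveStr 𝒢 k, V (𝒢.u (σ.obj 0))}, 𝒱.src _ (κ σ) = 0 →
      𝒱.tot.s ⟨_, κ σ⟩ = 𝒱.tot.t (zeroSection FV V σ.first) := fun h => by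
    rw [tot_t_zero_first, tot_s_of_src_eq_zero h]
  refine eq_of_mk_eq (F := FV) (A := V) ?_
  rw [← 𝒱.tot.mul_inv_cancel_right (e (hκ σ)), ← 𝒱.tot.mul_inv_cancel_right (e (hκ' σ)),
    ← mk_rightMulZero (hκ σ), ← mk_rightMulZero (hκ' σ), h]

variable (𝒱) in
/-- The family `c (g₁, …, gₖ) · 0_{g₁}⁻¹` of elements over units. -/
def rightDivZero (k : ℕ) (c : ∀ σ : NerveStr 𝒢 k, V σ.first) (σ : NerveStr 𝒢 k) :
    V (𝒢.u (σ.obj 0)) :=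
  fibreCast (by rw [𝒢.mul_inv, σ.t_first]) (𝒱.mul σ.first (𝒢.inv σ.first) (c σ, 0))

lemma mk_rightDivZero {c : ∀ σ : NerveStr 𝒢 k, V σ.first} {σ : NerveStr 𝒢 k}
    (hc : 𝒱.src _ (c σ) = 0) :
    (⟨_, 𝒱.rightDivZero k c σ⟩ : TotalSpace FV V) =
      𝒱.tot.mul ⟨_, c σ⟩ (𝒱.tot.inv (zeroSection FV V σ.first)) := by
  rw [𝒱.tot_inv_zero, zeroSection, 𝒱.tot_mul]
  · exact mk_fibreCast FV _ _
  · refine (src_eq_zero_iff_tot_s.1 hc).trans ?_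
    change _ = 𝒱.tot.t (zeroSection FV V _)
    rw [𝒱.tot_t_zero, 𝒢.t_inv]

lemma tot_s_eq_tot_s_zero {c : ∀ σ : NerveStr 𝒢 k, V σ.first} {σ : NerveStr 𝒢 k}
    (hc : 𝒱.src _ (c σ) = 0) : 𝒱.tot.s ⟨_, c σ⟩ = 𝒱.tot.s (zeroSection FV V σ.first) := by
  rw [𝒱.tot_s_zero, src_eq_zero_iff_tot_s.1 hc]

lemma src_rightDivZero {c : ∀ σ : NerveStr 𝒢 k, V σ.first} {σ : NerveStr 𝒢 k}
    (hc : 𝒱.src _ (c σ) = 0) : 𝒱.src _ (𝒱.rightDivZero k c σ) = 0 := by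
  rw [← 𝒱.tot_s_eq_zero_iff (𝒢.s_u _), mk_rightDivZero hc, 𝒱.tot.s_mul, 𝒱.tot.s_inv,
    tot_t_zero_first]
  rw [𝒱.tot.t_inv, tot_s_eq_tot_s_zero hc]

lemma rightMulZero_rightDivZero {c : ∀ σ : NerveStr 𝒢 k, V σ.first}
    (hc : ∀ σ, 𝒱.src _ (c σ) = 0) : 𝒱.rightMulZero k (𝒱.rightDivZero k c) = c := by
  funext σ
  refine eq_of_mk_eq (F := FV) (A := V) ?_
  rw [mk_rightMulZero (src_rightDivZero (hc σ)),
    mk_rightDivZero (hc σ), 𝒱.tot.inv_mul_cancel_right (tot_s_eq_tot_s_zero (hc σ))]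

lemma rightDivZero_mem_kerAnchor {c : ∀ σ : NerveStr 𝒢 k, V σ.first} {σ : NerveStr 𝒢 k}
    (hc : 𝒱.src _ (c σ) = 0) (hc' : 𝒱.trgSec k c σ = 0) :
    𝒱.rightDivZero k c σ ∈ 𝒱.kerAnchor (σ.obj 0) := by
  refine mem_kerAnchor_iff.2 ⟨src_rightDivZero hc, ?_⟩
  rw [← 𝒱.tot_t_eq_zero_iff (𝒢.t_u _), mk_rightDivZero hc, 𝒱.tot.t_mul, ← mk_trgSec, hc']
  · rfl
  · rw [𝒱.tot.t_inv, tot_s_eq_tot_s_zero hc]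

/-! ### Right multiplication by zero elements and the differentials -/

lemma mul_mul_unit_inv (σ : NerveStr 𝒢 (k + 1)) :
    𝒢.mul (𝒢.mul (σ.arr 0) (𝒢.u ((face 0 σ).obj 0))) (𝒢.inv (σ.arr 0)) = 𝒢.u (σ.obj 0) := by
  rw [← s_arr_zero, 𝒢.mul_u, 𝒢.mul_inv, t_arr_zero]

variable (𝒱) in
/-- The family `0_{g₁} · κ (g₂, …, gₖ₊₁) · 0_{g₁}⁻¹`. -/
def conjFace (k : ℕ) : (∀ σ : NerveStr 𝒢 k, V (𝒢.u (σ.obj 0))) →ₗ[ℝ]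
    (∀ σ : NerveStr 𝒢 (k + 1), V (𝒢.u (σ.obj 0))) :=
  LinearMap.pi fun σ =>
    fibreCast (mul_mul_unit_inv σ) ∘ₗ
        𝒱.mul (𝒢.mul (σ.arr 0) (𝒢.u ((face 0 σ).obj 0))) (𝒢.inv (σ.arr 0)) ∘ₗ
          LinearMap.inl ℝ _ _ ∘ₗ 𝒱.mul (σ.arr 0) (𝒢.u ((face 0 σ).obj 0)) ∘ₗ
            LinearMap.inr ℝ _ _ ∘ₗ LinearMap.proj (face 0 σ)

variable (𝒢 V) in
/-- The family `κ (g₁, …, gᵢ₊₁ gᵢ₊₂, …, gₖ₊₁)`. -/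
def pullUnitFace (k : ℕ) (i : Fin (k + 1)) : (∀ σ : NerveStr 𝒢 k, V (𝒢.u (σ.obj 0))) →ₗ[ℝ]
    (∀ σ : NerveStr 𝒢 (k + 1), V (𝒢.u (σ.obj 0))) :=
  LinearMap.pi fun σ =>
    fibreCast (congrArg 𝒢.u (face_succ_obj_zero σ i)) ∘ₗ LinearMap.proj (face i.succ σ)

lemma dKer_eq (κ : ∀ σ : NerveStr 𝒢 k, V (𝒢.u (σ.obj 0))) :
    𝒱.dKer k κ = 𝒱.conjFace k κ + ∑ i : Fin (k + 1), (-1 : ℝ) ^ ((i : ℕ) + 1) •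
      pullUnitFace 𝒢 V k i κ := by
  funext σ
  simp only [dKer, conjFace, pullUnitFace, LinearMap.pi_apply, LinearMap.add_apply,
    LinearMap.sum_apply, LinearMap.smul_apply, Pi.add_apply,
    Finset.sum_apply, Pi.smul_apply]

lemma mk_pullUnitFace (κ : ∀ σ : NerveStr 𝒢 k, V (𝒢.u (σ.obj 0))) (i : Fin (k + 1))
    (σ : NerveStr 𝒢 (k + 1)) :
    (⟨_, pullUnitFace 𝒢 V k i κ σ⟩ : TotalSpace FV V) = ⟨_, κ (face i.succ σ)⟩ :=
  mk_fibreCast FV (congrArg 𝒢.u (face_succ_obj_zero σ i)) _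

lemma mk_conjFace {κ : ∀ σ : NerveStr 𝒢 k, V (𝒢.u (σ.obj 0))} {σ : NerveStr 𝒢 (k + 1)}
    (hκ : κ (face 0 σ) ∈ 𝒱.kerAnchor ((face 0 σ).obj 0)) :
    𝒱.tot.s (𝒱.tot.mul (zeroSection FV V σ.first) ⟨_, κ (face 0 σ)⟩) =
        𝒱.tot.s (zeroSection FV V σ.first) ∧
      (⟨_, 𝒱.conjFace k κ σ⟩ : TotalSpace FV V) =
        𝒱.tot.mul (𝒱.tot.mul (zeroSection FV V σ.first) ⟨_, κ (face 0 σ)⟩)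
          (𝒱.tot.inv (zeroSection FV V σ.first)) := by
  have h1 : 𝒱.tot.s (zeroSection FV V σ.first) = 𝒱.tot.t ⟨_, κ (face 0 σ)⟩ := by
    rw [tot_t_of_trg_eq_zero (mem_kerAnchor_iff.1 hκ).2, 𝒱.tot_s_zero, σ.s_first]
  have h2 : 𝒱.tot.s (𝒱.tot.mul (zeroSection FV V σ.first) ⟨_, κ (face 0 σ)⟩) =
      𝒱.tot.s (zeroSection FV V σ.first) := by
    rw [𝒱.tot.s_mul _ _ h1, tot_s_of_src_eq_zero (mem_kerAnchor_iff.1 hκ).1, 𝒱.tot_s_zero,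
      σ.s_first]
  refine ⟨h2, ?_⟩
  rw [← 𝒱.tot.t_inv (zeroSection FV V σ.first), 𝒱.tot_inv_zero] at h2
  rw [𝒱.tot_inv_zero]
  simp only [zeroSection] at h1 h2 ⊢
  rw [𝒱.tot_mul _ _ _ _ h1] at h2 ⊢
  rw [𝒱.tot_mul _ _ _ _ h2]
  exact mk_fibreCast FV (mul_mul_unit_inv σ) _

lemma src_conjFace {κ : ∀ σ : NerveStr 𝒢 k, V (𝒢.u (σ.obj 0))} {σ : NerveStr 𝒢 (k + 1)}
    (hκ : κ (face 0 σ) ∈ 𝒱.kerAnchor ((face 0 σ).obj 0)) :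
    𝒱.src _ (𝒱.conjFace k κ σ) = 0 := by
  obtain ⟨h1, h2⟩ := mk_conjFace hκ
  rw [← 𝒱.tot_s_eq_zero_iff (𝒢.s_u _), h2, 𝒱.tot.s_mul _ _ (by rw [h1, 𝒱.tot.t_inv]), 𝒱.tot.s_inv,
    tot_t_zero_first]

lemma mk_rightMulZero_conjFace {κ : ∀ σ : NerveStr 𝒢 k, V (𝒢.u (σ.obj 0))}
    {σ : NerveStr 𝒢 (k + 1)} (hκ : κ (face 0 σ) ∈ 𝒱.kerAnchor ((face 0 σ).obj 0)) :
    (⟨σ.first, 𝒱.rightMulZero (k + 1) (𝒱.conjFace k κ) σ⟩ : TotalSpace FV V) =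
      𝒱.tot.mul (zeroSection FV V σ.first) ⟨_, κ (face 0 σ)⟩ := by
  obtain ⟨h1, h2⟩ := mk_conjFace hκ
  rw [mk_rightMulZero (src_conjFace hκ), h2, 𝒱.tot.inv_mul_cancel_right h1]

lemma src_pullUnitFace {κ : ∀ σ : NerveStr 𝒢 k, V (𝒢.u (σ.obj 0))} (i : Fin (k + 1))
    {σ : NerveStr 𝒢 (k + 1)} (hκ : 𝒱.src _ (κ (face i.succ σ)) = 0) :
    𝒱.src _ (pullUnitFace 𝒢 V k i κ σ) = 0 := by
  rw [← 𝒱.tot_s_eq_zero_iff (𝒢.s_u _), mk_pullUnitFace, tot_s_of_src_eq_zero hκ,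
    face_succ_obj_zero]

lemma mk_rightMulZero_pullUnitFace {κ : ∀ σ : NerveStr 𝒢 k, V (𝒢.u (σ.obj 0))} (i : Fin (k + 1))
    {σ : NerveStr 𝒢 (k + 1)} (hκ : 𝒱.src _ (κ (face i.succ σ)) = 0) :
    (⟨σ.first, 𝒱.rightMulZero (k + 1) (pullUnitFace 𝒢 V k i κ) σ⟩ : TotalSpace FV V) =
      𝒱.tot.mul ⟨_, κ (face i.succ σ)⟩ (zeroSection FV V σ.first) := by
  rw [mk_rightMulZero (src_pullUnitFace i hκ), mk_pullUnitFace]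

lemma src_dKer {κ : ∀ σ : NerveStr 𝒢 k, V (𝒢.u (σ.obj 0))}
    (hκ : ∀ σ, κ σ ∈ 𝒱.kerAnchor (σ.obj 0)) (σ : NerveStr 𝒢 (k + 1)) :
    𝒱.src _ (𝒱.dKer k κ σ) = 0 := by
  rw [dKer_eq, Pi.add_apply, Finset.sum_apply, map_add, map_sum, src_conjFace (hκ _), zero_add]
  refine Finset.sum_eq_zero fun i _ => ?_
  rw [Pi.smul_apply, map_smul, src_pullUnitFace i (mem_kerAnchor_iff.1 (hκ _)).1, smul_zero]

lemma rightMulZero_pullUnitFace {κ : ∀ σ : NerveStr 𝒢 (k + 1), V (𝒢.u (σ.obj 0))}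
    (hκ : ∀ σ, 𝒱.src _ (κ σ) = 0) (i : Fin (k + 1)) :
    𝒱.rightMulZero (k + 2) (pullUnitFace 𝒢 V (k + 1) i.succ κ) =
      pullFace 𝒢 V k i (𝒱.rightMulZero (k + 1) κ) := by
  funext σ
  refine eq_of_mk_eq (F := FV) (A := V) ?_
  rw [mk_pullFace, mk_rightMulZero (hκ _),
    mk_rightMulZero_pullUnitFace i.succ (hκ _), first_face_succ_succ]

lemma isSum_mul_zero_mul_inv_of_face {κ : ∀ σ : NerveStr 𝒢 k, V (𝒢.u (σ.obj 0))}
    (hκ : ∀ σ, κ σ ∈ 𝒱.kerAnchor (σ.obj 0)) (σ : NerveStr 𝒢 (k + 1)) :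
    IsSum (𝒱.tot.mul (𝒱.tot.mul ⟨_, κ (face 1 σ)⟩ (zeroSection FV V σ.first))
        (𝒱.tot.inv ⟨_, κ (face 0 σ)⟩))
      ⟨σ.first, 𝒱.rightMulZero (k + 1) (𝒱.conjFace k κ) σ⟩
      ⟨σ.first, 𝒱.rightMulZero (k + 1) (pullUnitFace 𝒢 V k 0 κ) σ⟩ := by
  have h0 := mem_kerAnchor_iff.1 (hκ (face 0 σ))
  have h1 := mem_kerAnchor_iff.1 (hκ (face 1 σ))
  have e1 : (face 1 σ).obj 0 = 𝒢.t σ.first := by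
    rw [σ.t_first]
    exact face_succ_obj_zero σ 0
  rw [mk_rightMulZero_conjFace (hκ _), mk_rightMulZero_pullUnitFace 0 h1.1]
  refine 𝒱.isSum_mul_zero_mul_inv (congrArg 𝒢.u e1) ?_ (congrArg 𝒢.u σ.s_first.symm) ?_ ?_
  · rw [← e1, tot_s_of_src_eq_zero h1.1]
  · rw [σ.s_first, tot_s_of_src_eq_zero h0.1]
  · rw [σ.s_first, tot_t_of_trg_eq_zero h0.2]

lemma divFace_rightMulZero {κ : ∀ σ : NerveStr 𝒢 (k + 1), V (𝒢.u (σ.obj 0))}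
    (hκ : ∀ σ, κ σ ∈ 𝒱.kerAnchor (σ.obj 0)) :
    𝒱.divFace k (𝒱.rightMulZero (k + 1) κ) + 𝒱.rightMulZero (k + 2) (𝒱.conjFace (k + 1) κ) =
      𝒱.rightMulZero (k + 2) (pullUnitFace 𝒢 V (k + 1) 0 κ) := by
  have hs : ∀ σ, 𝒱.src _ (κ σ) = 0 := fun σ => (mem_kerAnchor_iff.1 (hκ σ)).1
  funext σ
  rw [Pi.add_apply, ← isSum_mk (F := FV),
    mk_divFace (mem_projectable_of_src_eq_zero fun σ => src_rightMulZero (hs σ)).1]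
  convert isSum_mul_zero_mul_inv_of_face hκ σ using 1
  have e : ∀ σ, 𝒱.tot.s ⟨_, κ σ⟩ = 𝒱.tot.t (zeroSection FV V σ.first) := fun σ => by
    rw [tot_t_zero_first, tot_s_of_src_eq_zero (hs σ)]
  have hf : 𝒢.s (face 1 σ).first = 𝒢.s (face 0 σ).first := by
    rw [s_first, s_first, face_zero_face_one]
  rw [mk_rightMulZero (hs _), mk_rightMulZero (hs _), 𝒱.tot.mul_mul_inv_mul (e _) (e _),
    𝒱.tot_inv_zero, 𝒱.tot_mul_zero (hf.trans (𝒢.t_inv _).symm), mul_first_inv_first]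
  rw [𝒱.tot_s_zero, 𝒱.tot_s_zero, hf]

/-- Right multiplication by zero elements is a chain map in positive degrees. -/
lemma dVB_rightMulZero_succ {κ : ∀ σ : NerveStr 𝒢 (k + 1), V (𝒢.u (σ.obj 0))}
    (hκ : ∀ σ, κ σ ∈ 𝒱.kerAnchor (σ.obj 0)) :
    𝒱.dVB (k + 1) (𝒱.rightMulZero (k + 1) κ) = 𝒱.rightMulZero (k + 2) (𝒱.dKer (k + 1) κ) := by
  rw [dVB_succ, dKer_eq, map_add, map_sum, Fin.sum_univ_succ (n := k + 1), map_smul,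
    ← divFace_rightMulZero hκ]
  simp only [map_smul, Fin.val_zero, Fin.val_succ, add_assoc, one_add_one_eq_two,
    rightMulZero_pullUnitFace fun σ => (mem_kerAnchor_iff.1 (hκ σ)).1]
  simp only [zero_add, pow_one, neg_smul, one_smul]
  abel

end VBGroupoid
end VB

section VB

variable {EM EG : Type*} [NormedAddCommGroup EM] [NormedSpace ℝ EM]
  [NormedAddCommGroup EG] [NormedSpace ℝ EG]
  {M G : Type*} [TopologicalSpace M] [ChartedSpace EM M] [TopologicalSpace G] [ChartedSpace EG G]

namespace VBGroupoid

open NerveStr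

variable {𝒢 : LieGroupoid 𝓘(ℝ, EM) 𝓘(ℝ, EG) M G}
  {FE : Type*} [NormedAddCommGroup FE] [NormedSpace ℝ FE]
  {E : M → Type*} [∀ x, AddCommGroup (E x)] [∀ x, Module ℝ (E x)] [∀ x, TopologicalSpace (E x)]
  [TopologicalSpace (TotalSpace FE E)] [FiberBundle FE E] [VectorBundle ℝ FE E]
  {FV : Type*} [NormedAddCommGroup FV] [NormedSpace ℝ FV]
  {V : G → Type*} [∀ g, AddCommGroup (V g)] [∀ g, Module ℝ (V g)] [∀ g, TopologicalSpace (V g)]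
  [TopologicalSpace (TotalSpace FV V)] [FiberBundle FV V] [VectorBundle ℝ FV V]
  {𝒱 : VBGroupoid 𝒢 FE E FV V} {k : ℕ}

/-! ### The differential in degree zero -/

lemma face_one_obj_zero (σ : NerveStr 𝒢 (k + 1)) : (face 1 σ).obj 0 = 𝒢.t σ.first := by
  rw [σ.t_first]
  exact face_succ_obj_zero σ 0

lemma face_zero_obj_zero (σ : NerveStr 𝒢 (k + 1)) : (face 0 σ).obj 0 = 𝒢.s σ.first :=
  σ.s_first.symm

/-- For a section `α` of the core, `(δ α)(g) = α_{t g} · 0_g + 0_g · (α_{s g})⁻¹` is the product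
`α_{t g} · 0_g · (α_{s g})⁻¹` in the total groupoid. -/
lemma mk_dVB_zero {α : ∀ σ : NerveStr 𝒢 0, V σ.first} (hα : ∀ σ, 𝒱.src _ (α σ) = 0)
    (σ : NerveStr 𝒢 1) :
    (⟨σ.first, 𝒱.dVB 0 α σ⟩ : TotalSpace FV V) =
      𝒱.tot.mul (𝒱.tot.mul ⟨_, α (face 1 σ)⟩ (zeroSection FV V σ.first))
        (𝒱.tot.inv ⟨_, α (face 0 σ)⟩) := by
  have hs : ∀ σ, 𝒱.tot.s ⟨σ.first, α σ⟩ = zeroSection FE E (σ.obj 0) :=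
    fun σ => tot_s_of_src_eq_zero (hα σ)
  have h1 : 𝒱.tot.s ⟨_, α (face 1 σ)⟩ = 𝒱.tot.t (zeroSection FV V σ.first) := by
    rw [hs, tot_t_zero, face_one_obj_zero]
  have h0 : 𝒱.tot.s (zeroSection FV V σ.first) = 𝒱.tot.t (𝒱.tot.inv ⟨_, α (face 0 σ)⟩) := by
    rw [𝒱.tot.t_inv, hs, tot_s_zero, face_zero_obj_zero]
  have hag : 𝒱.tot.s (𝒱.tot.mul ⟨_, α (face 1 σ)⟩ (zeroSection FV V σ.first)) =
      zeroSection FE E (𝒢.s σ.first) := by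
    rw [𝒱.tot.s_mul _ _ h1, 𝒱.tot_s_zero]
  have hpr : (𝒱.tot.mul ⟨_, α (face 1 σ)⟩ (zeroSection FV V σ.first)).proj = σ.first := by
    rw [𝒱.tot_mul_proj h1, zeroSection_proj]
    change 𝒢.mul (𝒢.u ((face 1 σ).obj 0)) σ.first = _
    rw [face_one_obj_zero, 𝒢.u_mul]
  have hinv : 𝒱.tot.t (𝒱.tot.inv ⟨_, α (face 0 σ)⟩) = zeroSection FE E (𝒢.s σ.first) := by
    rw [← h0, tot_s_zero]
  have hipr : (𝒱.tot.inv ⟨_, α (face 0 σ)⟩).proj = 𝒢.u (𝒢.s σ.first) := by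
    rw [𝒱.tot_inv_proj]
    change 𝒢.inv (𝒢.u ((face 0 σ).obj 0)) = _
    rw [𝒢.inv_u, face_zero_obj_zero]
  have hsum := 𝒱.isSum_mul_zero_zero_mul hag hinv
  rw [hpr, hipr, 𝒱.mul_zero_unit hag] at hsum
  have pa : 𝒢.mul (𝒢.u ((face 1 σ).obj 0)) σ.first = σ.first := by
    rw [face_one_obj_zero, 𝒢.u_mul]
  have pb : 𝒢.mul σ.first (𝒢.inv (𝒢.u ((face 0 σ).obj 0))) = σ.first := by
    rw [𝒢.inv_u, face_zero_obj_zero, 𝒢.mul_u]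
  have hA : 𝒱.tot.mul ⟨_, α (face 1 σ)⟩ (zeroSection FV V σ.first) =
      ⟨σ.first, fibreCast pa (𝒱.mul (face 1 σ).first σ.first (α (face 1 σ), 0))⟩ :=
    (𝒱.tot_mul _ _ _ _ h1).trans (mk_fibreCast FV pa _).symm
  rw [𝒱.tot_inv] at h0
  have hB : 𝒱.tot.mul (zeroSection FV V σ.first) (𝒱.tot.inv ⟨_, α (face 0 σ)⟩) =
      ⟨σ.first, fibreCast pb (𝒱.mul σ.first (𝒢.inv (face 0 σ).first)
        (0, 𝒱.inv _ (α (face 0 σ))))⟩ := by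
    rw [𝒱.tot_inv]
    exact (𝒱.tot_mul _ _ _ _ h0).trans (mk_fibreCast FV pb _).symm
  rw [hB] at hsum
  nth_rewrite 1 [hA] at hsum
  exact hsum.eq_mk.symm

lemma tot_s_dVB_zero {α : ∀ σ : NerveStr 𝒢 0, V σ.first} (hα : ∀ σ, 𝒱.src _ (α σ) = 0)
    (σ : NerveStr 𝒢 1) :
    𝒱.tot.s ⟨σ.first, 𝒱.dVB 0 α σ⟩ = ⟨(face 0 σ).obj 0, 𝒱.trgSec 0 α (face 0 σ)⟩ := by
  have hs : ∀ σ, 𝒱.tot.s ⟨σ.first, α σ⟩ = zeroSection FE E (σ.obj 0) :=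
    fun σ => tot_s_of_src_eq_zero (hα σ)
  rw [mk_dVB_zero hα, mk_trgSec, 𝒱.tot.s_mul, 𝒱.tot.s_inv]
  rw [𝒱.tot.t_inv, hs, 𝒱.tot.s_mul, tot_s_zero, face_zero_obj_zero]
  rw [hs, tot_t_zero, face_one_obj_zero]

lemma dVB_zero_mem_projectable {α : ∀ σ : NerveStr 𝒢 0, V σ.first}
    (hα : ∀ σ, 𝒱.src _ (α σ) = 0) : 𝒱.dVB 0 α ∈ 𝒱.projectable 0 :=
  mem_projectable_iff_forall_face_eq.2 fun σ τ h => by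
    rw [tot_s_dVB_zero hα, tot_s_dVB_zero hα, h]

lemma srcSec_dVB_zero {α : ∀ σ : NerveStr 𝒢 0, V σ.first} (hα : ∀ σ, 𝒱.src _ (α σ) = 0) :
    𝒱.srcSec 0 (𝒱.dVB 0 α) = 𝒱.trgSec 0 α := by
  funext σ
  have := (𝒱.mk_srcSec (𝒱.dVB 0 α) σ).trans (tot_s_dVB_zero hα _)
  rwa [face_zero_consUnit, TotalSpace.mk_inj] at this

lemma dVB_dVB_zero {α : ∀ σ : NerveStr 𝒢 0, V σ.first} (hα : ∀ σ, 𝒱.src _ (α σ) = 0) :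
    𝒱.dVB 1 (𝒱.dVB 0 α) = 0 := by
  suffices h : 𝒱.divFace 0 (𝒱.dVB 0 α) = pullFace 𝒢 V 0 0 (𝒱.dVB 0 α) by
    rw [dVB_succ, h]
    simp
  have hs : ∀ σ, 𝒱.tot.s ⟨σ.first, α σ⟩ = zeroSection FE E (σ.obj 0) :=
    fun σ => tot_s_of_src_eq_zero (hα σ)
  have h1 : ∀ τ : NerveStr 𝒢 1,
      𝒱.tot.s ⟨_, α (face 1 τ)⟩ = 𝒱.tot.t (zeroSection FV V τ.first) := fun τ => by
    rw [hs, tot_t_zero, face_one_obj_zero]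
  have h0 : ∀ τ : NerveStr 𝒢 1,
      𝒱.tot.s (zeroSection FV V τ.first) = 𝒱.tot.s ⟨_, α (face 0 τ)⟩ := fun τ => by
    rw [hs, tot_s_zero, face_zero_obj_zero]
  funext σ
  refine eq_of_mk_eq (F := FV) (A := V) ?_
  rw [mk_divFace (dVB_zero_mem_projectable hα), mk_pullFace]
  have e : face 1 (face (0 : Fin 1).succ.succ σ) = face 1 (face 1 σ) := face_face 1 1 le_rfl σ
  have e' : face 0 (face (0 : Fin 1).succ.succ σ) = face 1 (face 0 σ) :=
    face_face 0 1 (Fin.zero_le _) σ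
  have hf : 𝒢.s (face 1 σ).first = 𝒢.s (face 0 σ).first := by
    rw [s_first, s_first, face_zero_face_one]
  rw [mk_dVB_zero hα, mk_dVB_zero hα, mk_dVB_zero hα, e, e', face_zero_face_one,
    𝒱.tot.mul_inv_mul_mul_inv_inv, 𝒱.tot.mul_mul_inv_mul,
    𝒱.tot_inv_zero, 𝒱.tot_mul_zero (hf.trans (𝒢.t_inv _).symm), mul_first_inv_first,
    first_face_succ_succ]
  · exact h1 _
  · exact h1 _
  · rw [tot_s_zero, tot_s_zero, hf]
  · rw [𝒱.tot.s_mul _ _ (h1 _), h0, face_zero_face_one]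
  · rw [𝒱.tot.s_mul _ _ (h1 _), h0]

/-- In degree zero, right multiplication by zero elements is a chain map up to sign. -/
lemma dVB_rightMulZero_zero {κ : ∀ σ : NerveStr 𝒢 0, V (𝒢.u (σ.obj 0))}
    (hκ : ∀ σ, κ σ ∈ 𝒱.kerAnchor (σ.obj 0)) :
    𝒱.dVB 0 (𝒱.rightMulZero 0 κ) = -𝒱.rightMulZero 1 (𝒱.dKer 0 κ) := by
  have hs : ∀ σ, 𝒱.src _ (κ σ) = 0 := fun σ => (mem_kerAnchor_iff.1 (hκ σ)).1
  have key : 𝒱.dVB 0 (𝒱.rightMulZero 0 κ) + 𝒱.rightMulZero 1 (𝒱.conjFace 0 κ) =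
      𝒱.rightMulZero 1 (pullUnitFace 𝒢 V 0 0 κ) := by
    funext σ
    rw [Pi.add_apply, ← isSum_mk (F := FV), mk_dVB_zero fun σ => src_rightMulZero (hs σ)]
    convert isSum_mul_zero_mul_inv_of_face hκ σ using 1
    have e : ∀ σ, (⟨σ.first, 𝒱.rightMulZero 0 κ σ⟩ : TotalSpace FV V) = ⟨_, κ σ⟩ := fun σ =>
      (mk_rightMulZero (hs σ)).trans (𝒱.mul_zero_unit (tot_s_of_src_eq_zero (hs σ)))
    rw [e, e]
  rw [dKer_eq, Fin.sum_univ_one, map_add, map_smul, ← key]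
  simp

/-! ### The source projection and the differentials -/

lemma fibreCast_mk {x y : M} (h : x = y) (e : E x) :
    fibreCast (A := 𝒱.Coker) h (Submodule.Quotient.mk e) =
      Submodule.Quotient.mk (fibreCast h e) := by
  subst h
  rfl

lemma cokerAction_srcSec {c : ∀ σ : NerveStr 𝒢 (k + 1), V σ.first} (hc : c ∈ 𝒱.projectable k)
    (σ : NerveStr 𝒢 (k + 1)) :
    fibreCast (A := 𝒱.Coker) (t_arr_zero σ) (𝒱.cokerAction (σ.arr 0)
      (fibreCast (A := 𝒱.Coker) (s_arr_zero σ).symm (𝒱.srcProj k c (face 0 σ)))) =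
      Submodule.Quotient.mk (𝒱.trgSec (k + 1) c σ) := by
  have h : fibreCast (s_arr_zero σ).symm (𝒱.srcSec k c (face 0 σ)) = 𝒱.src (σ.arr 0) (c σ) :=
    (mk_eq_iff_fibreCast (F := FE) _).1
      ((mem_projectable_iff.1 hc σ).symm.trans (𝒱.tot_s σ.first (c σ)))
  rw [srcProj_apply, fibreCast_mk, h]
  exact (congrArg _ (𝒱.cokerAction_mk σ.first (c σ))).trans (fibreCast_mk _ _)

/-- The source projection anticommutes with the differentials. -/
lemma srcProj_dVB_succ {c : ∀ σ : NerveStr 𝒢 (k + 1), V σ.first} (hc : c ∈ 𝒱.projectable k) :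
    𝒱.srcProj (k + 1) (𝒱.dVB (k + 1) c) = -𝒱.dCoker k (𝒱.srcProj k c) := by
  funext σ
  rw [srcProj_apply, srcSec_dVB_succ hc, Pi.neg_apply, dCoker]
  simp only [LinearMap.pi_apply, LinearMap.add_apply, LinearMap.comp_apply, LinearMap.proj_apply,
    LinearMap.sum_apply, LinearMap.smul_apply]
  rw [cokerAction_srcSec hc, neg_add, ← Finset.sum_neg_distrib]
  have h : ∀ i : Fin (k + 1), fibreCast (A := 𝒱.Coker) (face_succ_obj_zero σ i)
      (𝒱.srcProj k c (face i.succ σ)) =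
        Submodule.mkQ _ (fibreCast (face_succ_obj_zero σ i) (𝒱.srcSec k c (face i.succ σ))) :=
    fun i => fibreCast_mk _ _
  simp only [h, ← Submodule.mkQ_apply, map_add, map_neg, map_sum, map_smul, ← neg_smul]
  simp [pow_succ]

lemma srcProj_dVB_zero {α : ∀ σ : NerveStr 𝒢 0, V σ.first} (hα : ∀ σ, 𝒱.src _ (α σ) = 0) :
    𝒱.srcProj 0 (𝒱.dVB 0 α) = 0 := by
  funext σ
  rw [srcProj_apply, srcSec_dVB_zero hα]
  exact (Submodule.Quotient.mk_eq_zero _).2 ⟨⟨α σ, hα σ⟩, rfl⟩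

end VBGroupoid
end VB

/-! ### Generalized inverses of linear maps -/

section GeneralizedInverse

variable {K A B : Type*} [Field K] [AddCommGroup A] [Module K A] [AddCommGroup B] [Module K B]

lemma LinearMap.exists_generalizedInverse (f : A →ₗ[K] B) :
    ∃ g : B →ₗ[K] A, f ∘ₗ g ∘ₗ f = f := by
  obtain ⟨g, hg⟩ := f.rangeRestrict.exists_rightInverse_of_surjective f.range_rangeRestrict
  obtain ⟨g', hg'⟩ := g.exists_extend
  refine ⟨g', LinearMap.ext fun x => ?_⟩
  have h1 : g' (f x) = g (f.rangeRestrict x) := LinearMap.congr_fun hg' (f.rangeRestrict x)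
  have h2 := congrArg Subtype.val (LinearMap.congr_fun hg (f.rangeRestrict x))
  simpa [h1] using h2

/-- If `g₀` is a generalized inverse of `f₀`, and `f` has the same rank as `f₀` and is so near to
`f₀` that `1 + (f - f₀) g₀` has an inverse `T`, then `g₀ T` is a generalized inverse of `f`: the map
`1 + (f - f₀) g₀` sends the range of `f₀` onto the range of `f`. -/
lemma LinearMap.generalizedInverse_of_rank_eq [FiniteDimensional K B] {f₀ f : A →ₗ[K] B}
    {g₀ : B →ₗ[K] A} {T : B →ₗ[K] B} (h₀ : f₀ ∘ₗ g₀ ∘ₗ f₀ = f₀)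
    (hT : T ∘ₗ (LinearMap.id + (f - f₀) ∘ₗ g₀) = LinearMap.id)
    (hr : Module.finrank K (LinearMap.range f) = Module.finrank K (LinearMap.range f₀)) :
    f ∘ₗ (g₀ ∘ₗ T) ∘ₗ f = f := by
  set S : B →ₗ[K] B := LinearMap.id + (f - f₀) ∘ₗ g₀ with hS
  have hinj : Function.Injective S := by
    intro x y hxy
    have := congrArg T hxy
    rwa [← LinearMap.comp_apply, ← LinearMap.comp_apply, hT] at this
  have key : ∀ x, S (f₀ x) = f (g₀ (f₀ x)) := by
    intro x
    have := LinearMap.congr_fun h₀ x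
    simp only [LinearMap.comp_apply] at this
    simp [hS, this]
  have hle : (LinearMap.range f₀).map S ≤ LinearMap.range f := by
    rintro _ ⟨_, ⟨x, rfl⟩, rfl⟩
    exact ⟨_, (key x).symm⟩
  have heq : (LinearMap.range f₀).map S = LinearMap.range f :=
    Submodule.eq_of_le_of_finrank_eq hle
      (by rw [hr, (Submodule.equivMapOfInjective S hinj _).symm.finrank_eq])
  refine LinearMap.ext fun x => ?_
  obtain ⟨_, ⟨y, rfl⟩, hy⟩ : f x ∈ (LinearMap.range f₀).map S := heq ▸ LinearMap.mem_range_self f x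
  have hTS : T (S (f₀ y)) = f₀ y := LinearMap.congr_fun hT (f₀ y)
  simp only [LinearMap.comp_apply]
  rw [← hy, hTS, ← key]

end GeneralizedInverse

/-! ### Smooth families of linear maps between the fibres of vector bundles -/

section SmoothHom

variable {EA EB FA FB EN : Type*}
  [NormedAddCommGroup EA] [NormedSpace ℝ EA] [NormedAddCommGroup EB] [NormedSpace ℝ EB]
  [NormedAddCommGroup EN] [NormedSpace ℝ EN]
  [NormedAddCommGroup FA] [NormedSpace ℝ FA] [FiniteDimensional ℝ FA]
  [NormedAddCommGroup FB] [NormedSpace ℝ FB]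
  {BA BB N : Type*} [TopologicalSpace BA] [ChartedSpace EA BA]
  [TopologicalSpace BB] [ChartedSpace EB BB] [TopologicalSpace N] [ChartedSpace EN N]
  {A : BA → Type*} [∀ x, AddCommGroup (A x)] [∀ x, Module ℝ (A x)] [∀ x, TopologicalSpace (A x)]
  [TopologicalSpace (TotalSpace FA A)] [FiberBundle FA A] [VectorBundle ℝ FA A]
  {B : BB → Type*} [∀ x, AddCommGroup (B x)] [∀ x, Module ℝ (B x)] [∀ x, TopologicalSpace (B x)]
  [TopologicalSpace (TotalSpace FB B)] [FiberBundle FB B] [VectorBundle ℝ FB B]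

/-- The expression in trivializations of a linear map between fibres of two vector bundles, as a
linear function of that map. -/
def homCoord (e : Trivialization FA (TotalSpace.proj : TotalSpace FA A → BA))
    (e' : Trivialization FB (TotalSpace.proj : TotalSpace FB B → BB))
    [MemTrivializationAtlas e] [MemTrivializationAtlas e'] (x : BA) (y : BB) :
    (A x →ₗ[ℝ] B y) →ₗ[ℝ] FA →L[ℝ] FB where
  toFun φ := LinearMap.toContinuousLinearMap (e'.linearMapAt ℝ y ∘ₗ φ ∘ₗ e.symmₗ ℝ x)
  map_add' φ ψ := by ext; simp
  map_smul' r φ := by ext; simp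

lemma homCoord_apply (e : Trivialization FA (TotalSpace.proj : TotalSpace FA A → BA))
    (e' : Trivialization FB (TotalSpace.proj : TotalSpace FB B → BB))
    [MemTrivializationAtlas e] [MemTrivializationAtlas e'] {x : BA} {y : BB} (φ : A x →ₗ[ℝ] B y)
    (v : FA) : homCoord e e' x y φ v = e'.linearMapAt ℝ y (φ (e.symmₗ ℝ x v)) := rfl

variable (FA FB EN) in
/-- The family of linear maps `φ n : A (a n) → B (b n)` is smooth at `n₀`, in the trivializations of
the two vector bundles at `a n₀` and `b n₀`. -/
def SmoothHomAt {a : N → BA} {b : N → BB} (φ : ∀ n, A (a n) →ₗ[ℝ] B (b n)) (n₀ : N) : Prop :=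
  ContMDiffAt 𝓘(ℝ, EN) 𝓘(ℝ, FA →L[ℝ] FB) ∞
    (fun n => homCoord (trivializationAt FA A (a n₀)) (trivializationAt FB B (b n₀)) (a n) (b n)
      (φ n)) n₀

lemma contMDiffAt_clm_of_apply {f : N → FA →L[ℝ] FB} {n₀ : N}
    (h : ∀ v, ContMDiffAt 𝓘(ℝ, EN) 𝓘(ℝ, FB) ∞ (fun n => f n v) n₀) :
    ContMDiffAt 𝓘(ℝ, EN) 𝓘(ℝ, FA →L[ℝ] FB) ∞ f n₀ := by
  set β := Module.finBasis ℝ FA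
  have hf : f = fun n => ∑ i, ContinuousLinearMap.smulRightL ℝ FA FB
      (LinearMap.toContinuousLinearMap (β.coord i)) (f n (β i)) := by
    funext n
    ext v
    conv_lhs => rw [← β.sum_repr v, map_sum]
    simp [map_smul]
  rw [hf]
  exact ContMDiffAt.sum fun i _ => (ContinuousLinearMap.contMDiff _).contMDiffAt.comp _ (h (β i))

section

variable {a : N → BA} {b : N → BB} {φ : ∀ n, A (a n) →ₗ[ℝ] B (b n)} {n₀ : N}

/-- A smooth map of total spaces that is linear on fibres restricts to a smooth family. -/
lemma SmoothHomAt.of_bundleMap [ContMDiffVectorBundle ∞ FA A 𝓘(ℝ, EA)]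
    (Φ : TotalSpace FA A → TotalSpace FB B)
    (hΦ : ContMDiff (𝓘(ℝ, EA).prod 𝓘(ℝ, FA)) (𝓘(ℝ, EB).prod 𝓘(ℝ, FB)) ∞ Φ)
    (ha : ContMDiffAt 𝓘(ℝ, EN) 𝓘(ℝ, EA) ∞ a n₀)
    (h : ∀ n v, Φ ⟨a n, v⟩ = ⟨b n, φ n v⟩) : SmoothHomAt FA FB EN φ n₀ := by
  refine contMDiffAt_clm_of_apply fun w => ?_
  set e := trivializationAt FA A (a n₀) with he
  have hmem : a n₀ ∈ e.baseSet := mem_baseSet_trivializationAt FA A (a n₀)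
  have hsec : ContMDiffAt 𝓘(ℝ, EN) (𝓘(ℝ, EA).prod 𝓘(ℝ, FA)) ∞
      (fun n => (⟨a n, e.symm (a n) w⟩ : TotalSpace FA A)) n₀ := by
    rw [e.contMDiffAt_iff (e.mem_source.2 hmem)]
    refine ⟨ha, (contMDiffAt_const (c := w)).congr_of_eventuallyEq ?_⟩
    filter_upwards [ha.continuousAt.eventually (e.open_baseSet.mem_nhds hmem)] with n hn
    rw [e.apply_mk_symm hn]
  have hcomp := hΦ.contMDiffAt.comp n₀ hsec
  have hb0 : (Φ ⟨a n₀, e.symm (a n₀) w⟩).proj = b n₀ := by rw [h]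
  have hb := (contMDiffAt_totalSpace.1 hcomp)
  simp only [Function.comp_apply, h] at hb
  refine hb.2.congr_of_eventuallyEq ?_
  filter_upwards [ha.continuousAt.eventually (e.open_baseSet.mem_nhds hmem),
    hb.1.continuousAt.eventually ((trivializationAt FB B (b n₀)).open_baseSet.mem_nhds
      (mem_baseSet_trivializationAt FB B (b n₀)))] with n hn hn'
  rw [homCoord_apply, Trivialization.coe_linearMapAt_of_mem _ hn', e.symmₗ_apply hn]

lemma SmoothHomAt.sub {ψ : ∀ n, A (a n) →ₗ[ℝ] B (b n)} (hφ : SmoothHomAt FA FB EN φ n₀)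
    (hψ : SmoothHomAt FA FB EN ψ n₀) : SmoothHomAt FA FB EN (fun n => φ n - ψ n) n₀ := by
  refine (ContMDiffAt.sub hφ hψ).congr_of_eventuallyEq (Filter.Eventually.of_forall fun n => ?_)
  simp only [map_sub]

variable [ContMDiffVectorBundle ∞ FA A 𝓘(ℝ, EA)] [ContMDiffVectorBundle ∞ FB B 𝓘(ℝ, EB)]

/-- Smoothness in some trivializations implies smoothness in all others. -/
lemma contMDiffAt_homCoord_of
    {e f : Trivialization FA (TotalSpace.proj : TotalSpace FA A → BA)}
    {e' f' : Trivialization FB (TotalSpace.proj : TotalSpace FB B → BB)}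
    [MemTrivializationAtlas e] [MemTrivializationAtlas e']
    [MemTrivializationAtlas f] [MemTrivializationAtlas f']
    (ha : ContMDiffAt 𝓘(ℝ, EN) 𝓘(ℝ, EA) ∞ a n₀) (hb : ContMDiffAt 𝓘(ℝ, EN) 𝓘(ℝ, EB) ∞ b n₀)
    (he : a n₀ ∈ e.baseSet) (hf : a n₀ ∈ f.baseSet) (he' : b n₀ ∈ e'.baseSet)
    (hf' : b n₀ ∈ f'.baseSet)
    (h : ContMDiffAt 𝓘(ℝ, EN) 𝓘(ℝ, FA →L[ℝ] FB) ∞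
      (fun n => homCoord e e' (a n) (b n) (φ n)) n₀) :
    ContMDiffAt 𝓘(ℝ, EN) 𝓘(ℝ, FA →L[ℝ] FB) ∞
      (fun n => homCoord f f' (a n) (b n) (φ n)) n₀ := by
  have h1 := ha.coordChangeL (e := f) (e' := e) hf he
  have h2 := hb.coordChangeL (e := e') (e' := f') he' hf'
  refine ((h2.clm_comp h).clm_comp h1).congr_of_eventuallyEq ?_
  filter_upwards [ha.continuousAt.eventually (e.open_baseSet.mem_nhds he),
    ha.continuousAt.eventually (f.open_baseSet.mem_nhds hf),
    hb.continuousAt.eventually (e'.open_baseSet.mem_nhds he'),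
    hb.continuousAt.eventually (f'.open_baseSet.mem_nhds hf')] with n h1 h2 h3 h4
  ext v
  simp only [ContinuousLinearMap.comp_apply, homCoord_apply, ContinuousLinearEquiv.coe_coe]
  rw [f.coordChangeL_apply e ⟨h2, h1⟩, e'.coordChangeL_apply f' ⟨h3, h4⟩,
    e'.symm_linearMapAt h3, e.symmₗ_apply h1, f.symmₗ_apply h2, f'.coe_linearMapAt_of_mem h4]
  have : e.symm (a n) (e ⟨a n, f.symm (a n) v⟩).2 = f.symm (a n) v := e.symm_apply_apply_mk h1 _
  rw [this]

end

end SmoothHom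

/-! ### Generalized inverses of smooth families of constant rank -/

section SmoothHom

variable {EA EB FA FB EN : Type*}
  [NormedAddCommGroup EA] [NormedSpace ℝ EA] [NormedAddCommGroup EB] [NormedSpace ℝ EB]
  [NormedAddCommGroup EN] [NormedSpace ℝ EN]
  [NormedAddCommGroup FA] [NormedSpace ℝ FA] [FiniteDimensional ℝ FA]
  [NormedAddCommGroup FB] [NormedSpace ℝ FB]
  {BA BB N : Type*} [TopologicalSpace BA] [ChartedSpace EA BA]
  [TopologicalSpace BB] [ChartedSpace EB BB] [TopologicalSpace N] [ChartedSpace EN N]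
  {A : BA → Type*} [∀ x, AddCommGroup (A x)] [∀ x, Module ℝ (A x)] [∀ x, TopologicalSpace (A x)]
  [TopologicalSpace (TotalSpace FA A)] [FiberBundle FA A] [VectorBundle ℝ FA A]
  {B : BB → Type*} [∀ x, AddCommGroup (B x)] [∀ x, Module ℝ (B x)] [∀ x, TopologicalSpace (B x)]
  [TopologicalSpace (TotalSpace FB B)] [FiberBundle FB B] [VectorBundle ℝ FB B]


section

variable {a : N → BA} {b : N → BB} {φ : ∀ n, A (a n) →ₗ[ℝ] B (b n)}

/-- A smooth family of linear maps sends smooth families of vectors to smooth families. -/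
lemma SmoothHomAt.smoothFamilyOn {EM EG : Type*} [NormedAddCommGroup EM] [NormedSpace ℝ EM]
    [NormedAddCommGroup EG] [NormedSpace ℝ EG] {M G : Type*} [TopologicalSpace M]
    [ChartedSpace EM M] [TopologicalSpace G] [ChartedSpace EG G]
    {𝒢 : LieGroupoid 𝓘(ℝ, EM) 𝓘(ℝ, EG) M G} {k : ℕ} [ContMDiffVectorBundle ∞ FB B 𝓘(ℝ, EB)]
    {f : NerveStr 𝒢 k → N} {U : Set ((Fin (k + 1) → M) × (Fin k → G))}
    (hφ : ∀ n, SmoothHomAt FA FB EN φ n) (hb : ContMDiff 𝓘(ℝ, EN) 𝓘(ℝ, EB) ∞ b)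
    (hf : NerveStr.SmoothOn 𝓘(ℝ, EN) f U) {v : ∀ σ, A (a (f σ))}
    (hv : NerveStr.SmoothFamilyOn EA FA v U) :
    NerveStr.SmoothFamilyOn EB FB (fun σ => φ (f σ) (v σ)) U := by
  obtain ⟨Fn, hFn, hFns⟩ := hf
  obtain ⟨Fv, hFv, hFvs⟩ := hv
  obtain ⟨f₃, key⟩ : ∃ f₃ : (Fin (k + 1) → M) × (Fin k → G) → TotalSpace FB B,
      ∀ σ : NerveStr 𝒢 k, f₃ σ.embed = ⟨b (f σ), φ (f σ) (v σ)⟩ :=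
    ⟨Function.extend NerveStr.embed (fun σ => ⟨b (f σ), φ (f σ) (v σ)⟩)
      fun p => zeroSection FB B (b (Fn p)), fun σ =>
      NerveStr.embed_injective.extend_apply _ _ σ⟩
  refine ⟨f₃, key, ?_⟩
  rintro _ ⟨⟨σ, rfl⟩, hU⟩
  have hmem : σ.embed ∈ Set.range (NerveStr.embed (𝒢 := 𝒢)) ∩ U := ⟨⟨σ, rfl⟩, hU⟩
  have h1 := hFns σ.embed hmem
  have h2 := contMDiffWithinAt_totalSpace.1 (hFvs σ.embed hmem)
  have hbn : ContMDiffWithinAt (NerveStr.model EM EG k) 𝓘(ℝ, EB) ∞ (fun p => b (Fn p))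
      (Set.range (NerveStr.embed (𝒢 := 𝒢)) ∩ U) σ.embed :=
    hb.contMDiffAt.comp_contMDiffWithinAt _ h1
  have hφn := hφ (f σ)
  rw [SmoothHomAt, ← hFn] at hφn
  have h3 := ContMDiffAt.comp_contMDiffWithinAt _ hφn h1
  have h4 := h3.clm_apply h2.2
  refine contMDiffWithinAt_totalSpace.2 ⟨?_, ?_⟩
  · refine hbn.congr_of_mem ?_ hmem
    rintro _ ⟨⟨τ, rfl⟩, -⟩
    simp only [key, hFn]
  · simp only [key, hFv, hFn] at h4 ⊢
    refine h4.congr_of_eventuallyEq_of_mem ?_ hmem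
    have ha : ∀ᶠ p in nhdsWithin σ.embed (Set.range (NerveStr.embed (𝒢 := 𝒢)) ∩ U),
        (Fv p).proj ∈ (trivializationAt FA A (a (f σ))).baseSet := by
      refine h2.1.continuousWithinAt.eventually
        ((trivializationAt FA A (a (f σ))).open_baseSet.mem_nhds ?_)
      simp only [hFv]
      exact mem_baseSet_trivializationAt FA A _
    have hb : ∀ᶠ p in nhdsWithin σ.embed (Set.range (NerveStr.embed (𝒢 := 𝒢)) ∩ U),
        b (Fn p) ∈ (trivializationAt FB B (b (f σ))).baseSet := by
      refine hbn.continuousWithinAt.eventually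
        ((trivializationAt FB B (b (f σ))).open_baseSet.mem_nhds ?_)
      simp only [hFn]
      exact mem_baseSet_trivializationAt FB B _
    filter_upwards [ha, hb, self_mem_nhdsWithin] with p hpa hpb hpS
    obtain ⟨⟨τ, rfl⟩, -⟩ := hpS
    rw [hFv] at hpa
    rw [hFn] at hpb
    simp only [key, hFv, Function.comp_apply, homCoord_apply]
    have hn := hFn τ
    generalize Fn τ.embed = n at hn ⊢
    subst hn
    rw [Trivialization.symmₗ_apply _ hpa, Trivialization.coe_linearMapAt_of_mem _ hpb]
    congr 4
    exact ((trivializationAt FA A (a (f σ))).symm_apply_apply_mk hpa _).symm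

section

variable (e : Trivialization FA (TotalSpace.proj : TotalSpace FA A → BA))
    (e' : Trivialization FB (TotalSpace.proj : TotalSpace FB B → BB))
    [MemTrivializationAtlas e] [MemTrivializationAtlas e'] {x : BA} {y : BB}

lemma homCoord_eq_comp (hx : x ∈ e.baseSet) (hy : y ∈ e'.baseSet) (φ : A x →ₗ[ℝ] B y) :
    (homCoord e e' x y φ : FA →ₗ[ℝ] FB) =
      (e'.linearEquivAt ℝ y hy).toLinearMap ∘ₗ φ ∘ₗ (e.linearEquivAt ℝ x hx).symm.toLinearMap := by
  ext v
  simp [homCoord_apply, e.symmₗ_apply hx, e'.coe_linearMapAt_of_mem hy]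

lemma finrank_range_homCoord (hx : x ∈ e.baseSet) (hy : y ∈ e'.baseSet) (φ : A x →ₗ[ℝ] B y) :
    Module.finrank ℝ (LinearMap.range (homCoord e e' x y φ : FA →ₗ[ℝ] FB)) =
      Module.finrank ℝ (LinearMap.range φ) := by
  rw [homCoord_eq_comp e e' hx hy, LinearMap.range_comp, LinearEquiv.finrank_map_eq,
    LinearMap.range_comp_of_range_eq_top _ (LinearEquiv.range _)]

/-- The linear map between fibres with a given expression in trivializations. -/
def ofCoord (x : BA) (y : BB) (Ψ : FA →L[ℝ] FB) : A x →ₗ[ℝ] B y :=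
  e'.symmₗ ℝ y ∘ₗ (Ψ : FA →ₗ[ℝ] FB) ∘ₗ e.linearMapAt ℝ x

lemma homCoord_ofCoord (hx : x ∈ e.baseSet) (hy : y ∈ e'.baseSet) (Ψ : FA →L[ℝ] FB) :
    homCoord e e' x y (ofCoord e e' x y Ψ) = Ψ := by
  ext v
  simp only [homCoord_apply, ofCoord, LinearMap.comp_apply, ContinuousLinearMap.coe_coe]
  rw [e.linearMapAt_symmₗ hx, e'.linearMapAt_symmₗ hy]

lemma comp_ofCoord_comp {φ : A x →ₗ[ℝ] B y} (hx : x ∈ e.baseSet) (hy : y ∈ e'.baseSet)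
    {Ψ : FB →L[ℝ] FA}
    (h : (homCoord e e' x y φ : FA →ₗ[ℝ] FB) ∘ₗ (Ψ : FB →ₗ[ℝ] FA) ∘ₗ
      (homCoord e e' x y φ : FA →ₗ[ℝ] FB) = homCoord e e' x y φ) :
    φ ∘ₗ ofCoord e' e y x Ψ ∘ₗ φ = φ := by
  refine LinearMap.ext fun v => ?_
  have h1 := LinearMap.congr_fun h (e.linearMapAt ℝ x v)
  simp only [LinearMap.comp_apply, ContinuousLinearMap.coe_coe, homCoord_apply,
    e.symmₗ_linearMapAt hx] at h1
  have h2 := congrArg (e'.symmₗ ℝ y) h1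
  rw [e'.symmₗ_linearMapAt hy, e'.symmₗ_linearMapAt hy] at h2
  exact h2

end

variable [FiniteDimensional ℝ FB]
  [ContMDiffVectorBundle ∞ FA A 𝓘(ℝ, EA)] [ContMDiffVectorBundle ∞ FB B 𝓘(ℝ, EB)]

/-- Near a point, a smooth family of linear maps of constant rank has a smooth generalized inverse.
In trivializations it is `Ψ₀ (1 + (Φ - Φ₀) Ψ₀)⁻¹`, where `Ψ₀` is a generalized inverse of the value
`Φ₀` of the family `Φ` at that point. -/
lemma exists_isOpen_generalizedInverse (ha : ContMDiff 𝓘(ℝ, EN) 𝓘(ℝ, EA) ∞ a)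
    (hb : ContMDiff 𝓘(ℝ, EN) 𝓘(ℝ, EB) ∞ b) (hφ : ∀ n, SmoothHomAt FA FB EN φ n)
    {r : ℕ} (hr : ∀ n, Module.finrank ℝ (LinearMap.range (φ n)) = r) (p : N) :
    ∃ U : Set N, IsOpen U ∧ p ∈ U ∧ ∃ ψ : ∀ n, B (b n) →ₗ[ℝ] A (a n),
      ∀ n ∈ U, SmoothHomAt FB FA EN ψ n ∧ φ n ∘ₗ ψ n ∘ₗ φ n = φ n := by
  set e := trivializationAt FA A (a p) with he
  set e' := trivializationAt FB B (b p) with he'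
  have hpa : a p ∈ e.baseSet := mem_baseSet_trivializationAt FA A (a p)
  have hpb : b p ∈ e'.baseSet := mem_baseSet_trivializationAt FB B (b p)
  set Φ : N → FA →L[ℝ] FB := fun n => homCoord e e' (a n) (b n) (φ n) with hΦ
  have hΦs : ∀ n, a n ∈ e.baseSet → b n ∈ e'.baseSet →
      ContMDiffAt 𝓘(ℝ, EN) 𝓘(ℝ, FA →L[ℝ] FB) ∞ Φ n := fun n hna hnb =>
    contMDiffAt_homCoord_of ha.contMDiffAt hb.contMDiffAt (mem_baseSet_trivializationAt FA A _) hna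
      (mem_baseSet_trivializationAt FB B _) hnb (hφ n)
  obtain ⟨Ψ', hΨ'⟩ := LinearMap.exists_generalizedInverse (Φ p : FA →ₗ[ℝ] FB)
  set Ψ₀ : FB →L[ℝ] FA := LinearMap.toContinuousLinearMap Ψ' with hΨ₀
  set S : N → FB →L[ℝ] FB := fun n => 1 + (Φ n - Φ p) ∘L Ψ₀ with hS
  have hSs : ∀ n, a n ∈ e.baseSet → b n ∈ e'.baseSet →
      ContMDiffAt 𝓘(ℝ, EN) 𝓘(ℝ, FB →L[ℝ] FB) ∞ S n := fun n hna hnb =>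
    contMDiffAt_const.add (((hΦs n hna hnb).sub contMDiffAt_const).clm_comp contMDiffAt_const)
  have hSp : IsUnit (S p) := by
    have : S p = 1 := by simp [hS]
    rw [this]
    exact isUnit_one
  have hev : ∀ᶠ n in nhds p, a n ∈ e.baseSet ∧ b n ∈ e'.baseSet ∧ IsUnit (S n) :=
    (ha.continuous.continuousAt.eventually (e.open_baseSet.mem_nhds hpa)).and
      ((hb.continuous.continuousAt.eventually (e'.open_baseSet.mem_nhds hpb)).and
        ((hSs p hpa hpb).continuousAt.eventually (Units.isOpen.mem_nhds hSp)))
  obtain ⟨U, hU, hUo, hpU⟩ := eventually_nhds_iff.1 hev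
  refine ⟨U, hUo, hpU, fun n => ofCoord e' e (b n) (a n) (Ψ₀ ∘L Ring.inverse (S n)), ?_⟩
  intro n hn
  obtain ⟨hna, hnb, hu⟩ := hU n hn
  constructor
  · refine contMDiffAt_homCoord_of (e := e') (e' := e) hb.contMDiffAt ha.contMDiffAt hnb
      (mem_baseSet_trivializationAt FB B _) hna (mem_baseSet_trivializationAt FA A _) ?_
    have hinv : ContMDiffAt 𝓘(ℝ, EN) 𝓘(ℝ, FB →L[ℝ] FB) ∞ (fun n => Ring.inverse (S n)) n := by
      obtain ⟨w, hw⟩ := hu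
      have h := contDiffAt_ringInverse ℝ (n := ∞) w
      rw [hw] at h
      exact ContDiffAt.comp_contMDiffAt h (hSs n hna hnb)
    refine ((contMDiffAt_const (c := Ψ₀)).clm_comp hinv).congr_of_eventuallyEq ?_
    filter_upwards [hUo.mem_nhds hn] with m hm
    exact homCoord_ofCoord e' e (hU m hm).2.1 (hU m hm).1 _
  · refine comp_ofCoord_comp e e' hna hnb ?_
    refine LinearMap.generalizedInverse_of_rank_eq (f₀ := (Φ p : FA →ₗ[ℝ] FB)) (g₀ := Ψ')
      (T := (Ring.inverse (S n) : FB →L[ℝ] FB)) hΨ' ?_ ?_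
    · have := Ring.inverse_mul_cancel _ hu
      exact congrArg (fun L : FB →L[ℝ] FB => (L : FB →ₗ[ℝ] FB)) this
    · rw [finrank_range_homCoord e e' hna hnb, finrank_range_homCoord e e' hpa hpb, hr, hr]

/-- A smooth family of linear maps of constant rank over a manifold has a smooth generalized
inverse: local ones exist, and convex combinations of generalized inverses are such again. -/
theorem exists_smooth_generalizedInverse [FiniteDimensional ℝ EN] [IsManifold 𝓘(ℝ, EN) ∞ N]
    [T2Space N] [SigmaCompactSpace N] (ha : ContMDiff 𝓘(ℝ, EN) 𝓘(ℝ, EA) ∞ a)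
    (hb : ContMDiff 𝓘(ℝ, EN) 𝓘(ℝ, EB) ∞ b) (hφ : ∀ n, SmoothHomAt FA FB EN φ n)
    {r : ℕ} (hr : ∀ n, Module.finrank ℝ (LinearMap.range (φ n)) = r) :
    ∃ ψ : ∀ n, B (b n) →ₗ[ℝ] A (a n),
      (∀ n, SmoothHomAt FB FA EN ψ n) ∧ ∀ n, φ n ∘ₗ ψ n ∘ₗ φ n = φ n := by
  choose U hUo hpU ψ hψ using exists_isOpen_generalizedInverse ha hb hφ hr
  obtain ⟨ρ, hρ⟩ := SmoothPartitionOfUnity.exists_isSubordinate 𝓘(ℝ, EN) isClosed_univ U hUo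
    (fun p _ => Set.mem_iUnion.2 ⟨p, hpU p⟩)
  refine ⟨fun n => ∑ i ∈ ρ.finsupport n, ρ i n • ψ i n, fun n => ?_, fun n => ?_⟩
  · have key : ∀ i, n ∈ tsupport (ρ i) → ContMDiffAt 𝓘(ℝ, EN) 𝓘(ℝ, FB →L[ℝ] FA) ∞
        (fun m => homCoord (trivializationAt FB B (b n)) (trivializationAt FA A (a n)) (b m) (a m)
          (ψ i m)) n := fun i hi => (hψ i n (hρ i hi)).1
    refine (ρ.contMDiffAt_finsum key).congr_of_eventuallyEq
      (Filter.Eventually.of_forall fun m => ?_)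
    simp only [map_sum, map_smul]
    exact ρ.sum_finsupport_smul_eq_finsum m (fun i m => homCoord (trivializationAt FB B (b n))
      (trivializationAt FA A (a n)) (b m) (a m) (ψ i m))
  · have h : ∀ i ∈ ρ.finsupport n, ρ i n • (φ n ∘ₗ ψ i n ∘ₗ φ n) = ρ i n • φ n := by
      intro i hi
      rw [(hψ i n (hρ i (subset_tsupport _ ((ρ.mem_finsupport n).1 hi)))).2]
    calc φ n ∘ₗ (∑ i ∈ ρ.finsupport n, ρ i n • ψ i n) ∘ₗ φ n
        = ∑ i ∈ ρ.finsupport n, ρ i n • (φ n ∘ₗ ψ i n ∘ₗ φ n) := by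
          ext v
          simp [LinearMap.sum_apply]
      _ = φ n := by
          rw [Finset.sum_congr rfl h, ← Finset.sum_smul, ρ.sum_finsupport n (Set.mem_univ n),
            one_smul]

end

end SmoothHom

/-! ### Local sections of submersions -/

/-- A submersion between manifolds without boundary has a smooth local section through each point:
in suitable charts it is a linear projection. -/
lemma Manifold.IsSubmersionAt.exists_localSection {E E' H H' X Y : Type*}
    [NormedAddCommGroup E] [NormedSpace ℝ E] [NormedAddCommGroup E'] [NormedSpace ℝ E']
    [TopologicalSpace H] [TopologicalSpace H'] {I : ModelWithCorners ℝ E H}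
    {J : ModelWithCorners ℝ E' H'} [I.Boundaryless] [J.Boundaryless]
    [TopologicalSpace X] [ChartedSpace H X] [TopologicalSpace Y] [ChartedSpace H' Y]
    {f : X → Y} {x : X} (h : IsSubmersionAt I J ∞ f x) :
    ∃ q : Y → X, q (f x) = x ∧ ContMDiffAt J I ∞ q (f x) ∧ ∀ᶠ y in nhds (f x), f (q y) = y := by
  set z : Y → E := fun y => h.equiv.symm
    (h.codChart.extend J y, (h.equiv (h.domChart.extend I x)).2) with hz
  have hx := h.mem_domChart_source
  have hfx := h.mem_codChart_source
  have hxt : h.domChart.extend I x ∈ (h.domChart.extend I).target :=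
    (h.domChart.extend I).map_source (by rwa [OpenPartialHomeomorph.extend_source])
  have hzx : z (f x) = h.domChart.extend I x := by
    have h1 := h.writtenInCharts hxt
    simp only [Function.comp_apply, h.domChart.extend_left_inv hx] at h1
    rw [hz]
    simp only [h1]
    exact h.equiv.symm_apply_apply _
  have hzs : ContMDiffAt J 𝓘(ℝ, E) ∞ z (f x) := by
    have h1 := h.codChart.contMDiffAt_extend h.codChart_mem_maximalAtlas hfx
    exact h.equiv.symm.contDiff.contMDiff.contMDiffAt.comp (f x)
      (h1.prodMk_space contMDiffAt_const)
  have htar : (h.domChart.extend I).target ∈ nhds (z (f x)) := by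
    rw [hzx]
    exact (h.domChart.isOpen_extend_target).mem_nhds hxt
  refine ⟨fun y => (h.domChart.extend I).symm (z y), ?_, ?_, ?_⟩
  · simp only [hzx, h.domChart.extend_left_inv hx]
  · have h1 := contMDiffOn_extend_symm h.domChart_mem_maximalAtlas
    have h2 : I '' h.domChart.target = (h.domChart.extend I).target := by
      rw [OpenPartialHomeomorph.extend_target, I.image_eq]
    rw [h2] at h1
    exact (h1.contMDiffAt htar).comp (f x) hzs
  · filter_upwards [hzs.continuousAt.eventually htar, h.codChart.open_source.mem_nhds hfx]
      with y hy hy'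
    have h1 := h.writtenInCharts hy
    simp only [Function.comp_apply, hz, h.equiv.apply_symm_apply] at h1
    have h2 : (h.domChart.extend I).symm (z y) ∈ h.domChart.source := by
      rw [← OpenPartialHomeomorph.extend_source (I := I)]
      exact (h.domChart.extend I).map_target hy
    exact (h.codChart.extend J).injOn
      (by rw [OpenPartialHomeomorph.extend_source]; exact h.source_subset_preimage_source h2)
      (by rwa [OpenPartialHomeomorph.extend_source]) h1

/-! ### Splittings of the source map and of the core-anchor -/

section VB

variable {EM EG : Type*} [NormedAddCommGroup EM] [NormedSpace ℝ EM]
  [NormedAddCommGroup EG] [NormedSpace ℝ EG]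
  {M G : Type*} [TopologicalSpace M] [ChartedSpace EM M] [TopologicalSpace G] [ChartedSpace EG G]

namespace VBGroupoid

open NerveStr

variable {𝒢 : LieGroupoid 𝓘(ℝ, EM) 𝓘(ℝ, EG) M G}
  {FE : Type*} [NormedAddCommGroup FE] [NormedSpace ℝ FE]
  {E : M → Type*} [∀ x, AddCommGroup (E x)] [∀ x, Module ℝ (E x)] [∀ x, TopologicalSpace (E x)]
  [TopologicalSpace (TotalSpace FE E)] [FiberBundle FE E] [VectorBundle ℝ FE E]
  {FV : Type*} [NormedAddCommGroup FV] [NormedSpace ℝ FV]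
  {V : G → Type*} [∀ g, AddCommGroup (V g)] [∀ g, Module ℝ (V g)] [∀ g, TopologicalSpace (V g)]
  [TopologicalSpace (TotalSpace FV V)] [FiberBundle FV V] [VectorBundle ℝ FV V]
  {𝒱 : VBGroupoid 𝒢 FE E FV V} {k : ℕ}

/-- Through `0_g` there is a curve of vectors in the total bundle whose source is the line `ε ↦ ε v`
in a given fibre. -/
lemma exists_curve_tot_s_eq_smul (g : G) (v : E (𝒢.s g)) : ∃ w : ℝ → TotalSpace FV V,
    w 0 = zeroSection FV V g ∧ ContMDiffAt 𝓘(ℝ, ℝ) (𝓘(ℝ, EG).prod 𝓘(ℝ, FV)) ∞ w 0 ∧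
      ∀ᶠ ε in nhds 0, 𝒱.tot.s (w ε) = ⟨𝒢.s g, ε • v⟩ := by
  obtain ⟨q, hq0, hqs, hq⟩ := (𝒱.tot.submersion_s.isSubmersionAt
    (zeroSection FV V g)).exists_localSection
  rw [𝒱.tot_s_zero] at hq0 hqs hq
  set γ : ℝ → TotalSpace FE E := fun ε => ⟨𝒢.s g, ε • v⟩ with hγ
  have hγ0 : γ 0 = zeroSection FE E (𝒢.s g) := by simp [hγ, zeroSection]
  set eE := trivializationAt FE E (𝒢.s g)
  have hγs : ContMDiffAt 𝓘(ℝ, ℝ) (𝓘(ℝ, EM).prod 𝓘(ℝ, FE)) ∞ γ 0 := by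
    rw [contMDiffAt_totalSpace]
    refine ⟨contMDiffAt_const, ?_⟩
    have : ContMDiffAt 𝓘(ℝ, ℝ) 𝓘(ℝ, FE) ∞ (fun ε : ℝ => ε • (eE ⟨𝒢.s g, v⟩).2) 0 :=
      (contDiff_id.smul contDiff_const).contMDiff.contMDiffAt
    exact this.congr_of_eventuallyEq (Filter.Eventually.of_forall fun ε =>
      (eE.linear ℝ (mem_baseSet_trivializationAt FE E _)).map_smul ε v)
  refine ⟨q ∘ γ, ?_, ContMDiffAt.comp 0 (by rwa [hγ0]) hγs,
    hγs.continuousAt.eventually (by rwa [hγ0])⟩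
  rw [Function.comp_apply, hγ0, hq0]

variable (𝒱) in
/-- The difference of the target and source maps on the fibre of the total bundle over a unit. -/
def unitAnchor (x : M) : V (𝒢.u x) →ₗ[ℝ] E x :=
  fibreCast (𝒢.t_u x) ∘ₗ 𝒱.trg (𝒢.u x) - fibreCast (𝒢.s_u x) ∘ₗ 𝒱.src (𝒢.u x)

lemma fibreCast_src_unit (x : M) (e : E x) :
    fibreCast (𝒢.s_u x) (𝒱.src (𝒢.u x) (𝒱.unit x e)) = e := by
  refine eq_of_mk_eq (F := FE) (A := E) ?_
  rw [mk_fibreCast, ← 𝒱.tot_s, ← 𝒱.tot_u, 𝒱.tot.s_u]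

lemma fibreCast_trg_unit (x : M) (e : E x) :
    fibreCast (𝒢.t_u x) (𝒱.trg (𝒢.u x) (𝒱.unit x e)) = e := by
  refine eq_of_mk_eq (F := FE) (A := E) ?_
  rw [mk_fibreCast, ← 𝒱.tot_t, ← 𝒱.tot_u, 𝒱.tot.t_u]

/-- The vector `v - 1_{src v}` of the core, for a vector `v` over a unit. -/
lemma src_sub_unit_src (x : M) (v : V (𝒢.u x)) :
    𝒱.src _ (v - 𝒱.unit x (fibreCast (𝒢.s_u x) (𝒱.src _ v))) = 0 := by
  rw [← fibreCast_eq_zero_iff (𝒢.s_u x), map_sub, map_sub, fibreCast_src_unit, sub_self]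

lemma fibreCast_trg_sub_unit_src (x : M) (v : V (𝒢.u x)) :
    fibreCast (𝒢.t_u x) (𝒱.trg _ (v - 𝒱.unit x (fibreCast (𝒢.s_u x) (𝒱.src _ v)))) =
      𝒱.unitAnchor x v := by
  rw [map_sub, map_sub, fibreCast_trg_unit]
  rfl

lemma unitAnchor_eq_of_src_eq_zero {x : M} {v : V (𝒢.u x)} (hv : 𝒱.src _ v = 0) :
    𝒱.unitAnchor x v = fibreCast (𝒢.t_u x) (𝒱.trg _ v) := by
  simp [unitAnchor, hv]

lemma range_unitAnchor (x : M) :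
    LinearMap.range (𝒱.unitAnchor x) = LinearMap.range (𝒱.coreAnchor x) := by
  ext e
  constructor
  · rintro ⟨v, rfl⟩
    exact ⟨⟨_, 𝒱.src_sub_unit_src x v⟩, 𝒱.fibreCast_trg_sub_unit_src x v⟩
  · rintro ⟨⟨c, hc⟩, rfl⟩
    exact ⟨c, unitAnchor_eq_of_src_eq_zero hc⟩

variable [FiniteDimensional ℝ FE] [ContMDiffVectorBundle ∞ FE E 𝓘(ℝ, EM)]
  [FiniteDimensional ℝ FV] [ContMDiffVectorBundle ∞ FV V 𝓘(ℝ, EG)]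

lemma smoothHomAt_src (g : G) : SmoothHomAt FV FE EG 𝒱.src g :=
  SmoothHomAt.of_bundleMap (a := id) 𝒱.tot.s 𝒱.tot.submersion_s.contMDiff contMDiffAt_id 𝒱.tot_s

/-- The source map is surjective on fibres: in trivializations, the derivative at `0` of a curve of
vectors through `0_g` with sources `ε v` is a vector in the fibre at `g` with source `v`. -/
lemma src_surjective (g : G) : Function.Surjective (𝒱.src g) := by
  intro v
  obtain ⟨w, hw0, hw, hws⟩ := 𝒱.exists_curve_tot_s_eq_smul g v
  set eE := trivializationAt FE E (𝒢.s g) with heE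
  set eV := trivializationAt FV V g with heV
  have hEg : 𝒢.s g ∈ eE.baseSet := mem_baseSet_trivializationAt FE E _
  have hVg : g ∈ eV.baseSet := mem_baseSet_trivializationAt FV V _
  have hwt := contMDiffAt_totalSpace.1 hw
  rw [hw0, zeroSection_proj, ← heV] at hwt
  obtain ⟨hwb, hwf⟩ := hwt
  have hpr : (w 0).proj = g := by rw [hw0, zeroSection_proj]
  have hA : ContMDiffAt 𝓘(ℝ, ℝ) 𝓘(ℝ, FV →L[ℝ] FE) ∞
      (fun ε => homCoord eV eE (w ε).proj (𝒢.s (w ε).proj) (𝒱.src (w ε).proj)) 0 := by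
    refine ContMDiffAt.comp (g := fun n => homCoord eV eE n (𝒢.s n) (𝒱.src n)) (0 : ℝ) ?_ hwb
    rw [hpr]
    exact 𝒱.smoothHomAt_src g
  have hpt : ∀ (p : TotalSpace FV V) (ε : ℝ), 𝒱.tot.s p = ⟨𝒢.s g, ε • v⟩ → p.proj ∈ eV.baseSet →
      homCoord eV eE p.proj (𝒢.s p.proj) (𝒱.src p.proj) (eV p).2 =
        ε • (eE ⟨𝒢.s g, v⟩).2 := by
    rintro ⟨n, x⟩ ε hp hn
    have hs : 𝒢.s n = 𝒢.s g := by
      rw [𝒱.tot_s] at hp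
      exact congrArg TotalSpace.proj hp
    have h1 : (eE ⟨𝒢.s g, ε • v⟩).2 = ε • (eE ⟨𝒢.s g, v⟩).2 := (eE.linear ℝ hEg).map_smul ε v
    rw [homCoord_apply, eV.symmₗ_apply hn, eV.symm_apply_apply_mk hn,
      eE.coe_linearMapAt_of_mem (by rw [hs]; exact hEg), ← h1, ← hp, 𝒱.tot_s]
  have hev : ∀ᶠ ε in nhds (0 : ℝ), homCoord eV eE (w ε).proj (𝒢.s (w ε).proj)
      (𝒱.src (w ε).proj) (eV (w ε)).2 = ε • (eE ⟨𝒢.s g, v⟩).2 := by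
    have h2 : ∀ᶠ ε in nhds (0 : ℝ), (w ε).proj ∈ eV.baseSet := by
      refine hwb.continuousAt.eventually (eV.open_baseSet.mem_nhds ?_)
      simp only [hpr]
      exact hVg
    filter_upwards [hws, h2] with ε hε hε' using hpt _ _ hε hε'
  have hd1 := ((contMDiffAt_iff_contDiffAt.1 hA).differentiableAt (by simp)).hasDerivAt
  have hd2 := ((contMDiffAt_iff_contDiffAt.1 hwf).differentiableAt (by simp)).hasDerivAt
  have hd3 : HasDerivAt (fun ε : ℝ => ε • (eE ⟨𝒢.s g, v⟩).2) (eE ⟨𝒢.s g, v⟩).2 0 := by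
    simpa using (hasDerivAt_id (0 : ℝ)).smul_const (eE ⟨𝒢.s g, v⟩).2
  have hd := ((hd1.clm_apply hd2).congr_of_eventuallyEq (hev.mono fun ε h => h.symm)).unique hd3
  have hz : (eV (w 0)).2 = 0 := by
    rw [hw0]
    exact (eV.linear ℝ hVg).map_zero
  generalize deriv (fun ε => (eV (w ε)).2) 0 = β' at hd
  rw [hz, map_zero, zero_add] at hd
  generalize (w 0).proj = n at hd hpr
  subst hpr
  refine ⟨eV.symmₗ ℝ n β', ?_⟩
  rw [homCoord_apply, ← congrFun (eE.coe_linearMapAt_of_mem (R := ℝ) hEg) v] at hd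
  have := congrArg (eE.symmₗ ℝ (𝒢.s n)) hd
  rwa [eE.symmₗ_linearMapAt hEg, eE.symmₗ_linearMapAt hEg] at this

/-- A smooth splitting of the source map. -/
lemma exists_smooth_srcSplitting [FiniteDimensional ℝ EG] [IsManifold 𝓘(ℝ, EG) ∞ G] [T2Space G]
    [SigmaCompactSpace G] (𝒱 : VBGroupoid 𝒢 FE E FV V) :
    ∃ h : ∀ g, E (𝒢.s g) →ₗ[ℝ] V g, (∀ g v, 𝒱.src g (h g v) = v) ∧
      ∀ {k : ℕ} {U : Set ((Fin (k + 1) → M) × (Fin k → G))} 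
        {e : ∀ σ : NerveStr 𝒢 k, E (𝒢.s σ.first)},
        SmoothFamilyOn EM FE (b := fun σ => 𝒢.s σ.first) e U →
          SmoothFamilyOn EG FV (fun σ => h σ.first (e σ)) U := by
  have hr : ∀ g, Module.finrank ℝ (LinearMap.range (𝒱.src g)) = Module.finrank ℝ FE := by
    intro g
    rw [LinearMap.range_eq_top.2 (𝒱.src_surjective g), finrank_top]
    exact ((trivializationAt FE E (𝒢.s g)).linearEquivAt ℝ _
      (mem_baseSet_trivializationAt FE E _)).finrank_eq
  obtain ⟨h, hs, hh⟩ := exists_smooth_generalizedInverse (a := id) (b := 𝒢.s) (φ := 𝒱.src)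
    contMDiff_id 𝒢.submersion_s.contMDiff 𝒱.smoothHomAt_src hr
  refine ⟨h, fun g v => ?_, fun he => ?_⟩
  · obtain ⟨w, rfl⟩ := 𝒱.src_surjective g v
    exact LinearMap.congr_fun (hh g) w
  · exact SmoothHomAt.smoothFamilyOn hs contMDiff_id (smoothOn_first _) he

lemma smoothHomAt_unitAnchor (x : M) : SmoothHomAt FV FE EM (a := 𝒢.u) (b := id) 𝒱.unitAnchor x :=
  SmoothHomAt.sub
    (SmoothHomAt.of_bundleMap 𝒱.tot.t 𝒱.tot.smooth_t 𝒢.smooth_u.contMDiffAt fun x v => by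
      rw [𝒱.tot_t]
      exact (mk_fibreCast FE (𝒢.t_u x) _).symm)
    (SmoothHomAt.of_bundleMap 𝒱.tot.s 𝒱.tot.submersion_s.contMDiff 𝒢.smooth_u.contMDiffAt
      fun x v => by
        rw [𝒱.tot_s]
        exact (mk_fibreCast FE (𝒢.s_u x) _).symm)

/-- The core-anchor of a regular VB-groupoid has a smooth splitting over its image: a smooth
generalized inverse `ψ` of the target minus the source map over the units, corrected by units to
take values in the core. -/
lemma exists_smooth_coreSplitting [FiniteDimensional ℝ EM] [IsManifold 𝓘(ℝ, EM) ∞ M] [T2Space M]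
    [SigmaCompactSpace M] (h𝒱 : 𝒱.IsRegular) :
    ∃ θ : ∀ x, E x →ₗ[ℝ] V (𝒢.u x), (∀ x e, 𝒱.src _ (θ x e) = 0) ∧
      (∀ x, ∀ e ∈ LinearMap.range (𝒱.coreAnchor x),
        fibreCast (𝒢.t_u x) (𝒱.trg _ (θ x e)) = e) ∧
      ∀ {k : ℕ} {U : Set ((Fin (k + 1) → M) × (Fin k → G))} {e : ∀ σ : NerveStr 𝒢 k, E (σ.obj 0)},
        SmoothFamilyOn EM FE (b := fun σ => σ.obj 0) e U →
          SmoothFamilyOn EG FV (b := fun σ => 𝒢.u (σ.obj 0)) (fun σ => θ (σ.obj 0) (e σ)) U := by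
  obtain ⟨r, hr⟩ := h𝒱
  have hr' : ∀ x, Module.finrank ℝ (LinearMap.range (𝒱.unitAnchor x)) = r := fun x => by
    rw [range_unitAnchor, hr]
  obtain ⟨ψ, hψs, hψ⟩ := exists_smooth_generalizedInverse (a := 𝒢.u) (b := id)
    (φ := 𝒱.unitAnchor) 𝒢.smooth_u contMDiff_id 𝒱.smoothHomAt_unitAnchor hr'
  refine ⟨fun x => ψ x - 𝒱.unit x ∘ₗ fibreCast (𝒢.s_u x) ∘ₗ 𝒱.src _ ∘ₗ ψ x,
    fun x e => 𝒱.src_sub_unit_src x (ψ x e), fun x e he => ?_, fun {k U e} he => ?_⟩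
  · rw [← range_unitAnchor] at he
    obtain ⟨v, rfl⟩ := he
    exact (𝒱.fibreCast_trg_sub_unit_src x _).trans (LinearMap.congr_fun (hψ x) v)
  · have h1 : SmoothFamilyOn EG FV (b := fun σ : NerveStr 𝒢 k => 𝒢.u (σ.obj 0))
        (fun σ => ψ (σ.obj 0) (e σ)) U :=
      SmoothHomAt.smoothFamilyOn (A := E) (a := id) (f := fun σ : NerveStr 𝒢 k => σ.obj 0)
        hψs 𝒢.smooth_u (smoothOn_obj 0 U) he
    have h2 : SmoothFamilyOn EG FV (b := fun σ : NerveStr 𝒢 k => 𝒢.u (σ.obj 0))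
        (fun σ => 𝒱.unit _ (fibreCast (𝒢.s_u _) (𝒱.src _ (ψ (σ.obj 0) (e σ))))) U := by
      have h3 := SmoothOn.comp 𝒱.tot.smooth_u
        (SmoothOn.comp 𝒱.tot.submersion_s.contMDiff h1)
      have h4 : ∀ σ : NerveStr 𝒢 k, 𝒱.tot.u (𝒱.tot.s ⟨𝒢.u (σ.obj 0), ψ (σ.obj 0) (e σ)⟩) =
          ⟨_, 𝒱.unit _ (fibreCast (𝒢.s_u _) (𝒱.src _ (ψ (σ.obj 0) (e σ))))⟩ := fun σ => by
        rw [𝒱.tot_s, ← mk_fibreCast FE (𝒢.s_u (σ.obj 0)), 𝒱.tot_u]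
      simp only [h4] at h3
      exact h3
    have h5 := h1.comb (-1) h2
    have h6 : ((fun σ : NerveStr 𝒢 k => ψ (σ.obj 0) (e σ)) + (-1 : ℝ) • fun σ : NerveStr 𝒢 k =>
        𝒱.unit _ (fibreCast (𝒢.s_u _) (𝒱.src _ (ψ (σ.obj 0) (e σ))))) = fun σ =>
        (ψ (σ.obj 0) - 𝒱.unit _ ∘ₗ fibreCast (𝒢.s_u _) ∘ₗ 𝒱.src _ ∘ₗ ψ (σ.obj 0)) (e σ) := by
      funext σ
      simp [sub_eq_add_neg]
    rwa [h6] at h5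

end VBGroupoid

end VB

/-! ### Smoothness of the operations on cochains -/

section NerveSmooth

variable {EM EG : Type*} [NormedAddCommGroup EM] [NormedSpace ℝ EM]
  [NormedAddCommGroup EG] [NormedSpace ℝ EG]
  {M G : Type*} [TopologicalSpace M] [ChartedSpace EM M] [TopologicalSpace G] [ChartedSpace EG G]

namespace NerveStr

variable {𝒢 : LieGroupoid 𝓘(ℝ, EM) 𝓘(ℝ, EG) M G} {k : ℕ}
  {U : Set ((Fin (k + 1) → M) × (Fin k → G))}

lemma SmoothOn.congr {E' H' N : Type*} [NormedAddCommGroup E'] [NormedSpace ℝ E']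
    [TopologicalSpace H'] {J : ModelWithCorners ℝ E' H'} [TopologicalSpace N] [ChartedSpace H' N]
    {f f' : NerveStr 𝒢 k → N} (hf : SmoothOn J f U) (h : ∀ σ, σ.embed ∈ U → f' σ = f σ) :
    SmoothOn J f' U := by
  obtain ⟨F, hF, hFs⟩ := hf
  refine ⟨Function.extend embed f' F, fun σ => embed_injective.extend_apply _ _ σ,
    hFs.congr ?_⟩
  rintro _ ⟨⟨σ, rfl⟩, hσ⟩
  rw [embed_injective.extend_apply, h σ hσ, hF]

variable {EB : Type*} [NormedAddCommGroup EB] [NormedSpace ℝ EB] {B : Type*} [TopologicalSpace B]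
  [ChartedSpace EB B] {F : Type*} [NormedAddCommGroup F] [NormedSpace ℝ F]
  {A : B → Type*} [∀ x, AddCommGroup (A x)] [∀ x, Module ℝ (A x)] [∀ x, TopologicalSpace (A x)]
  [TopologicalSpace (TotalSpace F A)] [FiberBundle F A] [VectorBundle ℝ F A]
  [ContMDiffVectorBundle ∞ F A 𝓘(ℝ, EB)] {b : NerveStr 𝒢 k → B}

lemma SmoothFamilyOn.smul {c : ∀ σ : NerveStr 𝒢 k, A (b σ)} (hb : SmoothOn 𝓘(ℝ, EB) b U) (r : ℝ)
    (h : SmoothFamilyOn EB F c U) : SmoothFamilyOn EB F (r • c) U := by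
  simpa using SmoothFamilyOn.comb r (SmoothFamilyOn.zero hb) h

lemma SmoothFamilyOn.sum {ι : Type*} {s : Finset ι} {c : ι → ∀ σ : NerveStr 𝒢 k, A (b σ)}
    (hb : SmoothOn 𝓘(ℝ, EB) b U) (h : ∀ i, SmoothFamilyOn EB F (c i) U) :
    SmoothFamilyOn EB F (∑ i ∈ s, c i) U :=
  Finset.sum_induction c (fun c => SmoothFamilyOn EB F c U)
    (fun _ _ h h' => by simpa using SmoothFamilyOn.comb 1 h h') (SmoothFamilyOn.zero hb)
    fun i _ => h i

end NerveStr

end NerveSmooth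

section VB

variable {EM EG : Type*} [NormedAddCommGroup EM] [NormedSpace ℝ EM]
  [NormedAddCommGroup EG] [NormedSpace ℝ EG]
  {M G : Type*} [TopologicalSpace M] [ChartedSpace EM M] [TopologicalSpace G] [ChartedSpace EG G]

namespace VBGroupoid

open NerveStr

variable {𝒢 : LieGroupoid 𝓘(ℝ, EM) 𝓘(ℝ, EG) M G}
  {FE : Type*} [NormedAddCommGroup FE] [NormedSpace ℝ FE]
  {E : M → Type*} [∀ x, AddCommGroup (E x)] [∀ x, Module ℝ (E x)] [∀ x, TopologicalSpace (E x)]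
  [TopologicalSpace (TotalSpace FE E)] [FiberBundle FE E] [VectorBundle ℝ FE E]
  {FV : Type*} [NormedAddCommGroup FV] [NormedSpace ℝ FV]
  {V : G → Type*} [∀ g, AddCommGroup (V g)] [∀ g, Module ℝ (V g)] [∀ g, TopologicalSpace (V g)]
  [TopologicalSpace (TotalSpace FV V)] [FiberBundle FV V] [VectorBundle ℝ FV V]
  {𝒱 : VBGroupoid 𝒢 FE E FV V} {k : ℕ}

lemma smoothOn_tot_mul {f f' : NerveStr 𝒢 k → TotalSpace FV V}
    {U : Set ((Fin (k + 1) → M) × (Fin k → G))}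
    (hf : SmoothOn (𝓘(ℝ, EG).prod 𝓘(ℝ, FV)) f U) (hf' : SmoothOn (𝓘(ℝ, EG).prod 𝓘(ℝ, FV)) f' U)
    (h : ∀ σ, 𝒱.tot.s (f σ) = 𝒱.tot.t (f' σ)) :
    SmoothOn (𝓘(ℝ, EG).prod 𝓘(ℝ, FV)) (fun σ => 𝒱.tot.mul (f σ) (f' σ)) U :=
  (hf.prodMk hf').comp_of_mem 𝒱.tot.smooth_mul h

lemma smoothOn_srcSec {c : ∀ σ : NerveStr 𝒢 (k + 1), V σ.first}
    (hc : SmoothFamilyOn EG FV c Set.univ) :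
    SmoothFamilyOn EM FE (b := fun σ : NerveStr 𝒢 k => σ.obj 0) (𝒱.srcSec k c) Set.univ :=
  ((SmoothOn.comp_consUnit hc).comp 𝒱.tot.submersion_s.contMDiff).congr fun σ _ =>
    𝒱.mk_srcSec c σ

lemma smoothOn_zeroSection_first :
    SmoothOn (𝓘(ℝ, EG).prod 𝓘(ℝ, FV)) (fun σ : NerveStr 𝒢 k => zeroSection FV V σ.first)
      Set.univ :=
  (smoothOn_first Set.univ).comp (contMDiff_zeroSection ℝ V)

/-- The source section of the differential of a cochain with vanishing source is, up to sign, its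
target section. -/
lemma srcSec_dVB_of_src_eq_zero {c : ∀ σ : NerveStr 𝒢 k, V σ.first}
    (hs : ∀ σ, 𝒱.src _ (c σ) = 0) :
    𝒱.srcSec k (𝒱.dVB k c) = (if k = 0 then (1 : ℝ) else -1) • 𝒱.trgSec k c := by
  cases k with
  | zero => rw [srcSec_dVB_zero hs, if_pos rfl, one_smul]
  | succ k =>
    obtain ⟨h1, h2⟩ := mem_projectable_of_src_eq_zero hs
    funext σ
    rw [srcSec_dVB_succ h1, h2, if_neg (Nat.succ_ne_zero k)]
    simp

variable [ContMDiffVectorBundle ∞ FV V 𝓘(ℝ, EG)]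

lemma mem_CVB_zero_iff {α : ∀ σ : NerveStr 𝒢 0, V σ.first} :
    α ∈ 𝒱.CVB 0 ↔ SmoothFamilyOn EG FV α Set.univ ∧ ∀ σ, 𝒱.src _ (α σ) = 0 := Iff.rfl

lemma mem_CVB_succ_iff {c : ∀ σ : NerveStr 𝒢 (k + 1), V σ.first} :
    c ∈ 𝒱.CVB (k + 1) ↔ SmoothFamilyOn EG FV c Set.univ ∧ c ∈ 𝒱.projectable k := by
  rw [mem_projectable_iff_forall_face_eq]
  exact Iff.rfl

lemma mem_CVB_of_src_eq_zero {c : ∀ σ : NerveStr 𝒢 k, V σ.first}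
    (hc : SmoothFamilyOn EG FV c Set.univ) (hs : ∀ σ, 𝒱.src _ (c σ) = 0) : c ∈ 𝒱.CVB k := by
  cases k with
  | zero => exact ⟨hc, hs⟩
  | succ k => exact mem_CVB_succ_iff.2 ⟨hc, (mem_projectable_of_src_eq_zero hs).1⟩

lemma smoothFamilyOn_of_mem_CVB {c : ∀ σ : NerveStr 𝒢 k, V σ.first} (hc : c ∈ 𝒱.CVB k) :
    SmoothFamilyOn EG FV c Set.univ := by
  cases k with
  | zero => exact hc.1
  | succ k => exact hc.1

lemma dVB_mem_CVB {c : ∀ σ : NerveStr 𝒢 k, V σ.first} (hc : c ∈ 𝒱.CVB k) :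
    𝒱.dVB k c ∈ 𝒱.CVB (k + 1) := by
  have hs := smoothFamilyOn_of_mem_CVB hc
  cases k with
  | zero =>
    have hc' := (mem_CVB_zero_iff.1 hc).2
    refine mem_CVB_succ_iff.2 ⟨?_, dVB_zero_mem_projectable hc'⟩
    have hz : ∀ σ : NerveStr 𝒢 0, 𝒱.tot.s ⟨σ.first, c σ⟩ = zeroSection FE E (σ.obj 0) :=
      fun σ => tot_s_of_src_eq_zero (hc' σ)
    have h1 : ∀ σ : NerveStr 𝒢 1,
        𝒱.tot.s ⟨_, c (face 1 σ)⟩ = 𝒱.tot.t (zeroSection FV V σ.first) := fun σ => by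
      rw [hz, tot_t_zero, face_one_obj_zero]
    refine SmoothOn.congr (smoothOn_tot_mul (𝒱 := 𝒱) (smoothOn_tot_mul (𝒱 := 𝒱)
      (SmoothOn.comp_face 1 hs) smoothOn_zeroSection_first h1)
      ((SmoothOn.comp_face 0 hs).comp 𝒱.tot.smooth_inv) fun σ => ?_)
      fun σ _ => mk_dVB_zero hc' σ
    rw [𝒱.tot.s_mul _ _ (h1 σ), 𝒱.tot.t_inv, hz, tot_s_zero, face_zero_obj_zero]
  | succ k =>
    have hc' := (mem_CVB_succ_iff.1 hc).2
    refine mem_CVB_succ_iff.2 ⟨?_, dVB_succ_mem_projectable hc'⟩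
    have h0 : SmoothFamilyOn EG FV (𝒱.divFace k c) Set.univ := by
      refine SmoothOn.congr (smoothOn_tot_mul (𝒱 := 𝒱) (SmoothOn.comp_face 1 hs)
        ((SmoothOn.comp_face 0 hs).comp 𝒱.tot.smooth_inv) fun σ => ?_) fun σ _ => mk_divFace hc' σ
      rw [𝒱.tot.t_inv]
      exact tot_s_eq_of_mem_projectable hc' (face_zero_face_one σ)
    have hi : ∀ i, SmoothFamilyOn EG FV (pullFace 𝒢 V k i c) Set.univ := fun i =>
      SmoothOn.congr (SmoothOn.comp_face i.succ.succ hs) fun σ _ => mk_pullFace c i σ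
    rw [dVB_succ, ← neg_one_smul ℝ, add_comm ((-1 : ℝ) • 𝒱.divFace k c)]
    exact (SmoothFamilyOn.sum (smoothOn_first _) fun i => (hi i).smul (smoothOn_first _) _).comb
      (-1) h0

lemma rightMulZero_mem_CVB {κ : ∀ σ : NerveStr 𝒢 k, V (𝒢.u (σ.obj 0))}
    (hκ : SmoothFamilyOn EG FV (b := fun σ : NerveStr 𝒢 k => 𝒢.u (σ.obj 0)) κ Set.univ)
    (hs : ∀ σ, 𝒱.src _ (κ σ) = 0) : 𝒱.rightMulZero k κ ∈ 𝒱.CVB k := by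
  refine mem_CVB_of_src_eq_zero ?_ fun σ => src_rightMulZero (hs σ)
  refine SmoothOn.congr (smoothOn_tot_mul (𝒱 := 𝒱) hκ smoothOn_zeroSection_first fun σ => ?_)
    fun σ _ => mk_rightMulZero (hs σ)
  rw [tot_s_of_src_eq_zero (hs σ), tot_t_zero_first]

lemma rightDivZero_mem_CKer {c : ∀ σ : NerveStr 𝒢 k, V σ.first} (hc : c ∈ 𝒱.CVB k)
    (hs : ∀ σ, 𝒱.src _ (c σ) = 0) (ht : 𝒱.trgSec k c = 0) : 𝒱.rightDivZero k c ∈ 𝒱.CKer k := by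
  refine ⟨?_, fun σ => rightDivZero_mem_kerAnchor (hs σ) (congrFun ht σ)⟩
  refine SmoothOn.congr (smoothOn_tot_mul (𝒱 := 𝒱) (smoothFamilyOn_of_mem_CVB hc)
    (smoothOn_zeroSection_first.comp 𝒱.tot.smooth_inv) fun σ => ?_)
    fun σ _ => mk_rightDivZero (hs σ)
  rw [𝒱.tot.t_inv, tot_s_eq_tot_s_zero (hs σ)]

lemma src_of_mem_CKer {κ : ∀ σ : NerveStr 𝒢 k, V (𝒢.u (σ.obj 0))} (hκ : κ ∈ 𝒱.CKer k)
    (σ : NerveStr 𝒢 k) : 𝒱.src _ (κ σ) = 0 :=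
  (mem_kerAnchor_iff.1 (hκ.2 σ)).1

lemma srcProj_mem_CCoker [ContMDiffVectorBundle ∞ FE E 𝓘(ℝ, EM)]
    {c : ∀ σ : NerveStr 𝒢 (k + 1), V σ.first}
    (hc : c ∈ 𝒱.CVB (k + 1)) : 𝒱.srcProj k c ∈ 𝒱.CCoker k := fun _ =>
  ⟨Set.univ, isOpen_univ, trivial, 𝒱.srcSec k c, smoothOn_srcSec hc.1, fun _ _ => rfl⟩

/-! ### The exact sequence of cochain spaces -/

lemma dVB_dVB {c : ∀ σ : NerveStr 𝒢 k, V σ.first} (hc : c ∈ 𝒱.CVB k) :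
    𝒱.dVB (k + 1) (𝒱.dVB k c) = 0 := by
  cases k with
  | zero => exact dVB_dVB_zero hc.2
  | succ k => exact dVB_dVB_succ (mem_CVB_succ_iff.1 hc).2

/-- A cochain with vanishing source whose differential has vanishing source is the right
multiple by zero elements of a cochain with values in `𝔨`. -/
lemma exists_rightMulZero_eq {c : ∀ σ : NerveStr 𝒢 k, V σ.first} (hc : c ∈ 𝒱.CVB k)
    (hs : ∀ σ, 𝒱.src _ (c σ) = 0) (hd : 𝒱.srcSec k (𝒱.dVB k c) = 0) :
    ∃ κ ∈ 𝒱.CKer k, 𝒱.rightMulZero k κ = c := by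
  refine ⟨𝒱.rightDivZero k c, rightDivZero_mem_CKer hc hs ?_, rightMulZero_rightDivZero hs⟩
  rw [srcSec_dVB_of_src_eq_zero hs] at hd
  refine (smul_eq_zero.1 hd).resolve_left ?_
  split_ifs <;> norm_num

variable [ContMDiffVectorBundle ∞ FE E 𝓘(ℝ, EM)]
  [FiniteDimensional ℝ FE] [FiniteDimensional ℝ FV]
  [FiniteDimensional ℝ EM] [IsManifold 𝓘(ℝ, EM) ∞ M] [T2Space M] [SigmaCompactSpace M]

/-- A cochain whose source takes values in the image of the core-anchor becomes a cochain with
vanishing source when the differential of a cochain with vanishing source is subtracted: the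
splitting of the core-anchor provides the latter. -/
lemma exists_srcSec_sub_dVB_eq_zero (h𝒱 : 𝒱.IsRegular) {c : ∀ σ : NerveStr 𝒢 (k + 1), V σ.first}
    (hc : c ∈ 𝒱.CVB (k + 1)) (hp : 𝒱.srcProj k c = 0) :
    ∃ c' ∈ 𝒱.CVB k, (∀ σ, 𝒱.src _ (c' σ) = 0) ∧ 𝒱.srcSec k (c - 𝒱.dVB k c') = 0 := by
  obtain ⟨θ, hθ, hθ', hθs⟩ := exists_smooth_coreSplitting h𝒱
  set κ : ∀ σ : NerveStr 𝒢 k, V (𝒢.u (σ.obj 0)) := fun σ => θ _ (𝒱.srcSec k c σ) with hκ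
  have hκs : ∀ σ, 𝒱.src _ (κ σ) = 0 := fun σ => hθ _ _
  have hr : 𝒱.rightMulZero k κ ∈ 𝒱.CVB k := rightMulZero_mem_CVB (hθs (smoothOn_srcSec hc.1)) hκs
  have ht : 𝒱.trgSec k (𝒱.rightMulZero k κ) = 𝒱.srcSec k c := by
    funext σ
    refine eq_of_mk_eq (F := FE) (A := E) ?_
    rw [mk_trgSec_rightMulZero (hκs σ), 𝒱.tot_t, ← mk_fibreCast FE (𝒢.t_u (σ.obj 0))]
    exact congrArg (TotalSpace.mk _)
      (hθ' _ _ ((Submodule.Quotient.mk_eq_zero _).1 (congrFun hp σ)))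
  set ε : ℝ := if k = 0 then (1 : ℝ) else -1 with hε
  have hs : ∀ σ, 𝒱.src _ ((ε • 𝒱.rightMulZero k κ) σ) = 0 := fun σ => by
    rw [Pi.smul_apply, map_smul, src_rightMulZero (hκs σ), smul_zero]
  refine ⟨ε • 𝒱.rightMulZero k κ, Submodule.smul_mem _ _ hr, hs, ?_⟩
  have hεε : ε * ε = 1 := by
    rw [hε]
    split_ifs <;> norm_num
  rw [map_sub, srcSec_dVB_of_src_eq_zero hs, ← hε, map_smul, smul_smul, hεε, one_smul, ht, sub_self]

/-- Every cochain with values in `𝔩` is the source projection of a VB-cochain. -/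
lemma exists_srcProj_eq [FiniteDimensional ℝ EG] [IsManifold 𝓘(ℝ, EG) ∞ G] [T2Space G]
    [SigmaCompactSpace G] (h𝒱 : 𝒱.IsRegular) {ξ : ∀ σ : NerveStr 𝒢 k, 𝒱.Coker (σ.obj 0)}
    (hξ : ξ ∈ 𝒱.CCoker k) : ∃ c ∈ 𝒱.CVB (k + 1), 𝒱.srcProj k c = ξ := by
  obtain ⟨θ, hθ, hθ', hθs⟩ := exists_smooth_coreSplitting h𝒱
  obtain ⟨h, hh, hhs⟩ := exists_smooth_srcSplitting 𝒱
  -- the projection `P = 1 - ∂ θ` along the image of `∂` descends to a splitting of `E → 𝔩`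
  set P : ∀ x, E x →ₗ[ℝ] E x := fun x =>
    LinearMap.id - fibreCast (𝒢.t_u x) ∘ₗ 𝒱.trg _ ∘ₗ θ x with hP
  have hPr : ∀ x, ∀ e ∈ LinearMap.range (𝒱.coreAnchor x), P x e = 0 := fun x e he =>
    sub_eq_zero.2 (hθ' x e he).symm
  have hPq : ∀ x e, (Submodule.Quotient.mk (P x e) : 𝒱.Coker x) = Submodule.Quotient.mk e :=
    fun x e => (Submodule.Quotient.eq _).2 (by
      have h1 : P x e - e = -fibreCast (𝒢.t_u x) (𝒱.trg _ (θ x e)) := by simp [hP]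
      rw [h1]
      exact Submodule.neg_mem _ ⟨⟨θ x e, hθ x e⟩, rfl⟩)
  choose e₀ he₀ using fun σ => Submodule.Quotient.mk_surjective _ (ξ σ)
  set e : ∀ σ : NerveStr 𝒢 k, E (σ.obj 0) := fun σ => P _ (e₀ σ) with he
  have hes : SmoothFamilyOn EM FE (b := fun σ : NerveStr 𝒢 k => σ.obj 0) e Set.univ := by
    refine SmoothOn.of_locally fun σ => ?_
    obtain ⟨U, hU, hσ, e', he', hξe'⟩ := hξ σ
    refine ⟨U, hU, hσ, ?_⟩
    have h1 : SmoothFamilyOn EM FE (b := fun σ : NerveStr 𝒢 k => σ.obj 0)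
        (fun σ => fibreCast (𝒢.t_u _) (𝒱.trg _ (θ _ (e' σ)))) U :=
      ((hθs he').comp 𝒱.tot.smooth_t).congr fun τ _ => by
        rw [𝒱.tot_t]
        exact mk_fibreCast FE (𝒢.t_u (τ.obj 0)) _
    refine (he'.comb (-1) h1).congr fun τ hτ => ?_
    have h2 : e τ = P _ (e' τ) := by
      rw [he, ← sub_eq_zero, ← map_sub]
      exact hPr _ _ ((Submodule.Quotient.eq _).1 ((he₀ τ).trans (hξe' τ hτ)))
    rw [h2]
    simp [hP, sub_eq_add_neg]
  have hs : ∀ σ : NerveStr 𝒢 (k + 1), (face 0 σ).obj 0 = 𝒢.s σ.first := face_zero_obj_zero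
  set c : ∀ σ : NerveStr 𝒢 (k + 1), V σ.first := fun σ =>
    h σ.first (fibreCast (hs σ) (e (face 0 σ))) with hc
  have hcs : ∀ σ, 𝒱.tot.s ⟨σ.first, c σ⟩ = ⟨_, e (face 0 σ)⟩ := fun σ => by
    rw [𝒱.tot_s, hh, mk_fibreCast]
  refine ⟨c, mem_CVB_succ_iff.2 ⟨hhs ((SmoothOn.comp_face 0 hes).congr fun σ _ =>
    mk_fibreCast FE (hs σ) _), mem_projectable_iff_forall_face_eq.2 fun σ τ hστ => by
      rw [hcs, hcs, hστ]⟩, funext fun σ => ?_⟩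
  have hsec : 𝒱.srcSec k c σ = e σ := by
    have := (𝒱.mk_srcSec c σ).trans (hcs _)
    rw [face_zero_consUnit] at this
    exact eq_of_mk_eq this
  rw [srcProj_apply, hsec, he, hPq, he₀]

end VBGroupoid
end VB

/-! ### The long exact cohomology sequence -/

section LongExact

lemma cohomologyClass_eq_zero_iff {A : ℕ → Type*} [∀ k, AddCommGroup (A k)] [∀ k, Module ℝ (A k)]
    {C : ∀ k, Submodule ℝ (A k)} {d : ∀ k, A k →ₗ[ℝ] A (k + 1)} {k : ℕ} {x : cocycles C d k} :
    cohomologyClass C d k x = 0 ↔ (x : A k) ∈ coboundaries C d k :=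
  Submodule.Quotient.mk_eq_zero _

variable {A B L : ℕ → Type*} [∀ k, AddCommGroup (A k)] [∀ k, Module ℝ (A k)]
  [∀ k, AddCommGroup (B k)] [∀ k, Module ℝ (B k)] [∀ k, AddCommGroup (L k)] [∀ k, Module ℝ (L k)]
  {CA : ∀ k, Submodule ℝ (A k)} {dA : ∀ k, A k →ₗ[ℝ] A (k + 1)}
  {CB : ∀ k, Submodule ℝ (B k)} {dB : ∀ k, B k →ₗ[ℝ] B (k + 1)}
  {CL : ∀ k, Submodule ℝ (L k)} {dL : ∀ k, L k →ₗ[ℝ] L (k + 1)}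

/-- The map of cohomology spaces induced by a linear map of cochains. -/
def Cohomology.map {k l : ℕ} (f : A k →ₗ[ℝ] B l)
    (h : ∀ x ∈ cocycles CA dA k, f x ∈ cocycles CB dB l)
    (h' : ∀ x ∈ coboundaries CA dA k, f x ∈ coboundaries CB dB l) :
    Cohomology CA dA k →ₗ[ℝ] Cohomology CB dB l :=
  Submodule.mapQ _ _ (f.restrict h) fun x hx => h' x hx

variable (CA dA CB dB CL dL) in
/-- Maps `r : A → B` and `p : B → L` of cochain spaces, the latter of degree `-1`, that commute with
the differentials up to signs and form a sequence `0 → A → B → L → 0` that is exact up to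
coboundaries: `r` is injective, `p` is surjective, and an element of the kernel of `p` with
differential in the image of `r` lies in the image of `r` up to the coboundary of an element of `Z`,
a set of cochains that `p` kills. In degree `0`, where there is no `p`, an element of `B` with
differential in the image of `r` lies in the image of `r`. -/
structure IsShiftedExact (r : ∀ k, A k →ₗ[ℝ] B k) (p : ∀ k, B (k + 1) →ₗ[ℝ] L k)
    (Z : ∀ k, Set (B k)) (ε : ℕ → ℝ) : Prop where
  r_mem : ∀ {k} {x : A k}, x ∈ CA k → r k x ∈ CB k
  p_mem : ∀ {k} {y : B (k + 1)}, y ∈ CB (k + 1) → p k y ∈ CL k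
  dA_mem : ∀ {k} {x : A k}, x ∈ CA k → dA k x ∈ CA (k + 1)
  dB_mem : ∀ {k} {y : B k}, y ∈ CB k → dB k y ∈ CB (k + 1)
  dB_dB : ∀ {k} {y : B k}, y ∈ CB k → dB (k + 1) (dB k y) = 0
  ε_ne_zero : ∀ k, ε k ≠ 0
  dB_r : ∀ {k} {x : A k}, x ∈ CA k → dB k (r k x) = ε k • r (k + 1) (dA k x)
  p_dB_zero : ∀ {y : B 0}, y ∈ CB 0 → p 0 (dB 0 y) = 0
  p_dB_succ : ∀ {k} {y : B (k + 1)}, y ∈ CB (k + 1) → p (k + 1) (dB (k + 1) y) = -dL k (p k y)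
  p_r : ∀ {k} {x : A (k + 1)}, x ∈ CA (k + 1) → p k (r (k + 1) x) = 0
  r_injOn : ∀ {k} {x : A k}, x ∈ CA k → r k x = 0 → x = 0
  exists_p_eq : ∀ {k} {z : L k}, z ∈ CL k → ∃ y ∈ CB (k + 1), p k y = z
  p_of_mem : ∀ {k} {y : B (k + 1)}, y ∈ Z (k + 1) → p k y = 0
  exists_r_eq_zero : ∀ {y : B 0} {x : A 1}, y ∈ CB 0 → x ∈ CA 1 → dB 0 y = r 1 x →
    ∃ x' ∈ CA 0, y = r 0 x'
  exists_r_eq_succ : ∀ {k} {y : B (k + 1)} {x : A (k + 2)}, y ∈ CB (k + 1) → x ∈ CA (k + 2) →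
    dB (k + 1) y = r (k + 2) x → p k y = 0 →
      ∃ y' ∈ CB k, y' ∈ Z k ∧ ∃ x' ∈ CA (k + 1), y - dB k y' = r (k + 1) x'

namespace IsShiftedExact

variable {r : ∀ k, A k →ₗ[ℝ] B k} {p : ∀ k, B (k + 1) →ₗ[ℝ] L k} {Z : ∀ k, Set (B k)} {ε : ℕ → ℝ}
  (H : IsShiftedExact CA dA CB dB CL dL r p Z ε) {k : ℕ}

include H

lemma dA_eq_zero {x : A k} (hx : x ∈ CA k) (h : dB k (r k x) = 0) : dA k x = 0 := by
  rw [H.dB_r hx] at h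
  exact H.r_injOn (H.dA_mem hx) ((smul_eq_zero.1 h).resolve_left (H.ε_ne_zero k))

lemma mem_coboundaries_of_r_eq {x : A k} {x' : A (k + 1)} (hx : x ∈ CA k) (hx' : x' ∈ CA (k + 1))
    (h : r (k + 1) x' = dB k (r k x)) : x' ∈ coboundaries CA dA (k + 1) := by
  refine ⟨ε k • x, Submodule.smul_mem _ _ hx, ?_⟩
  have h1 := H.r_injOn (Submodule.sub_mem _ hx' (Submodule.smul_mem _ (ε k) (H.dA_mem hx)))
    (by rw [map_sub, map_smul, h, H.dB_r hx, sub_self])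
  rw [map_smul]
  exact (sub_eq_zero.1 h1).symm

lemma r_mem_cocycles {x : A k} (hx : x ∈ cocycles CA dA k) : r k x ∈ cocycles CB dB k := by
  refine ⟨H.r_mem hx.1, LinearMap.mem_ker.2 ?_⟩
  rw [H.dB_r hx.1, LinearMap.mem_ker.1 hx.2, map_zero, smul_zero]

lemma r_mem_coboundaries {x : A k} (hx : x ∈ coboundaries CA dA k) :
    r k x ∈ coboundaries CB dB k := by
  cases k with
  | zero =>
    obtain rfl : x = 0 := hx
    exact (map_zero (r 0)).symm ▸ Submodule.zero_mem _
  | succ k =>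
    obtain ⟨x, hx, rfl⟩ := hx
    refine ⟨(ε k)⁻¹ • r k x, Submodule.smul_mem _ _ (H.r_mem hx), ?_⟩
    rw [map_smul, H.dB_r hx, smul_smul, inv_mul_cancel₀ (H.ε_ne_zero k), one_smul]

lemma p_mem_cocycles_of_dB_eq {y : B (k + 1)} {x : A (k + 2)} (hy : y ∈ CB (k + 1))
    (hx : x ∈ CA (k + 2)) (h : dB (k + 1) y = r (k + 2) x) : p k y ∈ cocycles CL dL k := by
  refine ⟨H.p_mem hy, LinearMap.mem_ker.2 ?_⟩
  rw [← neg_eq_zero, ← H.p_dB_succ hy, h, H.p_r hx]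

lemma p_mem_cocycles {y : B (k + 1)} (hy : y ∈ cocycles CB dB (k + 1)) :
    p k y ∈ cocycles CL dL k :=
  H.p_mem_cocycles_of_dB_eq hy.1 (Submodule.zero_mem _)
    ((LinearMap.mem_ker.1 hy.2).trans (map_zero _).symm)

lemma p_mem_coboundaries {y : B (k + 1)} (hy : y ∈ coboundaries CB dB (k + 1)) :
    p k y ∈ coboundaries CL dL k := by
  obtain ⟨y, hy, rfl⟩ := hy
  cases k with
  | zero => exact H.p_dB_zero hy
  | succ k =>
    refine ⟨-p k y, Submodule.neg_mem _ (H.p_mem hy), ?_⟩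
    rw [H.p_dB_succ hy, map_neg]

/-- The elements of `A` that are connected to a cocycle `p y` of `L` are cocycles. -/
lemma mem_cocycles_of_dB_eq {y : B (k + 1)} {x : A (k + 2)} (hy : y ∈ CB (k + 1))
    (hx : x ∈ CA (k + 2)) (h : dB (k + 1) y = r (k + 2) x) : x ∈ cocycles CA dA (k + 2) :=
  ⟨hx, H.dA_eq_zero hx (by rw [← h, H.dB_dB hy])⟩

/-- Every cocycle of `L` lifts to an element of `B` with differential in the image of `r`. -/
lemma exists_p_eq_and_dB_eq {z : L k} (hz : z ∈ cocycles CL dL k) :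
    ∃ y ∈ CB (k + 1), ∃ x ∈ CA (k + 2), dB (k + 1) y = r (k + 2) x ∧ p k y = z := by
  obtain ⟨y, hy, rfl⟩ := H.exists_p_eq hz.1
  have h : p (k + 1) (dB (k + 1) y) = 0 := by
    rw [H.p_dB_succ hy, LinearMap.mem_ker.1 hz.2, neg_zero]
  obtain ⟨y', hy', hyZ, x, hx, h'⟩ := H.exists_r_eq_succ (H.dB_mem hy) (Submodule.zero_mem _)
    ((H.dB_dB hy).trans (map_zero _).symm) h
  exact ⟨y - y', Submodule.sub_mem _ hy hy', x, hx, by rw [map_sub, h'],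
    by rw [map_sub, H.p_of_mem hyZ, sub_zero]⟩

lemma exists_eq_dB_add_r {y : B (k + 1)} {x : A (k + 2)} (hy : y ∈ CB (k + 1))
    (hx : x ∈ CA (k + 2)) (h : dB (k + 1) y = r (k + 2) x) (hp : p k y ∈ coboundaries CL dL k) :
    ∃ y' ∈ CB k, ∃ x' ∈ CA (k + 1), y = dB k y' + r (k + 1) x' := by
  cases k with
  | zero =>
    obtain ⟨y', hy', -, x', hx', h'⟩ := H.exists_r_eq_succ hy hx h hp
    exact ⟨y', hy', x', hx', by rw [← h']; abel⟩
  | succ k =>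
    obtain ⟨z, hz, hz'⟩ := hp
    obtain ⟨w, hw, rfl⟩ := H.exists_p_eq hz
    obtain ⟨y', hy', -, x', hx', h'⟩ := H.exists_r_eq_succ (Submodule.add_mem _ hy (H.dB_mem hw))
      hx (by rw [map_add, H.dB_dB hw, h, add_zero])
      (by rw [map_add, H.p_dB_succ hw, hz', add_neg_cancel])
    exact ⟨y' - w, Submodule.sub_mem _ hy' hw, x', hx', by rw [← h', map_sub]; abel⟩

/-- If the cocycle `p y` is a coboundary, the cocycle connected to it is a coboundary. -/
lemma mem_coboundaries_of_dB_eq {y : B (k + 1)} {x : A (k + 2)} (hy : y ∈ CB (k + 1))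
    (hx : x ∈ CA (k + 2)) (h : dB (k + 1) y = r (k + 2) x) (hp : p k y ∈ coboundaries CL dL k) :
    x ∈ coboundaries CA dA (k + 2) := by
  obtain ⟨y', hy', x', hx', rfl⟩ := H.exists_eq_dB_add_r hy hx h hp
  refine H.mem_coboundaries_of_r_eq hx' hx ?_
  rw [← h, map_add, H.dB_dB hy', zero_add]

/-- The connecting map: the class of `p y` goes to the class of `x`, if `dB y = r x`. -/
lemma exists_connectingMap (k : ℕ) :
    ∃ K : Cohomology CL dL k →ₗ[ℝ] Cohomology CA dA (k + 2),
      ∀ (y : B (k + 1)) (hy : y ∈ CB (k + 1)) (x : A (k + 2)) (hx : x ∈ CA (k + 2))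
        (h : dB (k + 1) y = r (k + 2) x),
        K (cohomologyClass CL dL k ⟨p k y, H.p_mem_cocycles_of_dB_eq hy hx h⟩) =
          cohomologyClass CA dA (k + 2) ⟨x, H.mem_cocycles_of_dB_eq hy hx h⟩ := by
  -- the space of all pairs `(y, x)` as above, with its maps to the two cohomology spaces
  let D : Submodule ℝ (B (k + 1) × A (k + 2)) := (CB (k + 1)).prod (CA (k + 2)) ⊓
    LinearMap.eqLocus (dB (k + 1) ∘ₗ LinearMap.fst ℝ _ _) (r (k + 2) ∘ₗ LinearMap.snd ℝ _ _)
  let f : D →ₗ[ℝ] Cohomology CL dL k := cohomologyClass CL dL k ∘ₗ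
    LinearMap.codRestrict _ (p k ∘ₗ LinearMap.fst ℝ _ _ ∘ₗ D.subtype)
      fun w => H.p_mem_cocycles_of_dB_eq w.2.1.1 w.2.1.2 w.2.2
  let g : D →ₗ[ℝ] Cohomology CA dA (k + 2) := cohomologyClass CA dA (k + 2) ∘ₗ
    LinearMap.codRestrict _ (LinearMap.snd ℝ _ _ ∘ₗ D.subtype)
      fun w => H.mem_cocycles_of_dB_eq w.2.1.1 w.2.1.2 w.2.2
  have hf : LinearMap.range f = ⊤ := by
    refine LinearMap.range_eq_top.2 fun c => ?_
    obtain ⟨⟨z, hz⟩, rfl⟩ := Submodule.mkQ_surjective _ c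
    obtain ⟨y, hy, x, hx, h, rfl⟩ := H.exists_p_eq_and_dB_eq hz
    exact ⟨⟨(y, x), ⟨hy, hx⟩, h⟩, rfl⟩
  have hfg : ∀ w, f w = 0 → g w = 0 := fun w hw => cohomologyClass_eq_zero_iff.2
    (H.mem_coboundaries_of_dB_eq w.2.1.1 w.2.1.2 w.2.2 (cohomologyClass_eq_zero_iff.1 hw))
  obtain ⟨s, hs⟩ := f.exists_rightInverse_of_surjective hf
  refine ⟨g ∘ₗ s, fun y hy x hx h => ?_⟩
  let w : D := ⟨(y, x), ⟨hy, hx⟩, h⟩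
  change g (s (f w)) = g w
  rw [← sub_eq_zero, ← map_sub]
  refine hfg _ ?_
  rw [map_sub, sub_eq_zero]
  exact LinearMap.congr_fun hs (f w)

/-- The long exact cohomology sequence of a sequence of cochain spaces that is exact up to
coboundaries. -/
theorem exists_longExact :
    ∃ (r' : ∀ k, Cohomology CA dA k →ₗ[ℝ] Cohomology CB dB k)
      (p' : ∀ k, Cohomology CB dB (k + 1) →ₗ[ℝ] Cohomology CL dL k)
      (K : ∀ k, Cohomology CL dL k →ₗ[ℝ] Cohomology CA dA (k + 2)),
      (∀ (k : ℕ) (c : cocycles CA dA k), ∃ h : r k c ∈ cocycles CB dB k,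
          r' k (cohomologyClass _ _ k c) = cohomologyClass _ _ k ⟨r k c, h⟩) ∧
      (∀ (k : ℕ) (c : cocycles CB dB (k + 1)), ∃ h : p k c ∈ cocycles CL dL k,
          p' k (cohomologyClass _ _ (k + 1) c) = cohomologyClass _ _ k ⟨p k c, h⟩) ∧
      Function.Bijective (r' 0) ∧ Function.Injective (r' 1) ∧
      (∀ k, Function.Exact (r' (k + 1)) (p' k)) ∧
      (∀ k, Function.Exact (p' k) (K k)) ∧
      (∀ k, Function.Exact (K k) (r' (k + 2))) := by
  let r' : ∀ k, Cohomology CA dA k →ₗ[ℝ] Cohomology CB dB k := fun k =>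
    Cohomology.map (r k) (fun _ => H.r_mem_cocycles) fun _ => H.r_mem_coboundaries
  let p' : ∀ k, Cohomology CB dB (k + 1) →ₗ[ℝ] Cohomology CL dL k := fun k =>
    Cohomology.map (p k) (fun _ => H.p_mem_cocycles) fun _ => H.p_mem_coboundaries
  choose K hK using H.exists_connectingMap
  have hr : ∀ (k : ℕ) (c : cocycles CA dA k), r' k (cohomologyClass _ _ k c) =
    cohomologyClass _ _ k ⟨r k c, H.r_mem_cocycles c.2⟩ := fun _ _ => rfl
  have hp : ∀ (k : ℕ) (c : cocycles CB dB (k + 1)), p' k (cohomologyClass _ _ (k + 1) c) =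
    cohomologyClass _ _ k ⟨p k c, H.p_mem_cocycles c.2⟩ := fun _ _ => rfl
  refine ⟨r', p', K, fun k c => ⟨_, hr k c⟩, fun k c => ⟨_, hp k c⟩, ⟨?_, ?_⟩, ?_, fun k => ?_,
    fun k => ?_, fun k => ?_⟩
  · refine (injective_iff_map_eq_zero _).2 fun c hc => ?_
    obtain ⟨⟨x, hx⟩, rfl⟩ := Submodule.mkQ_surjective _ c
    exact cohomologyClass_eq_zero_iff.2 (H.r_injOn hx.1 (cohomologyClass_eq_zero_iff.1 hc))
  · intro c
    obtain ⟨⟨y, hy⟩, rfl⟩ := Submodule.mkQ_surjective _ c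
    obtain ⟨x, hx, rfl⟩ := H.exists_r_eq_zero hy.1 (Submodule.zero_mem _)
      ((LinearMap.mem_ker.1 hy.2).trans (map_zero _).symm)
    exact ⟨cohomologyClass _ _ 0 ⟨x, hx, H.dA_eq_zero hx hy.2⟩, rfl⟩
  · refine (injective_iff_map_eq_zero _).2 fun c hc => ?_
    obtain ⟨⟨x, hx⟩, rfl⟩ := Submodule.mkQ_surjective _ c
    obtain ⟨y, hy, h⟩ := cohomologyClass_eq_zero_iff.1 hc
    obtain ⟨x', hx', rfl⟩ := H.exists_r_eq_zero hy hx.1 h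
    exact cohomologyClass_eq_zero_iff.2 (H.mem_coboundaries_of_r_eq hx' hx.1 h.symm)
  · intro c
    constructor
    · intro hc
      obtain ⟨⟨y, hy⟩, rfl⟩ := Submodule.mkQ_surjective _ c
      obtain ⟨y', hy', x, hx, h⟩ := H.exists_eq_dB_add_r hy.1 (Submodule.zero_mem _)
        ((LinearMap.mem_ker.1 hy.2).trans (map_zero _).symm) (cohomologyClass_eq_zero_iff.1 hc)
      have hx' : dB (k + 1) (r (k + 1) x) = 0 := by
        have := LinearMap.mem_ker.1 hy.2
        rwa [h, map_add, H.dB_dB hy', zero_add] at this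
      refine ⟨cohomologyClass _ _ (k + 1) ⟨x, hx, H.dA_eq_zero hx hx'⟩, ?_⟩
      have hy'' : cohomologyClass CB dB (k + 1)
          (⟨r (k + 1) x, H.r_mem hx, hx'⟩ - ⟨y, hy⟩) = 0 := by
        refine cohomologyClass_eq_zero_iff.2 (⟨-y', Submodule.neg_mem _ hy', ?_⟩ :
          r (k + 1) x - y ∈ (CB k).map (dB k))
        rw [h, map_neg]
        abel
      rw [map_sub] at hy''
      exact sub_eq_zero.1 hy''
    · rintro ⟨c, rfl⟩
      obtain ⟨⟨x, hx⟩, rfl⟩ := Submodule.mkQ_surjective _ c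
      refine cohomologyClass_eq_zero_iff.2 ?_
      change p k (r (k + 1) x) ∈ _
      rw [H.p_r hx.1]
      exact Submodule.zero_mem _
  · intro c
    constructor
    · intro hc
      obtain ⟨⟨z, hz⟩, rfl⟩ := Submodule.mkQ_surjective _ c
      obtain ⟨y, hy, x, hx, h, rfl⟩ := H.exists_p_eq_and_dB_eq hz
      obtain ⟨x', hx', rfl⟩ := cohomologyClass_eq_zero_iff.1 ((hK k y hy x hx h).symm.trans hc)
      -- correct `y` by a multiple of `r x'` to obtain a cocycle
      have h' : dB (k + 1) (y - (ε (k + 1))⁻¹ • r (k + 1) x') = 0 := by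
        rw [map_sub, map_smul, H.dB_r hx', smul_smul, inv_mul_cancel₀ (H.ε_ne_zero _), one_smul, h,
          sub_self]
      refine ⟨cohomologyClass _ _ (k + 1) ⟨y - (ε (k + 1))⁻¹ • r (k + 1) x',
        Submodule.sub_mem _ hy (Submodule.smul_mem _ _ (H.r_mem hx')), h'⟩, ?_⟩
      refine (hp k _).trans (congrArg (cohomologyClass CL dL k) (Subtype.ext ?_))
      change p k (y - (ε (k + 1))⁻¹ • r (k + 1) x') = p k y
      rw [map_sub, map_smul, H.p_r hx', smul_zero, sub_zero]
    · rintro ⟨c, rfl⟩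
      obtain ⟨⟨y, hy⟩, rfl⟩ := Submodule.mkQ_surjective _ c
      refine (hK k y hy.1 0 (Submodule.zero_mem _)
        ((LinearMap.mem_ker.1 hy.2).trans (map_zero _).symm)).trans ?_
      exact cohomologyClass_eq_zero_iff.2 (Submodule.zero_mem _)
  · intro c
    constructor
    · intro hc
      obtain ⟨⟨x, hx⟩, rfl⟩ := Submodule.mkQ_surjective _ c
      obtain ⟨y, hy, h⟩ := cohomologyClass_eq_zero_iff.1 hc
      exact ⟨_, hK k y hy x hx.1 h⟩
    · rintro ⟨c, rfl⟩
      obtain ⟨⟨z, hz⟩, rfl⟩ := Submodule.mkQ_surjective _ c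
      obtain ⟨y, hy, x, hx, h, rfl⟩ := H.exists_p_eq_and_dB_eq hz
      have h1 := hK k y hy x hx h
      refine (congrArg (r' (k + 2)) h1).trans ?_
      exact cohomologyClass_eq_zero_iff.2 ⟨y, hy, h⟩

end IsShiftedExact

end LongExact

/-! ### The cochain spaces of a regular VB-groupoid -/

section VB

variable {EM EG : Type*} [NormedAddCommGroup EM] [NormedSpace ℝ EM]
  [NormedAddCommGroup EG] [NormedSpace ℝ EG]
  {M G : Type*} [TopologicalSpace M] [ChartedSpace EM M] [TopologicalSpace G] [ChartedSpace EG G]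

namespace VBGroupoid

open NerveStr

variable {𝒢 : LieGroupoid 𝓘(ℝ, EM) 𝓘(ℝ, EG) M G}
  {FE : Type*} [NormedAddCommGroup FE] [NormedSpace ℝ FE]
  {E : M → Type*} [∀ x, AddCommGroup (E x)] [∀ x, Module ℝ (E x)] [∀ x, TopologicalSpace (E x)]
  [TopologicalSpace (TotalSpace FE E)] [FiberBundle FE E] [VectorBundle ℝ FE E]
  {FV : Type*} [NormedAddCommGroup FV] [NormedSpace ℝ FV]
  {V : G → Type*} [∀ g, AddCommGroup (V g)] [∀ g, Module ℝ (V g)] [∀ g, TopologicalSpace (V g)]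
  [TopologicalSpace (TotalSpace FV V)] [FiberBundle FV V] [VectorBundle ℝ FV V]
  {𝒱 : VBGroupoid 𝒢 FE E FV V} {k : ℕ}

lemma srcProj_eq_zero_of_srcSec {c : ∀ σ : NerveStr 𝒢 (k + 1), V σ.first}
    (h : 𝒱.srcSec k c = 0) : 𝒱.srcProj k c = 0 := by
  funext σ
  rw [srcProj_apply, h]
  rfl

variable [ContMDiffVectorBundle ∞ FV V 𝓘(ℝ, EG)]

lemma dVB_rightMulZero {κ : ∀ σ : NerveStr 𝒢 k, V (𝒢.u (σ.obj 0))} (hκ : κ ∈ 𝒱.CKer k) :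
    𝒱.dVB k (𝒱.rightMulZero k κ) =
      (if k = 0 then (-1 : ℝ) else 1) • 𝒱.rightMulZero (k + 1) (𝒱.dKer k κ) := by
  cases k with
  | zero => rw [dVB_rightMulZero_zero hκ.2, if_pos rfl, neg_one_smul]
  | succ k => rw [dVB_rightMulZero_succ hκ.2, if_neg (Nat.succ_ne_zero k), one_smul]

lemma srcSec_rightMulZero {κ : ∀ σ : NerveStr 𝒢 (k + 1), V (𝒢.u (σ.obj 0))}
    (hκ : κ ∈ 𝒱.CKer (k + 1)) : 𝒱.srcSec k (𝒱.rightMulZero (k + 1) κ) = 0 :=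
  (mem_projectable_of_src_eq_zero fun σ => src_rightMulZero (src_of_mem_CKer hκ σ)).2

/-- The differential preserves `𝔨`-valued cochains: under right multiplication by zero elements,
`δ κ` corresponds to a cocycle with vanishing source, and these all come from `𝔨`. -/
lemma dKer_mem_CKer {κ : ∀ σ : NerveStr 𝒢 k, V (𝒢.u (σ.obj 0))} (hκ : κ ∈ 𝒱.CKer k) :
    𝒱.dKer k κ ∈ 𝒱.CKer (k + 1) := by
  have hs := src_dKer hκ.2
  set ε : ℝ := if k = 0 then (-1 : ℝ) else 1 with hε
  have hε0 : ε ≠ 0 := by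
    rw [hε]
    split_ifs <;> norm_num
  have hr : 𝒱.rightMulZero k κ ∈ 𝒱.CVB k := rightMulZero_mem_CVB hκ.1 (src_of_mem_CKer hκ)
  have h : 𝒱.rightMulZero (k + 1) (𝒱.dKer k κ) = ε⁻¹ • 𝒱.dVB k (𝒱.rightMulZero k κ) := by
    rw [dVB_rightMulZero hκ, smul_smul, inv_mul_cancel₀ hε0, one_smul]
  obtain ⟨κ', hκ', h'⟩ := exists_rightMulZero_eq (c := 𝒱.rightMulZero (k + 1) (𝒱.dKer k κ))
    (h ▸ Submodule.smul_mem _ _ (dVB_mem_CVB hr)) (fun σ => src_rightMulZero (hs σ))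
    (by rw [h, map_smul, dVB_dVB hr, smul_zero, map_zero])
  rwa [rightMulZero_injOn hs (src_of_mem_CKer hκ') h'.symm]

/-- Right multiplication by zero elements and the source projection satisfy the assumptions of the
long exact sequence, with the cochains of vanishing source as the distinguished set. -/
lemma isShiftedExact [ContMDiffVectorBundle ∞ FE E 𝓘(ℝ, EM)]
    [FiniteDimensional ℝ FE] [FiniteDimensional ℝ FV]
    [FiniteDimensional ℝ EM] [IsManifold 𝓘(ℝ, EM) ∞ M] [T2Space M] [SigmaCompactSpace M]
    [FiniteDimensional ℝ EG] [IsManifold 𝓘(ℝ, EG) ∞ G] [T2Space G] [SigmaCompactSpace G]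
    (h𝒱 : 𝒱.IsRegular) :
    IsShiftedExact 𝒱.CKer 𝒱.dKer 𝒱.CVB 𝒱.dVB 𝒱.CCoker 𝒱.dCoker 𝒱.rightMulZero 𝒱.srcProj
      (fun _ => {c | ∀ σ, 𝒱.src _ (c σ) = 0}) (fun k => if k = 0 then -1 else 1) where
  r_mem hκ := rightMulZero_mem_CVB hκ.1 (src_of_mem_CKer hκ)
  p_mem hc := srcProj_mem_CCoker hc
  dA_mem hκ := dKer_mem_CKer hκ
  dB_mem hc := dVB_mem_CVB hc
  dB_dB hc := dVB_dVB hc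
  ε_ne_zero k := by split_ifs <;> norm_num
  dB_r hκ := dVB_rightMulZero hκ
  p_dB_zero hc := srcProj_dVB_zero hc.2
  p_dB_succ hc := srcProj_dVB_succ (mem_CVB_succ_iff.1 hc).2
  p_r hκ := srcProj_eq_zero_of_srcSec (srcSec_rightMulZero hκ)
  r_injOn hκ h := rightMulZero_injOn (src_of_mem_CKer hκ) (fun _ => map_zero _)
    (h.trans (map_zero _).symm)
  exists_p_eq hξ := exists_srcProj_eq h𝒱 hξ
  p_of_mem hc := srcProj_eq_zero_of_srcSec (mem_projectable_of_src_eq_zero hc).2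
  exists_r_eq_zero hc hκ h := by
    obtain ⟨κ', hκ', h'⟩ := exists_rightMulZero_eq hc hc.2 (by rw [h, srcSec_rightMulZero hκ])
    exact ⟨κ', hκ', h'.symm⟩
  exists_r_eq_succ {k c κ} hc hκ h hp := by
    obtain ⟨c', hc', hs, hsec⟩ := exists_srcSec_sub_dVB_eq_zero h𝒱 hc hp
    have hmem : c - 𝒱.dVB k c' ∈ 𝒱.CVB (k + 1) := Submodule.sub_mem _ hc (dVB_mem_CVB hc')
    obtain ⟨κ', hκ', h'⟩ := exists_rightMulZero_eq hmem
      (src_eq_zero_of_srcSec (mem_CVB_succ_iff.1 hmem).2 hsec)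
      (by rw [map_sub, dVB_dVB hc', sub_zero, h, srcSec_rightMulZero hκ])
    exact ⟨c', hc', hs, κ', hκ', h'.symm⟩

end VBGroupoid
end VB

theorem mainTheorem6
    {EM EG FE FV : Type*}
    [NormedAddCommGroup EM] [NormedSpace ℝ EM] [FiniteDimensional ℝ EM]
    [NormedAddCommGroup EG] [NormedSpace ℝ EG] [FiniteDimensional ℝ EG]
    [NormedAddCommGroup FE] [NormedSpace ℝ FE] [FiniteDimensional ℝ FE]
    [NormedAddCommGroup FV] [NormedSpace ℝ FV] [FiniteDimensional ℝ FV]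
    {M : Type*} [TopologicalSpace M] [ChartedSpace EM M] [IsManifold 𝓘(ℝ, EM) ∞ M]
    [T2Space M] [SecondCountableTopology M]
    {G : Type*} [TopologicalSpace G] [ChartedSpace EG G] [IsManifold 𝓘(ℝ, EG) ∞ G]
    [T2Space G] [SecondCountableTopology G]
    {E : M → Type*} [∀ x, AddCommGroup (E x)] [∀ x, Module ℝ (E x)] [∀ x, TopologicalSpace (E x)]
    [TopologicalSpace (TotalSpace FE E)] [FiberBundle FE E] [VectorBundle ℝ FE E]
    [ContMDiffVectorBundle ∞ FE E 𝓘(ℝ, EM)]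
    {V : G → Type*} [∀ g, AddCommGroup (V g)] [∀ g, Module ℝ (V g)] [∀ g, TopologicalSpace (V g)]
    [TopologicalSpace (TotalSpace FV V)] [FiberBundle FV V] [VectorBundle ℝ FV V]
    [ContMDiffVectorBundle ∞ FV V 𝓘(ℝ, EG)]
    (𝒢 : LieGroupoid 𝓘(ℝ, EM) 𝓘(ℝ, EG) M G)
    (𝒱 : VBGroupoid 𝒢 FE E FV V) (h𝒱 : 𝒱.IsRegular) :
    ∃ (r : ∀ k, 𝒱.HKer k →ₗ[ℝ] 𝒱.HVB k)
      (p : ∀ k, 𝒱.HVB (k + 1) →ₗ[ℝ] 𝒱.HCoker k)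
      (K : ∀ k, 𝒱.HCoker k →ₗ[ℝ] 𝒱.HKer (k + 2)),
      -- `r` is induced by the right multiplication by zero elements
      (∀ (k : ℕ) (c : cocycles 𝒱.CKer 𝒱.dKer k),
        ∃ h : 𝒱.rightMulZero k c ∈ cocycles 𝒱.CVB 𝒱.dVB k,
          r k (cohomologyClass _ _ k c) = cohomologyClass _ _ k ⟨𝒱.rightMulZero k c, h⟩) ∧
      -- `p` is induced by the source projection
      (∀ (k : ℕ) (c : cocycles 𝒱.CVB 𝒱.dVB (k + 1)),
        ∃ h : 𝒱.srcProj k c ∈ cocycles 𝒱.CCoker 𝒱.dCoker k,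
          p k (cohomologyClass _ _ (k + 1) c) = cohomologyClass _ _ k ⟨𝒱.srcProj k c, h⟩) ∧
      -- the sequence is exact
      Function.Bijective (r 0) ∧ Function.Injective (r 1) ∧
      (∀ k, Function.Exact (r (k + 1)) (p k)) ∧
      (∀ k, Function.Exact (p k) (K k)) ∧
      (∀ k, Function.Exact (K k) (r (k + 2))) := by
  have : LocallyCompactSpace M := ChartedSpace.locallyCompactSpace EM M
  have : LocallyCompactSpace G := ChartedSpace.locallyCompactSpace EG G
  exact (VBGroupoid.isShiftedExact h𝒱).exists_longExact
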